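/- **Notation.** For real sequences $f,g$ write $f_k\lesssim g_k$ if there is $C>0$ with $f_k\le C g_k$ for all integers $k\ge 1$. For a positive sequence $N=(N_k)_{k\ge0}$ put $\nu_0:=1$, $\nu_k:=N_k/N_{k-1}$ $(k\ge1)$; the quotients of $\dot N$, $W$, $\dot W$ are denoted in the same way by $\dot\nu$, $\vartheta$, $\dot\vartheta$. **Weight functions.** A *weight function* is a continuous increasing (i.e. nondecreasing) function $\omega:[0,\infty)\to[0,\infty)$ with $\omega|_{[0,1]}=0$, $\lim_{t\to\infty}\omega(t)=\infty$, $\omega(2t)=O(\omega(t))$, $\omega(t)=O(t)$ and $\log t=o(\omega(t))$ as $t\to\infty$, and such that $\varphi(t):=\omega(e^t)$ is convex on $\mathbb R$. Let $\varphi^*(x):=\sup_{y\ge0}(xy-\varphi(y))$, $x\ge0$. The *associated weight matrix* is $\mathfrak W=\{W^x:x>0\}$, where $W^x_k:=\exp\big(\tfrac1x\varphi^*(xk)\big)$, $k\in\mathbb N=\{0,1,2,\dots\}$. The weight function $\omega$ is *admissible* if $\mathfrak N=\mathfrak W$ satisfies: 1. for all $N,\dot N\in\mathfrak N$: $\nu_k\lesssim\dot\nu_k$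 or $\dot\nu_k\lesssim\nu_k$; 2. $\sum_k 1/\nu_k<\infty$ for each $N\in\mathfrak N$; 3. for each $N\in\mathfrak N$ there is $C>0$ such that $\displaystyle\frac{\nu_{k+1}}{\nu_k}\le (C+1)+C\,\frac{\nu_{k+1}}{k+1}\sum_{j\ge k+1}\frac1{\nu_j}$ for all $k\in\mathbb N$; 4. for each $N\in\mathfrak N$ there is $\dot N\in\mathfrak N$ with $\nu_k\lesssim\dot N_k^{1/k}$; 5. for each $N\in\mathfrak N$ there is $\dot N\in\mathfrak N$ with $\nu_{2k}\lesssim\dot\nu_k$. **Function and jet spaces.** $\mathcal B^{\{\omega\}}(\mathbb R^n)$ is the set of real-valued $f\in C^\infty(\mathbb R^n)$ such that, for some integer $\rho\ge1$, $$\sup_{x\in\mathbb R^n,\ \alpha\in\mathbb N^n}|\partial^\alpha f(x)|\exp\big(-\tfrac1\rho\varphi^*(\rho|\alpha|)\big)<\infty .$$ For compact $E\subseteq\mathbb R^n$, a *jet* on $E$ is a family $F=(F^\alpha)_{\alpha\in\mathbb N^n}$ of continuous functions $F^\alpha:E\to\mathbb R$; for $a,x\in E$, $p\in\mathbb N$ and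 $|\alpha|\le p$ put $$(R^p_aF)^\alpha(x):=F^\alpha(x)-\sum_{|\beta|\le p-|\alpha|}\frac{(x-a)^\beta}{\beta!}F^{\alpha+\beta}(a).$$ $\mathcal B^{\{\omega\}}(E)$ is the set of all jets $F$ on $E$ for which there are $W\in\mathfrak W$ and $C,\rho>0$ with $$|F^\alpha(a)|\le C\rho^{|\alpha|}W_{|\alpha|}\quad(\alpha\in\mathbb N^n,\ a\in E),$$ $$|(R^p_aF)^\alpha(b)|\le C\rho^{p+1}W_{p+1}\frac{|b-a|^{p+1-|\alpha|}}{(p+1-|\alpha|)!}\quad(p\in\mathbb N,\ |\alpha|\le p,\ a,b\in E).$$ The *jet mapping* is $j_E^\infty(f):=(\partial^\alpha f|_E)_{\alpha\in\mathbb N^n}$. **Corollary 5.9.** Let $\omega$ be an admissible weight function with associated weight matrix $\mathfrak W$. Suppose that for every $W\in\mathfrak W$ there is $\dot W\in\mathfrak W$ with $$\sum_{\ell\ge k}\frac1{\dot\vartheta_\ell}\lesssim\frac{k}{\vartheta_k}.$$ Then for every $n$ and every compact set $E\subseteq\mathbb R^n$, the jet mapping $j_E^\infty$ maps $\mathcal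 B^{\{\omega\}}(\mathbb R^n)$ into $\mathcal B^{\{\omega\}}(E)$, and $$j_E^\infty:\mathcal B^{\{\omega\}}(\mathbb R^n)\to\mathcal B^{\{\omega\}}(E)$$ is surjective. -/

import Mathlib

open Filter Asymptotics Set
open scoped Topology Nat

noncomputable section

namespace Ultradiff

/-! ### Sequences -/

/-- `f ≲ g` for real sequences: there is a constant `C > 0` with `f k ≤ C g k` for all `k ≥ 1`. -/
def Dominated (f g : ℕ → ℝ) : Prop :=
  ∃ C : ℝ, 0 < C ∧ ∀ k : ℕ, 1 ≤ k → f k ≤ C * g k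

/-- The sequence of quotients `μ` of `M`: `μ 0 = 1` and `μ k = M k / M (k - 1)` for `k ≥ 1`. -/
def quot (M : ℕ → ℝ) : ℕ → ℝ
  | 0 => 1
  | k + 1 => M (k + 1) / M k

/-- The tail `∑_{ℓ ≥ k} 1 / μ_ℓ` of the series of reciprocals. It is only used for sequences
with `∑ 1 / μ_ℓ < ∞`. -/
def recipTail (μ : ℕ → ℝ) (k : ℕ) : ℝ := ∑' j : ℕ, 1 / μ (k + j)

/-- The conditions that make a weight matrix `𝔑` (a family of weight sequences `N`, with
quotients `ν = quot N`) admissible. -/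
structure IsAdmissibleMatrix (𝔑 : Set (ℕ → ℝ)) : Prop where
  total : ∀ N ∈ 𝔑, ∀ N' ∈ 𝔑, Dominated (quot N) (quot N') ∨ Dominated (quot N') (quot N)
  nonquasianalytic : ∀ N ∈ 𝔑, Summable fun k => 1 / quot N k
  quotient_growth : ∀ N ∈ 𝔑, ∃ C : ℝ, 0 < C ∧ ∀ k : ℕ,
    quot N (k + 1) / quot N k ≤
      (C + 1) + C * (quot N (k + 1) / ((k : ℝ) + 1)) * recipTail (quot N) (k + 1)
  root : ∀ N ∈ 𝔑, ∃ N' ∈ 𝔑, Dominated (quot N) fun k => N' k ^ (1 / (k : ℝ))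
  doubling : ∀ N ∈ 𝔑, ∃ N' ∈ 𝔑, Dominated (fun k => quot N (2 * k)) (quot N')

/-! ### Weight functions -/

/-- Weight functions `ω : [0, ∞) → [0, ∞)`; the values of `ω` at negative reals play no role.
Nonnegativity follows from `mono` and `zero`. -/
structure IsWeightFunction (ω : ℝ → ℝ) : Prop where
  cont : ContinuousOn ω (Ici 0)
  mono : MonotoneOn ω (Ici 0)
  zero : ∀ t ∈ Icc (0 : ℝ) 1, ω t = 0
  tendsto : Tendsto ω atTop atTop
  doubling : (fun t => ω (2 * t)) =O[atTop] ω
  linear : ω =O[atTop] fun t => t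
  log : Real.log =o[atTop] ω
  convex : ConvexOn ℝ univ fun t => ω (Real.exp t)

/-- The Young conjugate `φ*(x) = sup_{y ≥ 0} (x y - φ(y))`, `x ≥ 0`, of `φ(t) = ω(e^t)`. For a
weight function the supremum is finite, because `log t = o(ω(t))`. -/
def youngConj (ω : ℝ → ℝ) (x : ℝ) : ℝ :=
  ⨆ y : {y : ℝ // 0 ≤ y}, (x * y - ω (Real.exp y))

/-- The sequence `W^x_k = exp (φ*(x k) / x)`. -/
def weightSeq (ω : ℝ → ℝ) (x : ℝ) (k : ℕ) : ℝ :=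
  Real.exp (1 / x * youngConj ω (x * k))

/-- The weight matrix `𝔚 = {W^x : x > 0}` associated with `ω`. -/
def weightMatrix (ω : ℝ → ℝ) : Set (ℕ → ℝ) :=
  {W | ∃ x : ℝ, 0 < x ∧ W = weightSeq ω x}

/-- Admissible weight functions: the associated weight matrix is admissible. -/
structure IsAdmissibleWeight (ω : ℝ → ℝ) : Prop where
  isWeightFunction : IsWeightFunction ω
  admissible : IsAdmissibleMatrix (weightMatrix ω)

/-! ### Partial derivatives and jets -/

variable {n : ℕ}

/-- The first partial derivative `∂_i f` on `ℝⁿ`. -/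
def pderiv (i : Fin n) (f : EuclideanSpace ℝ (Fin n) → ℝ) : EuclideanSpace ℝ (Fin n) → ℝ :=
  fun x => fderiv ℝ f x (EuclideanSpace.single i 1)

/-- The partial derivative `∂^α f = ∂_1^{α_1} ⋯ ∂_n^{α_n} f` of multi-index `α`. -/
def mderiv (α : Fin n → ℕ) (f : EuclideanSpace ℝ (Fin n) → ℝ) : EuclideanSpace ℝ (Fin n) → ℝ :=
  (List.finRange n).foldr (fun i g => (pderiv i)^[α i] g) f

theorem contDiff_pderiv (i : Fin n) {f : EuclideanSpace ℝ (Fin n) → ℝ} (hf : ContDiff ℝ (⊤ : ℕ∞) f) :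
    ContDiff ℝ (⊤ : ℕ∞) (pderiv i f) :=
  (hf.fderiv_right (m := (⊤ : ℕ∞)) (by simp)).clm_apply contDiff_const

theorem contDiff_mderiv (α : Fin n → ℕ) {f : EuclideanSpace ℝ (Fin n) → ℝ}
    (hf : ContDiff ℝ (⊤ : ℕ∞) f) : ContDiff ℝ (⊤ : ℕ∞) (mderiv α f) := by
  have key : ∀ (i : Fin n) (m : ℕ) (g : EuclideanSpace ℝ (Fin n) → ℝ),
      ContDiff ℝ (⊤ : ℕ∞) g → ContDiff ℝ (⊤ : ℕ∞) ((pderiv i)^[m] g) := by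
    intro i m
    induction m with
    | zero => intro g hg; exact hg
    | succ m ih => intro g hg; exact ih _ (contDiff_pderiv i hg)
  unfold mderiv
  induction List.finRange n with
  | nil => exact hf
  | cons i l ih => exact key i _ _ ih

/-- `C^∞(ℝⁿ)`, the real-valued smooth functions on `ℝⁿ`. -/
abbrev SmoothFun (n : ℕ) : Type := {f : EuclideanSpace ℝ (Fin n) → ℝ // ContDiff ℝ (⊤ : ℕ∞) f}

/-- Jets `F = (F^α)_α` of continuous functions `F^α : E → ℝ`. -/
abbrev Jet (E : Set (EuclideanSpace ℝ (Fin n))) : Type := (Fin n → ℕ) → C(E, ℝ)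

/-- The jet mapping `j_E^∞ : f ↦ (∂^α f|_E)_α`. -/
def jetMap (E : Set (EuclideanSpace ℝ (Fin n))) (f : SmoothFun n) : Jet E :=
  fun α => ⟨fun x => mderiv α f.1 x, (contDiff_mderiv α f.2).continuous.comp continuous_subtype_val⟩

/-- The length `|α| = α_1 + ⋯ + α_n`. -/
def len (α : Fin n → ℕ) : ℕ := ∑ i, α i

/-- The remainder `(R_a^p F)^α(x) = F^α(x) - ∑_{|β| ≤ p - |α|} (x - a)^β / β! F^{α + β}(a)`,
used for `|α| ≤ p`. The sum is grouped according to the length `k = |β|`. -/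
def remainder {E : Set (EuclideanSpace ℝ (Fin n))} (F : Jet E) (p : ℕ) (α : Fin n → ℕ)
    (a x : E) : ℝ :=
  F α x - ∑ k ∈ Finset.range (p - len α + 1), ∑ β ∈ Finset.piAntidiag Finset.univ k,
    (∏ i, (x.1 i - a.1 i) ^ β i) / (∏ i, ((β i)! : ℝ)) * F (α + β) a

/-! ### Ultradifferentiable functions and Whitney jets -/

/-- The class `𝓑^{ω}(ℝⁿ)` of smooth functions with
`sup_{x, α} |∂^α f(x)| exp (- φ*(ρ |α|) / ρ) < ∞` for some positive integer `ρ`. -/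
def ultraFun (ω : ℝ → ℝ) (n : ℕ) : Set (SmoothFun n) :=
  {f | ∃ ρ : ℕ, 0 < ρ ∧ ∃ C : ℝ, ∀ (α : Fin n → ℕ) (x : EuclideanSpace ℝ (Fin n)),
    |mderiv α f.1 x| * Real.exp (-(1 / (ρ : ℝ) * youngConj ω (ρ * len α))) ≤ C}

/-- The class `𝓑^{M}(E)` of Whitney jets on `E` whose growth is controlled by the sequence `M`. -/
def whitneyJetSeq (M : ℕ → ℝ) (E : Set (EuclideanSpace ℝ (Fin n))) : Set (Jet E) :=
  {F | ∃ ρ : ℝ, 0 < ρ ∧ ∃ C : ℝ, 0 < C ∧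
    (∀ (α : Fin n → ℕ) (a : E), |F α a| ≤ C * ρ ^ len α * M (len α)) ∧
    (∀ (p : ℕ) (α : Fin n → ℕ), len α ≤ p → ∀ a b : E,
      |remainder F p α a b| ≤ C * ρ ^ (p + 1) * M (p + 1) *
        (‖(b : EuclideanSpace ℝ (Fin n)) - a‖ ^ (p + 1 - len α) / ((p + 1 - len α)! : ℝ)))}

/-- The class `𝓑^{ω}(E)` of Whitney jets: the union of the classes `𝓑^{W}(E)` over all `W` in the
weight matrix associated with `ω`. -/
def whitneyJet (ω : ℝ → ℝ) (E : Set (EuclideanSpace ℝ (Fin n))) : Set (Jet E) :=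
  {F | ∃ W ∈ weightMatrix ω, F ∈ whitneyJetSeq W E}

end Ultradiff

end

noncomputable section

namespace Ultradiff

/-! ### The weight matrix of a weight function -/

section Weights

variable {ω : ℝ → ℝ}

/-! Restriction is Taylor's formula on the segment between two points; the dimension only costs a
geometric factor (`abs_sub_sum_mon_mderiv_le`).

Extension glues Taylor polynomials of the jet whose degree depends on the scale. At scale `ε = 2 ^
(-s)` a neighbourhood of `E` carries a partition of unity by tensor products of cut-offs on a
uniform grid, and Taylor polynomials at nearby points of `E` are glued to `approx`. The degree is
the index minimising `∏_{i<k} l₁ i * η`, with `η` a fixed multiple of `ε`; Taylor polynomials at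
points of distance comparable to `ε` then differ by a multiple of the minimum `minProd l₁ η`. The
extension is the coarsest approximation plus the series of differences of consecutive ones. Each
difference is written as a double sum over both partitions (`glue`), so that only Taylor polynomials
at neighbouring points are compared and the estimates hold on all of `ℝⁿ`; no decomposition of the
complement of `E` is needed. Near `E` the series telescopes, and at `a ∈ E` its derivatives converge
to the jet (`exists_extension`).

The smallness has to beat the cost of the cut-offs. These are infinite convolutions of normalised
indicators of intervals, with equal widths up to the minimising index `K` of a sequence `l₂` and
widths proportional to `1 / μ i` afterwards. The tail hypothesis keeps the total width below `ε`,
and the derivatives grow like a sequence `M` of the matrix with constant a multiple of `1 / minProd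
l₂ (ε / e)` (`CutoffPair.exists_partition`).

The two sides are balanced by `minProd l₁ (B ε) ≤ C (minProd l₂ ε) ^ R`
(`exists_extension_weights`), a consequence of `W^x_{Rk} = (W^{Rx}_k)^R` and of the absorption of
geometric factors by the matrix. With `R = 2n + 2`, two partitions consume `2n` powers, the
derivatives of polynomials one, and the last one makes the series converge geometrically. The
sequences `l₁`, `l₂` are nondecreasing because the tail hypothesis and the doubling condition make
`ϑ_k / k` almost increasing up to a change of `W`; comparability of the quotients lets a single `M`
control all derivatives. -/

theorem IsWeightFunction.nonneg (hω : IsWeightFunction ω) {t : ℝ} (ht : 0 ≤ t) : 0 ≤ ω t := by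
  have h := hω.mono (mem_Ici.2 le_rfl) (mem_Ici.2 ht) ht
  rwa [hω.zero 0 (by simp)] at h

/-- Since `log t = o(ω t)`, eventually `φ(y) ≥ (|x| + 1) y`, so only bounded `y` can make the
expression positive. This makes `youngConj` a genuine supremum instead of the default value of `⨆`.
-/
theorem IsWeightFunction.bddAbove (hω : IsWeightFunction ω) (x : ℝ) :
    BddAbove (range fun y : {y : ℝ // 0 ≤ y} => x * y - ω (Real.exp y)) := by
  have hc : 0 < 1 / (|x| + 1) := by positivity
  obtain ⟨t₀, ht₀⟩ := eventually_atTop.1 (hω.log.bound hc)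
  refine ⟨|x| * |t₀|, ?_⟩
  rintro _ ⟨⟨y, hy⟩, rfl⟩
  have hpos := hω.nonneg (Real.exp_pos y).le
  simp only
  rcases le_total t₀ (Real.exp y) with h | h
  · have h1 := ht₀ _ h
    rw [Real.log_exp, Real.norm_of_nonneg hy, Real.norm_of_nonneg hpos] at h1
    have h2 : (|x| + 1) * y ≤ ω (Real.exp y) := by
      rwa [one_div, inv_mul_eq_div, le_div_iff₀ (by positivity), mul_comm] at h1
    have h3 : x * y ≤ |x| * y := mul_le_mul_of_nonneg_right (le_abs_self x) hy
    have : 0 ≤ |x| * |t₀| := by positivity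
    nlinarith
  · have h1 : y ≤ |t₀| := by
      have := Real.add_one_le_exp y
      linarith [le_abs_self t₀]
    have h3 : x * y ≤ |x| * y := mul_le_mul_of_nonneg_right (le_abs_self x) hy
    have h4 : |x| * y ≤ |x| * |t₀| := mul_le_mul_of_nonneg_left h1 (abs_nonneg x)
    linarith

theorem IsWeightFunction.le_youngConj (hω : IsWeightFunction ω) (x : ℝ) {y : ℝ} (hy : 0 ≤ y) :
    x * y - ω (Real.exp y) ≤ youngConj ω x :=
  le_ciSup (hω.bddAbove x) ⟨y, hy⟩

theorem youngConj_le {x c : ℝ} (h : ∀ y, 0 ≤ y → x * y - ω (Real.exp y) ≤ c) :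
    youngConj ω x ≤ c :=
  haveI : Nonempty {y : ℝ // 0 ≤ y} := ⟨⟨0, le_rfl⟩⟩
  ciSup_le fun y => h y y.2

theorem IsWeightFunction.youngConj_zero (hω : IsWeightFunction ω) : youngConj ω 0 = 0 := by
  apply le_antisymm
  · refine youngConj_le fun y _ => ?_
    have := hω.nonneg (Real.exp_pos y).le
    linarith
  · have := hω.le_youngConj 0 le_rfl
    simpa [hω.zero 1 (by simp)] using this

theorem weightSeq_pos (x : ℝ) (k : ℕ) : 0 < weightSeq ω x k := Real.exp_pos _

theorem IsWeightFunction.weightSeq_zero (hω : IsWeightFunction ω) (x : ℝ) :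
    weightSeq ω x 0 = 1 := by
  simp [weightSeq, hω.youngConj_zero]

/-- The exponent is the supremum of `k t - φ(t) / x`, which increases with `x` because `φ ≥ 0`. -/
theorem IsWeightFunction.weightSeq_mono (hω : IsWeightFunction ω) {x y : ℝ} (hx : 0 < x)
    (hxy : x ≤ y) (k : ℕ) : weightSeq ω x k ≤ weightSeq ω y k := by
  have hy : 0 < y := hx.trans_le hxy
  refine Real.exp_le_exp.2 ?_
  rw [one_div, inv_mul_le_iff₀ hx]
  refine youngConj_le fun t ht => ?_
  have h1 := hω.le_youngConj (y * k) ht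
  have h0 := hω.nonneg (Real.exp_pos t).le
  have h2 : x * k * t - ω (Real.exp t) ≤ x * (1 / y * (y * k * t - ω (Real.exp t))) := by
    have : x * (1 / y * (y * k * t - ω (Real.exp t))) =
        x * k * t - x / y * ω (Real.exp t) := by field_simp
    rw [this]
    have : x / y ≤ 1 := (div_le_one hy).2 hxy
    nlinarith
  refine h2.trans ?_
  gcongr

/-- Both exponents are `φ*(x R k) / x`. A power `R` of a weight is thus traded for a larger index
and a different parameter. -/
theorem weightSeq_mul (x : ℝ) (hx : 0 < x) (R : ℕ) (hR : 0 < R) (k : ℕ) :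
    weightSeq ω x (R * k) = weightSeq ω (R * x) k ^ R := by
  have : (R : ℝ) ≠ 0 := by positivity
  rw [weightSeq, weightSeq, ← Real.exp_nat_mul]
  congr 1
  push_cast
  rw [show x * (R * (k : ℝ)) = R * x * k by ring]
  field_simp

/-- `φ*` is a supremum of affine functions, hence convex. -/
theorem IsWeightFunction.weightSeq_logConvex (hω : IsWeightFunction ω) {x : ℝ} (hx : 0 < x)
    (k : ℕ) : weightSeq ω x (k + 1) * weightSeq ω x (k + 1) ≤
      weightSeq ω x k * weightSeq ω x (k + 2) := by
  simp only [weightSeq]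
  rw [← Real.exp_add, ← Real.exp_add, ← mul_add, ← mul_add]
  refine Real.exp_le_exp.2 (mul_le_mul_of_nonneg_left ?_ (by positivity))
  rw [← two_mul, ← le_div_iff₀' two_pos]
  refine youngConj_le fun y hy => ?_
  have h1 := hω.le_youngConj (x * k) hy
  have h2 := hω.le_youngConj (x * (k + 2 : ℕ)) hy
  push_cast at h1 h2 ⊢
  rw [le_div_iff₀' two_pos]
  linarith

/-- Weight sequences of a weight matrix absorb geometric factors. -/
theorem IsWeightFunction.exists_weightSeq_two_pow_mul (hω : IsWeightFunction ω) {x : ℝ}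
    (hx : 0 < x) : ∃ y, 0 < y ∧ ∃ C : ℝ, 0 < C ∧
      ∀ k : ℕ, 2 ^ k * weightSeq ω x k ≤ C * weightSeq ω y k := by
  obtain ⟨D, hDpos, hD⟩ := hω.doubling.exists_pos
  obtain ⟨t₀, ht₀⟩ := eventually_atTop.1 hD.bound
  set B := ω (2 * |t₀|) with hB
  have hB0 : 0 ≤ B := hω.nonneg (by positivity)
  have hbound : ∀ t, 0 ≤ t → ω (2 * t) ≤ D * ω t + B := by
    intro t ht
    have h0 := hω.nonneg ht
    rcases le_total t₀ t with h | h
    · have h1 := ht₀ t h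
      rw [Real.norm_of_nonneg h0, Real.norm_of_nonneg (hω.nonneg (by positivity))] at h1
      linarith
    · have h1 : ω (2 * t) ≤ B := hω.mono (mem_Ici.2 (by positivity)) (mem_Ici.2 (by positivity))
        (by linarith [le_abs_self t₀])
      have : 0 ≤ D * ω t := by positivity
      linarith
  -- Testing the conjugate at `y + log 2` and using `φ(y + log 2) ≤ D φ(y) + B` gives `D φ*(x k) + D
  -- x k log 2 - B ≤ φ*(D x k)`; division by `D x` yields the parameter and the constant.
  refine ⟨D * x, by positivity, Real.exp (B / (D * x)), Real.exp_pos _, fun k => ?_⟩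
  have h2 : (2 : ℝ) ^ k = Real.exp (k * Real.log 2) := by
    rw [Real.exp_nat_mul, Real.exp_log two_pos]
  rw [weightSeq, weightSeq, h2, ← Real.exp_add, ← Real.exp_add]
  refine Real.exp_le_exp.2 ?_
  rw [← le_sub_iff_add_le', one_div, inv_mul_le_iff₀ hx]
  refine youngConj_le fun y hy => ?_
  have hl : 0 ≤ Real.log 2 := Real.log_nonneg one_le_two
  have h1 := hω.le_youngConj (D * x * k) (add_nonneg hy hl)
  have h3 := hbound (Real.exp y) (Real.exp_pos y).le
  rw [show 2 * Real.exp y = Real.exp (y + Real.log 2) by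
    rw [Real.exp_add, Real.exp_log two_pos, mul_comm]] at h3
  have h4 : D * x * k * (y + Real.log 2) - (D * ω (Real.exp y) + B) ≤
    youngConj ω (D * x * k) := by linarith
  have h5 : D * (x * (B / (D * x) + 1 / (D * x) * youngConj ω (D * x * k) - k * Real.log 2)) =
    B + youngConj ω (D * x * k) - D * x * k * Real.log 2 := by field_simp
  rw [← mul_le_mul_iff_right₀ hDpos, h5]
  linarith

theorem IsWeightFunction.exists_weightSeq_pow_mul (hω : IsWeightFunction ω) {x : ℝ}
    (hx : 0 < x) (σ : ℝ) (hσ : 0 ≤ σ) : ∃ y, 0 < y ∧ ∃ C : ℝ, 0 < C ∧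
      ∀ k : ℕ, σ ^ k * weightSeq ω x k ≤ C * weightSeq ω y k := by
  have key : ∀ m : ℕ, ∃ y, 0 < y ∧ ∃ C : ℝ, 0 < C ∧
      ∀ k : ℕ, (2 ^ m : ℝ) ^ k * weightSeq ω x k ≤ C * weightSeq ω y k := by
    intro m
    induction m with
    | zero => exact ⟨x, hx, 1, one_pos, fun k => by simp⟩
    | succ m ih =>
      obtain ⟨y, hy, C, hC, h⟩ := ih
      obtain ⟨z, hz, C', hC', h'⟩ := hω.exists_weightSeq_two_pow_mul hy
      refine ⟨z, hz, C * C', by positivity, fun k => ?_⟩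
      calc (2 ^ (m + 1) : ℝ) ^ k * weightSeq ω x k
          = 2 ^ k * ((2 ^ m : ℝ) ^ k * weightSeq ω x k) := by ring
        _ ≤ 2 ^ k * (C * weightSeq ω y k) := mul_le_mul_of_nonneg_left (h k) (by positivity)
        _ = C * (2 ^ k * weightSeq ω y k) := by ring
        _ ≤ C * (C' * weightSeq ω z k) := mul_le_mul_of_nonneg_left (h' k) hC.le
        _ = _ := by ring
  obtain ⟨m, hm⟩ := pow_unbounded_of_one_lt σ (one_lt_two (α := ℝ))
  obtain ⟨y, hy, C, hC, h⟩ := key m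
  refine ⟨y, hy, C, hC, fun k => le_trans ?_ (h k)⟩
  have := (weightSeq_pos (ω := ω) x k).le
  gcongr

end Weights

/-! ### Logarithmically convex sequences -/

/-- Positive sequences `M` with `M 0 = 1` and nondecreasing quotients. -/
structure IsLogConvexSeq (M : ℕ → ℝ) : Prop where
  zero : M 0 = 1
  pos : ∀ k, 0 < M k
  mono : Monotone fun k => quot M (k + 1)

namespace IsLogConvexSeq

variable {M : ℕ → ℝ}

theorem quot_pos (hM : IsLogConvexSeq M) (k : ℕ) : 0 < quot M (k + 1) :=
  div_pos (hM.pos _) (hM.pos _)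

theorem succ (hM : IsLogConvexSeq M) (k : ℕ) : M (k + 1) = M k * quot M (k + 1) := by
  rw [quot, mul_div_cancel₀ _ (hM.pos k).ne']

theorem add (hM : IsLogConvexSeq M) (j k : ℕ) :
    M (j + k) = M j * ∏ i ∈ Finset.range k, quot M (j + i + 1) := by
  induction k with
  | zero => simp
  | succ k ih => rw [Finset.prod_range_succ, ← mul_assoc, ← ih, ← add_assoc, hM.succ]

theorem eq_prod (hM : IsLogConvexSeq M) (k : ℕ) :
    M k = ∏ i ∈ Finset.range k, quot M (i + 1) := by
  simpa [hM.zero] using hM.add 0 k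

theorem mul_le (hM : IsLogConvexSeq M) (j k : ℕ) : M j * M k ≤ M (j + k) := by
  rw [hM.add, hM.eq_prod k]
  have := (hM.pos j).le
  gcongr with i
  · exact fun i _ => (hM.quot_pos i).le
  · exact hM.mono (Nat.le_add_left i j)

end IsLogConvexSeq

theorem IsWeightFunction.isLogConvexSeq {ω : ℝ → ℝ} (hω : IsWeightFunction ω) {M : ℕ → ℝ}
    (hM : M ∈ weightMatrix ω) : IsLogConvexSeq M := by
  obtain ⟨x, hx, rfl⟩ := hM
  refine ⟨hω.weightSeq_zero x, weightSeq_pos x, monotone_nat_of_le_succ fun k => ?_⟩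
  have h := hω.weightSeq_logConvex hx k
  simp only [quot]
  rw [div_le_div_iff₀ (weightSeq_pos x _) (weightSeq_pos x _)]
  linarith

/-! ### Minima of `t_k ε^k` -/

/-- The first index `k` with `λ_k ε ≥ 1`. -/
def minIndex (l : ℕ → ℝ) (ε : ℝ) : ℕ := sInf {k | 1 ≤ l k * ε}

/-- The minimum over `k` of `∏_{i < k} λ_i ε`, where `λ` is nondecreasing and unbounded. -/
def minProd (l : ℕ → ℝ) (ε : ℝ) : ℝ := ∏ i ∈ Finset.range (minIndex l ε), (l i * ε)

/-- Positive, nondecreasing, unbounded sequences. -/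
structure IsGrowing (l : ℕ → ℝ) : Prop where
  pos : ∀ k, 0 < l k
  mono : Monotone l
  unbounded : ∀ B, ∃ k, B ≤ l k

namespace IsGrowing

variable {l : ℕ → ℝ} {ε : ℝ}

theorem one_le_of_minIndex_le (hl : IsGrowing l) (hε : 0 < ε) {k : ℕ} (hk : minIndex l ε ≤ k) :
    1 ≤ l k * ε := by
  have h : minIndex l ε ∈ {k | 1 ≤ l k * ε} := by
    apply Nat.sInf_mem
    obtain ⟨k, hk⟩ := hl.unbounded (1 / ε)
    exact ⟨k, by rwa [div_le_iff₀ hε] at hk⟩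
  exact le_trans h (mul_le_mul_of_nonneg_right (hl.mono hk) hε.le)

theorem lt_one_of_lt_minIndex {k : ℕ} (hk : k < minIndex l ε) : l k * ε < 1 := by
  by_contra! h
  exact absurd (Nat.sInf_le h : minIndex l ε ≤ k) (not_le.2 hk)

theorem minIndex_anti (hl : IsGrowing l) {ε' : ℝ} (hε : 0 < ε) (h : ε ≤ ε') :
    minIndex l ε' ≤ minIndex l ε :=
  Nat.sInf_le ((hl.one_le_of_minIndex_le hε le_rfl).trans
    (mul_le_mul_of_nonneg_left h (hl.pos _).le))

theorem minProd_pos (hl : IsGrowing l) (hε : 0 < ε) : 0 < minProd l ε :=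
  Finset.prod_pos fun i _ => mul_pos (hl.pos i) hε

theorem prod_anti (hl : IsGrowing l) (hε : 0 < ε) {j k : ℕ} (hjk : j ≤ k)
    (hk : k ≤ minIndex l ε) :
    ∏ i ∈ Finset.range k, (l i * ε) ≤ ∏ i ∈ Finset.range j, (l i * ε) := by
  obtain ⟨d, rfl⟩ := Nat.exists_eq_add_of_le hjk
  rw [Finset.prod_range_add]
  refine mul_le_of_le_one_right (Finset.prod_nonneg fun i _ => (mul_pos (hl.pos i) hε).le)
    (Finset.prod_le_one (fun i _ => (mul_pos (hl.pos _) hε).le) fun i hi => ?_)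
  have := Finset.mem_range.1 hi
  exact (lt_one_of_lt_minIndex (by omega)).le

/-- The factors are below one before `minIndex` and at least one from there on, so the partial
products decrease and then increase. -/
theorem minProd_le (hl : IsGrowing l) (hε : 0 < ε) (k : ℕ) :
    minProd l ε ≤ ∏ i ∈ Finset.range k, (l i * ε) := by
  rcases le_total k (minIndex l ε) with h | h
  · exact hl.prod_anti hε h le_rfl
  · obtain ⟨d, rfl⟩ := Nat.exists_eq_add_of_le h
    rw [Finset.prod_range_add]
    refine le_mul_of_one_le_right (hl.minProd_pos hε).le ?_
    rw [← Finset.prod_const_one (s := Finset.range d)]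
    exact Finset.prod_le_prod (fun _ _ => zero_le_one)
      fun i _ => hl.one_le_of_minIndex_le hε (Nat.le_add_right _ i)

theorem minProd_mono (hl : IsGrowing l) {ε' : ℝ} (hε : 0 < ε) (h : ε ≤ ε') :
    minProd l ε ≤ minProd l ε' := by
  refine (hl.minProd_le hε (minIndex l ε')).trans ?_
  unfold minProd
  gcongr with i
  · exact fun i _ => (mul_pos (hl.pos i) hε).le
  · exact (hl.pos i).le

theorem minProd_le_one (hl : IsGrowing l) (hε : 0 < ε) : minProd l ε ≤ 1 := by
  simpa using hl.minProd_le hε 0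

theorem minProd_le_mul (hl : IsGrowing l) (hε : 0 < ε) : minProd l ε ≤ l 0 * ε := by
  simpa using hl.minProd_le hε 1

end IsGrowing

/-! ### Sequences derived from an admissible weight function -/

/-- The relation between the sequences `l` and `M` that allows the construction of cut-off
functions in the class defined by `M` with bounds governed by `minProd l`. -/
def CutoffPair (l M : ℕ → ℝ) : Prop :=
  ∃ μ : ℕ → ℝ, ∃ C : ℝ, 0 < C ∧ (∀ i, 0 < μ i) ∧ (Summable fun i => 1 / μ i) ∧
    (∀ K, ∑' j, 1 / μ (K + j) ≤ C / l K) ∧ (∀ i, μ i ≤ C * quot M (i + 1)) ∧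
    ∀ i : ℕ, (i + 1) * l i ≤ C * quot M (i + 1)

theorem prod_succ_mul (l : ℕ → ℝ) (k : ℕ) :
    ∏ i ∈ Finset.range k, (((i : ℝ) + 1) * l i) = k ! * ∏ i ∈ Finset.range k, l i := by
  rw [Finset.prod_mul_distrib, ← Finset.prod_range_add_one_eq_factorial]
  push_cast
  rfl

theorem factorial_pow_le (R k : ℕ) : (k ! : ℝ) ^ R ≤ (R * k)! := by
  have := Nat.le_of_dvd (Nat.factorial_pos _)
    (Nat.prod_factorial_dvd_factorial_sum (Finset.range R) fun _ => k)
  simp only [Finset.prod_const, Finset.sum_const, Finset.card_range, smul_eq_mul] at this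
  exact_mod_cast this

section

variable {ω : ℝ → ℝ} (hω : IsAdmissibleWeight ω)
  (hstrong : ∀ W ∈ weightMatrix ω, ∃ W' ∈ weightMatrix ω,
    Dominated (recipTail (quot W')) (fun k => (k : ℝ) / quot W k))

include hω

theorem IsAdmissibleWeight.summable_quot_succ {W : ℕ → ℝ} (hW : W ∈ weightMatrix ω) :
    Summable fun k => 1 / quot W (k + 1) :=
  (summable_nat_add_iff 1).2 (hω.admissible.nonquasianalytic W hW)

/-- Otherwise `1 / ϑ_k ≥ 1 / (B k)`, and summability of the left side contradicts the divergence of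
the harmonic series. -/
theorem IsAdmissibleWeight.exists_le_quot_div {W : ℕ → ℝ} (hW : W ∈ weightMatrix ω) (B : ℝ) :
    ∃ k : ℕ, B ≤ quot W (k + 1) / (k + 1) := by
  have hWc := hω.isWeightFunction.isLogConvexSeq hW
  by_contra! h
  have hB : 0 < B := by
    refine lt_trans (div_pos (hWc.quot_pos 0) ?_) (h 0)
    simp
  have h1 : Summable fun k : ℕ => B * (1 / quot W (k + 1)) :=
    (hω.summable_quot_succ hW).mul_left B
  have h2 : Summable fun k : ℕ => 1 / ((k + 1 : ℕ) : ℝ) := by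
    refine h1.of_nonneg_of_le (fun k => by positivity) fun k => ?_
    have h3 := (h k).le
    have h4 := hWc.quot_pos k
    rw [div_le_iff₀ (by positivity)] at h3
    rw [mul_one_div, div_le_div_iff₀ (by positivity) h4]
    push_cast
    linarith
  exact Real.not_summable_one_div_natCast ((summable_nat_add_iff 1).1 h2)

include hstrong

/-- The tail of `∑ 1 / ν_ℓ` from `j + 1` contains `i + 1` terms of index at most `2 (i + 1)`, each
at least `1 / ν_{2(i+1)}`. The tail hypothesis therefore bounds `ϑ_{j+1} / (j + 1)` by a multiple of
`ν_{2(i+1)} / (i + 1)`, and the doubling condition removes the factor 2. -/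
theorem IsAdmissibleWeight.exists_quot_div_le {W : ℕ → ℝ} (hW : W ∈ weightMatrix ω) :
    ∃ W' ∈ weightMatrix ω, ∃ C : ℝ, 0 < C ∧ ∀ i j : ℕ, j ≤ i →
      quot W (j + 1) / (j + 1) ≤ C * quot W' (i + 1) / (i + 1) := by
  obtain ⟨V, hV, A, hA, hAV⟩ := hstrong W hW
  obtain ⟨W', hW', D, hD, hDW⟩ := hω.admissible.doubling V hV
  have hVc := hω.isWeightFunction.isLogConvexSeq hV
  have hWc := hω.isWeightFunction.isLogConvexSeq hW
  refine ⟨W', hW', A * D, by positivity, fun i j hji => ?_⟩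
  have h1 := hAV (j + 1) (by omega)
  have h2 : ((i : ℝ) + 1) / quot V (2 * (i + 1)) ≤ recipTail (quot V) (j + 1) := by
    have hs : Summable fun l => 1 / quot V (j + 1 + l) := by
      simpa only [add_comm] using
        (summable_nat_add_iff (j + 1)).2 (hω.admissible.nonquasianalytic V hV)
    refine le_trans ?_ (hs.sum_le_tsum (Finset.range (i + 1)) fun l _ => ?_)
    · rw [div_eq_mul_one_div]
      have : ∑ l ∈ Finset.range (i + 1), 1 / quot V (2 * (i + 1)) =
          ((i : ℝ) + 1) * (1 / quot V (2 * (i + 1))) := by simp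
      rw [← this]
      refine Finset.sum_le_sum fun l hl => ?_
      have hl' := Finset.mem_range.1 hl
      rw [show j + 1 + l = j + l + 1 by omega, show 2 * (i + 1) = 2 * i + 1 + 1 by omega]
      exact one_div_le_one_div_of_le (hVc.quot_pos _) (hVc.mono (by omega))
    · rw [show j + 1 + l = j + l + 1 by omega]
      exact (one_div_pos.2 (hVc.quot_pos _)).le
  have h3 := hDW (i + 1) (by omega)
  simp only at h1 h3
  have p1 : 0 < quot V (2 * (i + 1)) := hVc.quot_pos (2 * i + 1)
  have p2 := hWc.quot_pos j
  have h4 := h2.trans h1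
  push_cast at h4
  rw [← mul_div_assoc, div_le_div_iff₀ p1 p2] at h4
  rw [div_le_div_iff₀ (by positivity) (by positivity)]
  calc quot W (j + 1) * (i + 1) = (i + 1) * quot W (j + 1) := mul_comm _ _
    _ ≤ A * (j + 1) * quot V (2 * (i + 1)) := h4
    _ ≤ A * (j + 1) * (D * quot W' (i + 1)) := by gcongr
    _ = _ := by ring

/-- The sequence `l` is the running maximum of `ϑ_{j+1} / (j + 1)`; almost monotonicity keeps it
below the corresponding ratio of another member of the matrix. -/
theorem IsAdmissibleWeight.exists_growing {W : ℕ → ℝ} (hW : W ∈ weightMatrix ω) :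
    ∃ l : ℕ → ℝ, IsGrowing l ∧ (∀ i : ℕ, quot W (i + 1) ≤ (i + 1) * l i) ∧
      ∃ W' ∈ weightMatrix ω, ∃ C : ℝ, 0 < C ∧ ∀ i : ℕ, (i + 1) * l i ≤ C * quot W' (i + 1) := by
  obtain ⟨W', hW', C, hC, h⟩ := hω.exists_quot_div_le hstrong hW
  have hWc := hω.isWeightFunction.isLogConvexSeq hW
  set f : ℕ → ℝ := fun j => quot W (j + 1) / (j + 1) with hf
  refine ⟨partialSups f, ⟨fun k => ?_, (partialSups f).mono, fun B => ?_⟩, fun i => ?_,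
    W', hW', C, hC, fun i => ?_⟩
  · refine lt_of_lt_of_le ?_ (le_partialSups f k)
    exact div_pos (hWc.quot_pos k) (by positivity)
  · obtain ⟨k, hk⟩ := hω.exists_le_quot_div hW B
    exact ⟨k, hk.trans (le_partialSups f k)⟩
  · have := le_partialSups f i
    rw [← div_le_iff₀' (by positivity)]
    exact this
  · rw [← le_div_iff₀' (by positivity)]
    exact partialSups_le f i _ fun j hj => h i j hj

/-- A second use of the tail hypothesis, for the `V` that dominates `(i + 1) l i`, bounds the tail
of the reciprocal quotients of `V'` at `K + 1` by a multiple of `1 / l K`. The sequence `M` has to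
dominate `V` and `V'` at once; by totality one of the two does. -/
theorem IsAdmissibleWeight.exists_cutoffPair {W : ℕ → ℝ} (hW : W ∈ weightMatrix ω) :
    ∃ l : ℕ → ℝ, IsGrowing l ∧ (∀ i : ℕ, quot W (i + 1) ≤ (i + 1) * l i) ∧
      ∃ M ∈ weightMatrix ω, CutoffPair l M := by
  obtain ⟨l, hl, hWl, V, hV, C, hC, hlV⟩ := hω.exists_growing hstrong hW
  obtain ⟨V', hV', A, hA, hAV⟩ := hstrong V hV
  have hVc := hω.isWeightFunction.isLogConvexSeq hV
  have hVc' := hω.isWeightFunction.isLogConvexSeq hV'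
  refine ⟨l, hl, hWl, ?_⟩
  have htail : ∀ K, ∑' j, 1 / quot V' (K + j + 1) ≤ A * C / l K := by
    intro K
    have h1 := hAV (K + 1) (by omega)
    have h2 := hlV K
    have h3 : recipTail (quot V') (K + 1) = ∑' j, 1 / quot V' (K + j + 1) := by
      unfold recipTail
      congr 1
      ext j
      congr 2
      omega
    rw [← h3]
    refine h1.trans ?_
    rw [mul_div_assoc]
    refine mul_le_mul_of_nonneg_left ?_ hA.le
    rw [div_le_div_iff₀ (hVc.quot_pos K) (hl.pos K)]
    push_cast
    linarith
  have mk : ∀ M ∈ weightMatrix ω, Dominated (quot V) (quot M) → Dominated (quot V') (quot M) →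
      ∃ M ∈ weightMatrix ω, CutoffPair l M := by
    rintro M hM ⟨C₁, hC₁, h₁⟩ ⟨C₂, hC₂, h₂⟩
    have hMc := hω.isWeightFunction.isLogConvexSeq hM
    refine ⟨M, hM, fun i => quot V' (i + 1), A * C + C₂ + C * C₁, by positivity, hVc'.quot_pos,
      hω.summable_quot_succ hV', fun K => (htail K).trans ?_, fun i => ?_, fun i => ?_⟩
    · have := hl.pos K
      gcongr
      nlinarith [mul_pos hC hC₁]
    · refine (h₂ (i + 1) (by omega)).trans (mul_le_mul_of_nonneg_right ?_ (hMc.quot_pos i).le)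
      nlinarith [mul_pos hC hC₁, mul_pos hA hC]
    · refine (hlV i).trans ?_
      refine (mul_le_mul_of_nonneg_left (h₁ (i + 1) (by omega)) hC.le).trans ?_
      rw [← mul_assoc]
      refine mul_le_mul_of_nonneg_right ?_ (hMc.quot_pos i).le
      nlinarith [mul_pos hC hC₁, mul_pos hA hC]
  have hrefl : ∀ M : ℕ → ℝ, Dominated M M := fun M => ⟨1, one_pos, fun k _ => by simp⟩
  rcases hω.admissible.total V hV V' hV' with h | h
  · exact mk V' hV' h (hrefl _)
  · exact mk V hV (hrefl _) h

/-- The minimum for `l₁` is tested at the index `R k`, where `k` is the minimising index of `l₂` at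
`ε`. There `(R k)! ∏ l₁ ≤ C₁^{Rk} W^y_{Rk} = (C₁^k W^{Ry}_k)^R`. As `l₂` is built from a `W^z`
absorbing `(C₁ B)^k W^{Ry}_k`, the product is at most `(C k! minProd l₂ ε)^R / (R k)!`, and `(k!)^R
≤ (R k)!`. -/
theorem IsAdmissibleWeight.exists_extension_weights {x : ℝ} (hx : 0 < x) {B : ℝ} (hB : 0 < B)
    {R : ℕ} (hR : 0 < R) :
    ∃ l₁ l₂ : ℕ → ℝ, IsGrowing l₁ ∧ IsGrowing l₂ ∧
      (∀ k, weightSeq ω x k ≤ k ! * ∏ i ∈ Finset.range k, l₁ i) ∧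
      (∃ C : ℝ, 0 < C ∧ ∀ ε, 0 < ε → minProd l₁ (B * ε) ≤ C * minProd l₂ ε ^ R) ∧
      ∃ M ∈ weightMatrix ω, CutoffPair l₂ M := by
  have hWF := hω.isWeightFunction
  have hlow : ∀ {V : ℕ → ℝ} {l : ℕ → ℝ}, V ∈ weightMatrix ω →
      (∀ i : ℕ, quot V (i + 1) ≤ (i + 1) * l i) →
      ∀ k, V k ≤ k ! * ∏ i ∈ Finset.range k, l i := by
    intro V l hV h k
    have hVc := hWF.isLogConvexSeq hV
    rw [hVc.eq_prod k, ← prod_succ_mul]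
    exact Finset.prod_le_prod (fun i _ => (hVc.quot_pos i).le) fun i _ => h i
  obtain ⟨l₁, hl₁, hWl₁, _, ⟨y, hy, rfl⟩, C₁, hC₁, hl₁V⟩ :=
    hω.exists_growing hstrong ⟨x, hx, rfl⟩
  obtain ⟨z, hz, C, hC, hCz⟩ := hWF.exists_weightSeq_pow_mul (x := R * y) (by positivity)
    (C₁ * B) (by positivity)
  obtain ⟨l₂, hl₂, hWl₂, hM⟩ := hω.exists_cutoffPair hstrong ⟨z, hz, rfl⟩
  refine ⟨l₁, l₂, hl₁, hl₂, hlow ⟨x, hx, rfl⟩ hWl₁, ⟨C ^ R, by positivity, fun ε hε => ?_⟩, hM⟩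
  set k := minIndex l₂ ε with hk
  have hyc := hWF.isLogConvexSeq (M := weightSeq ω y) ⟨y, hy, rfl⟩
  have h1 := hl₁.minProd_le (mul_pos hB hε) (R * k)
  have h2 : ((R * k)! : ℝ) * ∏ i ∈ Finset.range (R * k), l₁ i ≤
      (C₁ ^ k * weightSeq ω (R * y) k) ^ R := by
    rw [← prod_succ_mul, mul_pow, ← weightSeq_mul y hy R hR, ← pow_mul, mul_comm k R,
      hyc.eq_prod (R * k)]
    rw [← Finset.card_range (R * k), ← Finset.prod_const, Finset.card_range,
      ← Finset.prod_mul_distrib]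
    exact Finset.prod_le_prod (fun i _ => mul_nonneg (by positivity) (hl₁.pos i).le)
      fun i _ => hl₁V i
  have h3 : (C₁ * B) ^ k * weightSeq ω (R * y) k * ε ^ k ≤ C * k ! * minProd l₂ ε := by
    have h4 := (hCz k).trans (mul_le_mul_of_nonneg_left (hlow ⟨z, hz, rfl⟩ hWl₂ k) hC.le)
    have h5 := mul_le_mul_of_nonneg_right h4 (pow_nonneg hε.le k)
    refine h5.trans (le_of_eq ?_)
    rw [minProd, ← hk, Finset.prod_mul_distrib, Finset.prod_const, Finset.card_range]
    ring
  have hpos : 0 < ((R * k)! : ℝ) := by positivity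
  rw [← mul_le_mul_iff_right₀ hpos]
  have hm := (hl₂.minProd_pos hε).le
  have hw := (weightSeq_pos (ω := ω) (R * y) k).le
  calc ((R * k)! : ℝ) * minProd l₁ (B * ε)
      ≤ (R * k)! * ∏ i ∈ Finset.range (R * k), (l₁ i * (B * ε)) := by gcongr
    _ = ((R * k)! * ∏ i ∈ Finset.range (R * k), l₁ i) * (B * ε) ^ (R * k) := by
        rw [Finset.prod_mul_distrib, Finset.prod_const, Finset.card_range, mul_assoc]
    _ ≤ (C₁ ^ k * weightSeq ω (R * y) k) ^ R * (B * ε) ^ (R * k) := by gcongr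
    _ = ((C₁ * B) ^ k * weightSeq ω (R * y) k * ε ^ k) ^ R := by
        rw [mul_comm R k, pow_mul (B * ε), ← mul_pow]
        congr 1
        rw [mul_pow, mul_pow]
        ring
    _ ≤ (C * k ! * minProd l₂ ε) ^ R := by gcongr
    _ = (k ! : ℝ) ^ R * (C ^ R * minProd l₂ ε ^ R) := by ring
    _ ≤ (R * k)! * (C ^ R * minProd l₂ ε ^ R) := by
        gcongr
        exact factorial_pow_le R k

end

/-! ### Smooth steps as infinite convolutions -/

section SmoothStep

/-- The unit step averaged over the `m` intervals of lengths `a j, …, a (j + m - 1)`. -/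
def stepAvg (a : ℕ → ℝ) : ℕ → ℕ → ℝ → ℝ
  | 0, _, t => if 0 ≤ t then 1 else 0
  | m + 1, j, t => (a j)⁻¹ * ∫ u in (0 : ℝ)..a j, stepAvg a m (j + 1) (t - u)

variable {a : ℕ → ℝ}

theorem intervalIntegrable_comp_sub {f : ℝ → ℝ} (hf : Monotone f) (t c d : ℝ) :
    IntervalIntegrable (fun u => f (t - u)) MeasureTheory.volume c d :=
  Antitone.intervalIntegrable fun _ _ h => hf (by linarith)

theorem average_const {c : ℝ} (hc : 0 < c) (d : ℝ) : c⁻¹ * ∫ _ in (0 : ℝ)..c, d = d := by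
  simp [hc.ne']

theorem average_mono {c : ℝ} (hc : 0 < c) {f g : ℝ → ℝ}
    (hf : IntervalIntegrable f MeasureTheory.volume 0 c)
    (hg : IntervalIntegrable g MeasureTheory.volume 0 c) (h : ∀ u ∈ Icc 0 c, f u ≤ g u) :
    c⁻¹ * ∫ u in (0 : ℝ)..c, f u ≤ c⁻¹ * ∫ u in (0 : ℝ)..c, g u :=
  mul_le_mul_of_nonneg_left (intervalIntegral.integral_mono_on hc.le hf hg h) (by positivity)

theorem monotone_stepAvg (ha : ∀ i, 0 < a i) (m j : ℕ) : Monotone (stepAvg a m j) := by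
  induction m generalizing j with
  | zero =>
    intro s t h
    simp only [stepAvg]
    split_ifs <;> linarith
  | succ m ih =>
    intro s t h
    exact average_mono (ha j) (intervalIntegrable_comp_sub (ih _) _ _ _)
      (intervalIntegrable_comp_sub (ih _) _ _ _) fun u _ => ih _ (by linarith)

theorem stepAvg_mem (ha : ∀ i, 0 < a i) (m j : ℕ) (t : ℝ) :
    0 ≤ stepAvg a m j t ∧ stepAvg a m j t ≤ 1 := by
  induction m generalizing j t with
  | zero => simp only [stepAvg]; split_ifs <;> norm_num
  | succ m ih =>
    have hi := intervalIntegrable_comp_sub (monotone_stepAvg ha m (j + 1)) t 0 (a j)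
    constructor
    · have := average_mono (ha j) (intervalIntegrable_const (c := (0 : ℝ))) hi
        fun u _ => (ih (j + 1) (t - u)).1
      rwa [average_const (ha j)] at this
    · have := average_mono (ha j) hi (intervalIntegrable_const (c := (1 : ℝ)))
        fun u _ => (ih (j + 1) (t - u)).2
      rwa [average_const (ha j)] at this

/-- The additional average acts on the innermost function, the unit step, which it can only lower;
the outer averages preserve the inequality. -/
theorem stepAvg_succ_le (ha : ∀ i, 0 < a i) (m j : ℕ) (t : ℝ) :
    stepAvg a (m + 1) j t ≤ stepAvg a m j t := by
  induction m generalizing j t with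
  | zero =>
    by_cases ht : 0 ≤ t
    · have := (stepAvg_mem ha 1 j t).2
      simpa [stepAvg, ht] using this
    · have hi := intervalIntegrable_comp_sub (monotone_stepAvg ha 0 (j + 1)) t 0 (a j)
      have := average_mono (ha j) hi (intervalIntegrable_const (c := (0 : ℝ))) fun u hu => by
        have : ¬ 0 ≤ t - u := by linarith [hu.1]
        simp [stepAvg, this]
      rw [average_const (ha j)] at this
      refine le_trans this ?_
      simp [stepAvg, ht]
  | succ m ih =>
    exact average_mono (ha j) (intervalIntegrable_comp_sub (monotone_stepAvg ha _ _) _ _ _)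
      (intervalIntegrable_comp_sub (monotone_stepAvg ha _ _) _ _ _) fun u _ => ih _ _

theorem stepAvg_of_neg (ha : ∀ i, 0 < a i) (m j : ℕ) {t : ℝ} (ht : t < 0) :
    stepAvg a m j t = 0 := by
  refine le_antisymm ?_ (stepAvg_mem ha m j t).1
  induction m with
  | zero => simp [stepAvg, not_le.2 ht]
  | succ m ih => exact (stepAvg_succ_le ha m j t).trans ih

theorem stepAvg_of_sum_le (ha : ∀ i, 0 < a i) (m j : ℕ) {t : ℝ}
    (ht : ∑ i ∈ Finset.range m, a (j + i) ≤ t) : stepAvg a m j t = 1 := by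
  refine le_antisymm (stepAvg_mem ha m j t).2 ?_
  induction m generalizing j t with
  | zero => simp at ht; simp [stepAvg, ht]
  | succ m ih =>
    have := average_mono (ha j) (intervalIntegrable_const (c := (1 : ℝ)))
      (intervalIntegrable_comp_sub (monotone_stepAvg ha m (j + 1)) t 0 (a j)) fun u hu => by
        refine ih (j + 1) ?_
        rw [Finset.sum_range_succ'] at ht
        have h2 : ∑ i ∈ Finset.range m, a (j + 1 + i) = ∑ i ∈ Finset.range m, a (j + (i + 1)) :=
          Finset.sum_congr rfl fun i _ => by congr 1; omega
        have := hu.2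
        simp only [add_zero] at ht
        linarith
    rwa [average_const (ha j)] at this

/-- The limit of `stepAvg a m j` as `m → ∞`. -/
def smoothStep (a : ℕ → ℝ) (j : ℕ) (t : ℝ) : ℝ := ⨅ m, stepAvg a m j t

theorem bddBelow_stepAvg (ha : ∀ i, 0 < a i) (j : ℕ) (t : ℝ) :
    BddBelow (range fun m => stepAvg a m j t) :=
  ⟨0, by rintro _ ⟨m, rfl⟩; exact (stepAvg_mem ha m j t).1⟩

theorem tendsto_stepAvg (ha : ∀ i, 0 < a i) (j : ℕ) (t : ℝ) :
    Tendsto (fun m => stepAvg a m j t) atTop (𝓝 (smoothStep a j t)) :=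
  tendsto_atTop_ciInf (antitone_nat_of_succ_le fun m => stepAvg_succ_le ha m j t)
    (bddBelow_stepAvg ha j t)

theorem monotone_smoothStep (ha : ∀ i, 0 < a i) (j : ℕ) : Monotone (smoothStep a j) :=
  fun _ _ h => ciInf_mono (bddBelow_stepAvg ha j _) fun m => monotone_stepAvg ha m j h

theorem smoothStep_mem (ha : ∀ i, 0 < a i) (j : ℕ) (t : ℝ) :
    0 ≤ smoothStep a j t ∧ smoothStep a j t ≤ 1 :=
  ⟨le_ciInf fun m => (stepAvg_mem ha m j t).1,
    (ciInf_le (bddBelow_stepAvg ha j t) 0).trans (stepAvg_mem ha 0 j t).2⟩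

theorem smoothStep_of_neg (ha : ∀ i, 0 < a i) (j : ℕ) {t : ℝ} (ht : t < 0) :
    smoothStep a j t = 0 := by
  simp [smoothStep, stepAvg_of_neg ha _ j ht]

theorem smoothStep_of_le (ha : ∀ i, 0 < a i) (hs : Summable a) {t c : ℝ} (hc : ∑' i, a i ≤ c)
    (ht : c ≤ t) : smoothStep a 0 t = 1 := by
  have : ∀ m, stepAvg a m 0 t = 1 := fun m => by
    refine stepAvg_of_sum_le ha m 0 ?_
    simp only [zero_add]
    exact ((hs.sum_le_tsum _ fun i _ => (ha i).le).trans hc).trans ht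
  simp [smoothStep, this]

/-- The recursion passes to the limit by dominated convergence. It expresses each step as a
primitive of the next one, from which smoothness follows by bootstrapping. -/
theorem smoothStep_eq_average (ha : ∀ i, 0 < a i) (j : ℕ) (t : ℝ) :
    smoothStep a j t = (a j)⁻¹ * ∫ u in (t - a j)..t, smoothStep a (j + 1) u := by
  have h1 : Tendsto (fun m => stepAvg a (m + 1) j t) atTop (𝓝 (smoothStep a j t)) :=
    (tendsto_add_atTop_iff_nat 1).2 (tendsto_stepAvg ha j t)
  have h2 : Tendsto (fun m => stepAvg a (m + 1) j t) atTop
      (𝓝 ((a j)⁻¹ * ∫ u in (0 : ℝ)..a j, smoothStep a (j + 1) (t - u))) := by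
    refine Tendsto.const_mul _ ?_
    refine intervalIntegral.tendsto_integral_filter_of_dominated_convergence (fun _ => 1)
      (Eventually.of_forall fun m => ?_) (Eventually.of_forall fun m => ?_)
      intervalIntegrable_const (Eventually.of_forall fun u _ => tendsto_stepAvg ha _ _)
    · have := (intervalIntegrable_comp_sub (monotone_stepAvg ha m (j + 1)) t 0 (a j))
      exact (intervalIntegrable_iff.1 this).aestronglyMeasurable
    · refine Eventually.of_forall fun u _ => ?_
      have := stepAvg_mem ha m (j + 1) (t - u)
      rw [Real.norm_of_nonneg this.1]
      exact this.2
  rw [tendsto_nhds_unique h1 h2, intervalIntegral.integral_comp_sub_left]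
  simp

theorem continuous_smoothStep (ha : ∀ i, 0 < a i) (j : ℕ) : Continuous (smoothStep a j) := by
  have hi : ∀ c d, IntervalIntegrable (smoothStep a (j + 1)) MeasureTheory.volume c d :=
    fun c d => (monotone_smoothStep ha (j + 1)).intervalIntegrable
  have h : smoothStep a j = fun t => (a j)⁻¹ * ((∫ u in (0 : ℝ)..t, smoothStep a (j + 1) u) -
      ∫ u in (0 : ℝ)..(t - a j), smoothStep a (j + 1) u) := by
    ext t
    rw [smoothStep_eq_average ha j t, intervalIntegral.integral_interval_sub_left (hi _ _) (hi _ _)]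
  rw [h]
  have hc := intervalIntegral.continuous_primitive hi 0
  exact continuous_const.mul (hc.sub (hc.comp (continuous_id.sub continuous_const)))

theorem hasDerivAt_smoothStep (ha : ∀ i, 0 < a i) (j : ℕ) (t : ℝ) :
    HasDerivAt (smoothStep a j)
      ((a j)⁻¹ * (smoothStep a (j + 1) t - smoothStep a (j + 1) (t - a j))) t := by
  have hc := continuous_smoothStep ha (j + 1)
  have hi : ∀ c d, IntervalIntegrable (smoothStep a (j + 1)) MeasureTheory.volume c d :=
    fun c d => (monotone_smoothStep ha (j + 1)).intervalIntegrable
  have h : smoothStep a j = fun t => (a j)⁻¹ * ((∫ u in (0 : ℝ)..t, smoothStep a (j + 1) u) -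
      ∫ u in (0 : ℝ)..(t - a j), smoothStep a (j + 1) u) := by
    ext t
    rw [smoothStep_eq_average ha j t, intervalIntegral.integral_interval_sub_left (hi _ _) (hi _ _)]
  rw [h]
  have hd : ∀ s, HasDerivAt (fun t => ∫ u in (0 : ℝ)..t, smoothStep a (j + 1) u)
      (smoothStep a (j + 1) s) s := fun s => hc.integral_hasStrictDerivAt 0 s |>.hasDerivAt
  refine ((hd t).sub ?_).const_mul _
  exact (hd (t - a j)).comp_sub_const t (a j)

theorem deriv_smoothStep (ha : ∀ i, 0 < a i) (j : ℕ) :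
    deriv (smoothStep a j) =
      fun t => (a j)⁻¹ * (smoothStep a (j + 1) t - smoothStep a (j + 1) (t - a j)) :=
  funext fun t => (hasDerivAt_smoothStep ha j t).deriv

theorem contDiff_smoothStep (ha : ∀ i, 0 < a i) (j : ℕ) :
    ContDiff ℝ (⊤ : ℕ∞) (smoothStep a j) := by
  refine contDiff_infty.2 fun k => ?_
  induction k generalizing j with
  | zero => exact contDiff_zero.2 (continuous_smoothStep ha j)
  | succ k ih =>
    refine contDiff_succ_iff_deriv.2 ⟨fun t => (hasDerivAt_smoothStep ha j t).differentiableAt,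
      fun h => absurd h (WithTop.natCast_ne_top k), ?_⟩
    rw [deriv_smoothStep ha]
    exact contDiff_const.mul ((ih _).sub ((ih _).comp (contDiff_id.sub contDiff_const)))

/-- Each differentiation replaces the step with index `j` by a difference of two translates of the
step with index `j + 1`, divided by `a j`. -/
theorem abs_iteratedDeriv_smoothStep_le (ha : ∀ i, 0 < a i) (k j : ℕ) (t : ℝ) :
    |iteratedDeriv k (smoothStep a j) t| ≤ ∏ i ∈ Finset.range k, 2 / a (j + i) := by
  induction k generalizing j t with
  | zero =>
    have := smoothStep_mem ha j t
    simp [abs_of_nonneg this.1, this.2]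
  | succ k ih =>
    have hs : ContDiffAt ℝ k (smoothStep a (j + 1)) t :=
      ((contDiff_smoothStep ha (j + 1)).of_le (by exact_mod_cast le_top)).contDiffAt
    have hs' : ContDiffAt ℝ k (fun t => smoothStep a (j + 1) (t - a j)) t :=
      (((contDiff_smoothStep ha (j + 1)).of_le (by exact_mod_cast le_top)).comp
        (contDiff_id.sub contDiff_const)).contDiffAt
    rw [iteratedDeriv_succ', deriv_smoothStep ha, iteratedDeriv_const_mul_field,
      iteratedDeriv_fun_sub hs hs', iteratedDeriv_comp_sub_const, abs_mul, Finset.prod_range_succ',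
      abs_of_pos (inv_pos.2 (ha j)), mul_comm]
    have h1 := ih (j + 1) t
    have h2 := ih (j + 1) (t - a j)
    have h3 : ∀ i, j + 1 + i = j + (i + 1) := fun i => by omega
    simp only [h3] at h1 h2
    have h4 := (abs_sub (iteratedDeriv k (smoothStep a (j + 1)) t)
      (iteratedDeriv k (smoothStep a (j + 1)) (t - a j))).trans (add_le_add h1 h2)
    rw [← two_mul] at h4
    refine (mul_le_mul_of_nonneg_right h4 (inv_pos.2 (ha j)).le).trans (le_of_eq ?_)
    simp only [add_zero]
    ring

end SmoothStep

/-! ### Derivative bounds for one-dimensional cut-offs -/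

/-- At `ε / e` the product over the first `K = minIndex l ε` factors equals `e^{-K} minProd l ε`. An
exponential loss in `K` is thus paid by a fixed change of scale. -/
theorem IsGrowing.exp_minIndex_div_le {l : ℕ → ℝ} (hl : IsGrowing l) {ε : ℝ} (hε : 0 < ε) :
    Real.exp (minIndex l ε) / minProd l ε ≤ 1 / minProd l (ε / Real.exp 1) := by
  have he : 0 < Real.exp 1 := Real.exp_pos 1
  have h := hl.minProd_le (div_pos hε he) (minIndex l ε)
  have h2 : ∏ i ∈ Finset.range (minIndex l ε), (l i * (ε / Real.exp 1)) =
      minProd l ε / Real.exp (minIndex l ε) := by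
    rw [← Real.exp_one_pow, minProd, ← Finset.card_range (minIndex l ε), ← Finset.prod_const,
      Finset.card_range, ← Finset.prod_div_distrib]
    exact Finset.prod_congr rfl fun i _ => by ring
  rw [h2] at h
  have h3 := one_div_le_one_div_of_le (hl.minProd_pos (div_pos hε he)) h
  rwa [one_div_div] at h3

/-- Up to `K` the product is `(4 K / ε)^j`; here `K^j ≤ e^K j!`, and `minProd l ε ≤ ε^j ∏ l`
together with `j! ∏ l ≤ C^j M j` turns `j! / ε^j` into `M j / minProd l ε`. Beyond `K` each factor
is bounded by a quotient of `M`, and these quotients accumulate to `M j / M K`. -/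
theorem prod_le_exp_div_minProd {l M μ : ℕ → ℝ} {C : ℝ} (hl : IsGrowing l) (hM : IsLogConvexSeq M)
    (hC : 0 < C) (hμ : ∀ i, 0 < μ i) (hμM : ∀ i, μ i ≤ C * quot M (i + 1))
    (hlM : ∀ i : ℕ, (i + 1) * l i ≤ C * quot M (i + 1)) {ε : ℝ} (hε : 0 < ε) {b : ℕ → ℝ}
    (hb : ∀ i < minIndex l ε, b i = 4 * minIndex l ε / ε)
    (hb' : ∀ i, minIndex l ε ≤ i → b i = 4 * C * μ i) (j : ℕ) :
    ∏ i ∈ Finset.range j, b i ≤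
      Real.exp (minIndex l ε) / minProd l ε * (4 * C + 4 * C * C) ^ j * M j := by
  set K := minIndex l ε with hK
  have hm : 0 < minProd l ε := hl.minProd_pos hε
  have small : ∀ j ≤ K, ∏ i ∈ Finset.range j, b i ≤
      Real.exp K / minProd l ε * (4 * C) ^ j * M j := by
    intro j hj
    have h1 : ∏ i ∈ Finset.range j, b i = (4 * K / ε) ^ j := by
      rw [Finset.prod_congr rfl fun i hi => hb i ((Finset.mem_range.1 hi).trans_le hj),
        Finset.prod_const, Finset.card_range]
    have h2 : (K : ℝ) ^ j ≤ Real.exp K * j ! := by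
      have := Real.pow_div_factorial_le_exp (K : ℝ) (Nat.cast_nonneg K) j
      rwa [div_le_iff₀ (by positivity)] at this
    have h3 : (j ! : ℝ) * ∏ i ∈ Finset.range j, l i ≤ C ^ j * M j := by
      rw [← prod_succ_mul, hM.eq_prod j, ← Finset.card_range j, ← Finset.prod_const,
        Finset.card_range, ← Finset.prod_mul_distrib]
      exact Finset.prod_le_prod (fun i _ => mul_nonneg (by positivity) (hl.pos i).le)
        fun i _ => hlM i
    have h4 : minProd l ε ≤ (∏ i ∈ Finset.range j, l i) * ε ^ j := by
      have := hl.minProd_le hε j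
      rwa [Finset.prod_mul_distrib, Finset.prod_const, Finset.card_range] at this
    have hP : 0 < ∏ i ∈ Finset.range j, l i := Finset.prod_pos fun i _ => hl.pos i
    rw [h1, div_pow, mul_pow, div_le_iff₀ (by positivity)]
    have h5 : (j ! : ℝ) * minProd l ε ≤ C ^ j * M j * ε ^ j := by
      calc (j ! : ℝ) * minProd l ε ≤ j ! * ((∏ i ∈ Finset.range j, l i) * ε ^ j) := by gcongr
        _ = (j ! * ∏ i ∈ Finset.range j, l i) * ε ^ j := by ring
        _ ≤ _ := by gcongr
    calc (4 : ℝ) ^ j * K ^ j ≤ 4 ^ j * (Real.exp K * j !) := by gcongr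
      _ = 4 ^ j * (Real.exp K / minProd l ε * (j ! * minProd l ε)) := by field_simp
      _ ≤ 4 ^ j * (Real.exp K / minProd l ε * (C ^ j * M j * ε ^ j)) := by gcongr
      _ = _ := by ring
  have hσ : 4 * C ≤ 4 * C + 4 * C * C := by nlinarith
  rcases le_total j K with hj | hj
  · refine (small j hj).trans ?_
    have := (hM.pos j).le
    gcongr
  · obtain ⟨d, rfl⟩ := Nat.exists_eq_add_of_le hj
    rw [Finset.prod_range_add, hM.add, pow_add]
    have h1 : ∏ i ∈ Finset.range d, b (K + i) ≤
        (4 * C + 4 * C * C) ^ d * ∏ i ∈ Finset.range d, quot M (K + i + 1) := by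
      rw [← Finset.card_range d, ← Finset.prod_const, Finset.card_range,
        ← Finset.prod_mul_distrib]
      refine Finset.prod_le_prod (fun i _ => ?_) fun i _ => ?_
      · rw [hb' _ (Nat.le_add_right K i)]
        have := hμ (K + i)
        positivity
      · rw [hb' _ (Nat.le_add_right K i)]
        have h2 := hμM (K + i)
        have h3 := (hM.quot_pos (K + i)).le
        calc 4 * C * μ (K + i) ≤ 4 * C * (C * quot M (K + i + 1)) := by gcongr
          _ ≤ _ := by nlinarith [mul_nonneg hC.le h3]
    have h2 := small K le_rfl
    have hMK := (hM.pos K).le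
    calc (∏ i ∈ Finset.range K, b i) * ∏ i ∈ Finset.range d, b (K + i)
        ≤ (Real.exp K / minProd l ε * (4 * C) ^ K * M K) *
          ((4 * C + 4 * C * C) ^ d * ∏ i ∈ Finset.range d, quot M (K + i + 1)) := by
          refine mul_le_mul h2 h1 (Finset.prod_nonneg fun i _ => ?_) (by positivity)
          rw [hb' _ (Nat.le_add_right K i)]
          have := hμ (K + i)
          positivity
      _ ≤ (Real.exp K / minProd l ε * (4 * C + 4 * C * C) ^ K * M K) *
          ((4 * C + 4 * C * C) ^ d * ∏ i ∈ Finset.range d, quot M (K + i + 1)) := by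
          have : 0 ≤ ∏ i ∈ Finset.range d, quot M (K + i + 1) :=
            Finset.prod_nonneg fun i _ => (hM.quot_pos _).le
          gcongr
      _ = _ := by ring

/-- One-dimensional partitions of unity on the grid of size `ε`, with derivative bounds. -/
theorem CutoffPair.exists_partition {l M : ℕ → ℝ} (hl : IsGrowing l) (hM : IsLogConvexSeq M)
    (h : CutoffPair l M) : ∃ σ : ℝ, 0 < σ ∧ ∀ ε, 0 < ε → ∃ g : ℝ → ℝ,
      ContDiff ℝ (⊤ : ℕ∞) g ∧ (∀ t, t < 0 ∨ 2 * ε < t → g t = 0) ∧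
      (∀ (m : ℕ) (t : ℝ), |t| + ε ≤ m * ε →
        ∑ q ∈ Finset.range (2 * m), g (t - ε * ((q : ℝ) - m)) = 1) ∧
      ∀ (j : ℕ) (t : ℝ),
        |iteratedDeriv j g t| ≤ 2 / minProd l (ε / Real.exp 1) * σ ^ j * M j := by
  obtain ⟨μ, C, hC, hμ, hμs, htail, hμM, hlM⟩ := h
  refine ⟨4 * C + 4 * C * C, by positivity, fun ε hε => ?_⟩
  set K := minIndex l ε with hK
  -- Half of the total width `ε` is shared equally by the first `K` intervals. The remaining widths
  -- sum to at most `(1 / (2 C)) (C / l K) = 1 / (2 l K) ≤ ε / 2`, since `l K * ε ≥ 1` at the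
  -- minimising index.
  set a : ℕ → ℝ := fun i => if i < K then ε / (2 * K) else 1 / (2 * C) * (1 / μ i) with ha_def
  have ha : ∀ i, 0 < a i := by
    intro i
    have := hμ i
    simp only [ha_def]
    split_ifs with hi
    · have : (0 : ℝ) < K := by exact_mod_cast (Nat.zero_le i).trans_lt hi
      positivity
    · positivity
  have hshift : (fun i => a (i + K)) = fun i => 1 / (2 * C) * (1 / μ (K + i)) := by
    ext i
    simp [ha_def, add_comm]
  have hs' : Summable fun i => a (i + K) := by
    rw [hshift]
    refine Summable.mul_left _ ?_
    simpa only [add_comm] using (summable_nat_add_iff K).2 hμs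
  have hs : Summable a := (summable_nat_add_iff K).1 hs'
  have hsum : ∑' i, a i ≤ ε := by
    rw [← hs.sum_add_tsum_nat_add K, hshift, tsum_mul_left]
    have h1 : ∑ i ∈ Finset.range K, a i ≤ ε / 2 := by
      rw [Finset.sum_congr rfl (g := fun _ => ε / (2 * K)) fun i hi => by
        simp [ha_def, Finset.mem_range.1 hi], Finset.sum_const, Finset.card_range, nsmul_eq_mul]
      rcases Nat.eq_zero_or_pos K with h0 | h0
      · rw [h0]; simp; positivity
      · have : (0 : ℝ) < K := by exact_mod_cast h0
        apply le_of_eq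
        field_simp
    have h2 : 1 / (2 * C) * ∑' i, 1 / μ (K + i) ≤ ε / 2 := by
      have h3 := hl.one_le_of_minIndex_le hε (le_refl (minIndex l ε))
      have hlK := hl.pos K
      calc 1 / (2 * C) * ∑' i, 1 / μ (K + i) ≤ 1 / (2 * C) * (C / l K) := by
            gcongr; exact htail K
        _ = 1 / (2 * l K) := by field_simp
        _ ≤ ε / 2 := by
          rw [div_le_div_iff₀ (by positivity) two_pos]
          linarith
    linarith
  have hbound : ∀ j t, |iteratedDeriv j (smoothStep a 0) t| ≤
      1 / minProd l (ε / Real.exp 1) * (4 * C + 4 * C * C) ^ j * M j := by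
    intro j t
    have h1 := abs_iteratedDeriv_smoothStep_le ha j 0 t
    simp only [zero_add] at h1
    have h2 := prod_le_exp_div_minProd hl hM hC hμ hμM hlM hε (b := fun i => 2 / a i)
      (fun i hi => by
        rw [← hK] at hi
        simp only [ha_def, ← hK, hi, if_true]
        have : (0 : ℝ) < K := by exact_mod_cast (Nat.zero_le i).trans_lt hi
        field_simp
        norm_num)
      (fun i hi => by
        rw [← hK] at hi
        simp only [ha_def, not_lt.2 hi, if_false]
        have := hμ i
        field_simp
        norm_num) j
    have h3 := hl.exp_minIndex_div_le hε
    have := (hM.pos j).le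
    refine h1.trans (h2.trans ?_)
    gcongr
  have hG := contDiff_smoothStep ha 0
  have hG' : ContDiff ℝ (⊤ : ℕ∞) fun t => smoothStep a 0 (t - ε) :=
    hG.comp (contDiff_id.sub contDiff_const)
  -- The step rises from 0 to 1 within `[0, ε]`, so subtracting its translate by `ε` leaves a bump
  -- on `[0, 2 ε]` whose translates by multiples of `ε` telescope.
  refine ⟨fun t => smoothStep a 0 t - smoothStep a 0 (t - ε), hG.sub hG', ?_, ?_, ?_⟩
  · rintro t (ht | ht)
    · simp only
      rw [smoothStep_of_neg ha 0 ht, smoothStep_of_neg ha 0 (by linarith), sub_zero]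
    · simp only
      rw [smoothStep_of_le ha hs hsum (by linarith), smoothStep_of_le ha hs hsum (by linarith),
        sub_self]
  · intro m t ht
    have h1 : ∀ q : ℕ, smoothStep a 0 (t - ε * ((q : ℝ) - m)) -
        smoothStep a 0 (t - ε * ((q : ℝ) - m) - ε) =
        smoothStep a 0 (t - ε * ((q : ℝ) - m)) -
        smoothStep a 0 (t - ε * (((q + 1 : ℕ) : ℝ) - m)) := by
      intro q
      congr 2
      push_cast
      ring
    simp only [h1]
    rw [Finset.sum_range_sub' (fun q : ℕ => smoothStep a 0 (t - ε * ((q : ℝ) - m)))]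
    have h2 := neg_abs_le t
    have h3 := le_abs_self t
    push_cast
    rw [smoothStep_of_le ha hs hsum (by linarith), smoothStep_of_neg ha 0 (by linarith), sub_zero]
  · intro j t
    have hj : ((j : ℕ∞) : WithTop ℕ∞) ≤ ((⊤ : ℕ∞) : WithTop ℕ∞) := by exact_mod_cast le_top
    rw [iteratedDeriv_fun_sub (hG.of_le hj).contDiffAt (hG'.of_le hj).contDiffAt,
      iteratedDeriv_comp_sub_const]
    refine (abs_sub _ _).trans ((add_le_add (hbound j t) (hbound j (t - ε))).trans (le_of_eq ?_))
    ring

/-! ### Iterated partial derivatives -/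

section PartialDerivatives

variable {n : ℕ}

/-- The operator `D` is an evaluation of the `k`-th iterated derivative at vectors of norm at most
one. -/
def IsDerivEval (k : ℕ)
    (D : (EuclideanSpace ℝ (Fin n) → ℝ) → EuclideanSpace ℝ (Fin n) → ℝ) : Prop :=
  ∃ v : Fin k → EuclideanSpace ℝ (Fin n), (∀ i, ‖v i‖ ≤ 1) ∧
    ∀ f, ContDiff ℝ (⊤ : ℕ∞) f → ∀ x, D f x = iteratedFDeriv ℝ k f x v

theorem isDerivEval_id : IsDerivEval 0 (id : (EuclideanSpace ℝ (Fin n) → ℝ) → _) :=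
  ⟨Fin.elim0, fun i => i.elim0, fun f _ x => by simp⟩

theorem IsDerivEval.pderiv {k : ℕ}
    {D : (EuclideanSpace ℝ (Fin n) → ℝ) → EuclideanSpace ℝ (Fin n) → ℝ} (h : IsDerivEval k D)
    (i : Fin n) : IsDerivEval (k + 1) fun f => pderiv i (D f) := by
  obtain ⟨v, hv, hD⟩ := h
  refine ⟨Fin.cons (EuclideanSpace.single i 1) v, fun j => ?_, fun f hf x => ?_⟩
  · refine Fin.cases ?_ (fun j => ?_) j
    · simp
    · simpa using hv j
  · have h1 : D f = fun y => iteratedFDeriv ℝ k f y v := funext (hD f hf)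
    have h2 : DifferentiableAt ℝ (iteratedFDeriv ℝ k f) x :=
      (hf.differentiable_iteratedFDeriv (by exact_mod_cast WithTop.coe_lt_top _)) x
    rw [iteratedFDeriv_succ_apply_left, Fin.cons_zero, Fin.tail_cons]
    simp only [Ultradiff.pderiv]
    rw [h1, fderiv_continuousMultilinear_apply_const_apply h2]

theorem IsDerivEval.pderiv_iterate {k : ℕ}
    {D : (EuclideanSpace ℝ (Fin n) → ℝ) → EuclideanSpace ℝ (Fin n) → ℝ} (h : IsDerivEval k D)
    (i : Fin n) (m : ℕ) : IsDerivEval (m + k) fun f => (Ultradiff.pderiv i)^[m] (D f) := by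
  induction m with
  | zero => simpa using h
  | succ m ih =>
    have := ih.pderiv i
    simp only [← Function.iterate_succ_apply' (Ultradiff.pderiv i)] at this
    rwa [show m + 1 + k = m + k + 1 by omega]

/-- Each partial derivative inserts one unit vector into the iterated Fréchet derivative; linearity,
limits and norm bounds for partial derivatives are inherited from there. -/
theorem isDerivEval_mderiv (α : Fin n → ℕ) : IsDerivEval (len α) (mderiv α) := by
  have key : ∀ l : List (Fin n), IsDerivEval (l.map α).sum
      fun f => l.foldr (fun i g => (pderiv i)^[α i] g) f := by
    intro l
    induction l with
    | nil => exact isDerivEval_id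
    | cons i l ih =>
      rw [List.map_cons, List.sum_cons]
      exact ih.pderiv_iterate i (α i)
  have h := key (List.finRange n)
  rw [← Fin.sum_univ_def] at h
  exact h

theorem abs_mderiv_le (α : Fin n → ℕ) {f : EuclideanSpace ℝ (Fin n) → ℝ}
    (hf : ContDiff ℝ (⊤ : ℕ∞) f) (x : EuclideanSpace ℝ (Fin n)) :
    |mderiv α f x| ≤ ‖iteratedFDeriv ℝ (len α) f x‖ := by
  obtain ⟨v, hv, h⟩ := isDerivEval_mderiv α
  rw [h f hf, ← Real.norm_eq_abs]
  refine ((iteratedFDeriv ℝ (len α) f x).le_opNorm v).trans ?_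
  exact mul_le_of_le_one_right (norm_nonneg _)
    (Finset.prod_le_one (fun i _ => norm_nonneg _) fun i _ => hv i)

theorem mderiv_sum {ι : Type*} (α : Fin n → ℕ) (s : Finset ι)
    {f : ι → EuclideanSpace ℝ (Fin n) → ℝ} (hf : ∀ i, ContDiff ℝ (⊤ : ℕ∞) (f i))
    (x : EuclideanSpace ℝ (Fin n)) :
    mderiv α (fun y => ∑ i ∈ s, f i y) x = ∑ i ∈ s, mderiv α (f i) x := by
  obtain ⟨v, _, h⟩ := isDerivEval_mderiv α
  rw [h _ (ContDiff.sum fun i _ => hf i), iteratedFDeriv_fun_sum_apply fun i _ =>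
    ((hf i).of_le (by exact_mod_cast le_top)).contDiffAt]
  rw [sum_apply]
  exact Finset.sum_congr rfl fun i _ => (h _ (hf i) x).symm

theorem mderiv_sub (α : Fin n → ℕ) {f g : EuclideanSpace ℝ (Fin n) → ℝ}
    (hf : ContDiff ℝ (⊤ : ℕ∞) f) (hg : ContDiff ℝ (⊤ : ℕ∞) g) (x : EuclideanSpace ℝ (Fin n)) :
    mderiv α (fun y => f y - g y) x = mderiv α f x - mderiv α g x := by
  obtain ⟨v, _, h⟩ := isDerivEval_mderiv α
  have hl : ((len α : ℕ∞) : WithTop ℕ∞) ≤ ((⊤ : ℕ∞) : WithTop ℕ∞) := by exact_mod_cast le_top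
  change mderiv α (f - g) x = _
  rw [h (f - g) (hf.sub hg), h _ hf, h _ hg,
    iteratedFDeriv_sub_apply (hf.of_le hl).contDiffAt (hg.of_le hl).contDiffAt]
  rfl

theorem mderiv_mul_const (α : Fin n → ℕ) {f : EuclideanSpace ℝ (Fin n) → ℝ}
    (hf : ContDiff ℝ (⊤ : ℕ∞) f) (c : ℝ) (x : EuclideanSpace ℝ (Fin n)) :
    mderiv α (fun y => f y * c) x = mderiv α f x * c := by
  obtain ⟨v, _, h⟩ := isDerivEval_mderiv α
  have hl : ((len α : ℕ∞) : WithTop ℕ∞) ≤ ((⊤ : ℕ∞) : WithTop ℕ∞) := by exact_mod_cast le_top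
  have h1 : (fun y => f y * c) = fun y => c • f y := by
    ext y
    simp [mul_comm]
  rw [h1, h (fun y => c • f y) (hf.const_smul c), h _ hf,
    iteratedFDeriv_const_smul_apply' (hf.of_le hl).contDiffAt]
  simp [mul_comm]

theorem pderiv_comm (i j : Fin n) {f : EuclideanSpace ℝ (Fin n) → ℝ}
    (hf : ContDiff ℝ (⊤ : ℕ∞) f) : pderiv i (pderiv j f) = pderiv j (pderiv i f) := by
  ext x
  have hd : DifferentiableAt ℝ (fderiv ℝ f) x :=
    (hf.fderiv_right (m := (⊤ : ℕ∞)) (by simp)).differentiable (by simp) x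
  have hs : IsSymmSndFDerivAt ℝ f x :=
    hf.contDiffAt.isSymmSndFDerivAt 
      (by simpa using (WithTop.coe_le_coe.2 (le_top : (2 : ℕ∞) ≤ ⊤)))
  have key : ∀ v w : EuclideanSpace ℝ (Fin n),
      fderiv ℝ (fun y => fderiv ℝ f y v) x w = fderiv ℝ (fderiv ℝ f) x w v := by
    intro v w
    rw [fderiv_clm_apply hd (differentiableAt_const v)]
    simp
  change fderiv ℝ (fun y => fderiv ℝ f y _) x _ = fderiv ℝ (fun y => fderiv ℝ f y _) x _
  rw [key, key, hs.eq]

theorem contDiff_pderiv_iterate (i : Fin n) (m : ℕ) {f : EuclideanSpace ℝ (Fin n) → ℝ}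
    (hf : ContDiff ℝ (⊤ : ℕ∞) f) : ContDiff ℝ (⊤ : ℕ∞) ((pderiv i)^[m] f) := by
  induction m generalizing f with
  | zero => exact hf
  | succ m ih => exact ih (contDiff_pderiv i hf)

theorem pderiv_pderiv_iterate (i j : Fin n) (m : ℕ) {f : EuclideanSpace ℝ (Fin n) → ℝ}
    (hf : ContDiff ℝ (⊤ : ℕ∞) f) :
    pderiv i ((pderiv j)^[m] f) = (pderiv j)^[m] (pderiv i f) := by
  induction m generalizing f with
  | zero => rfl
  | succ m ih =>
    rw [Function.iterate_succ_apply, Function.iterate_succ_apply, ih (contDiff_pderiv j hf),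
      pderiv_comm i j hf]

/-- The partial derivatives are composed in a fixed order, so the new one is commuted inwards, by
symmetry of second derivatives, until it meets the block of its own variable. -/
theorem pderiv_mderiv (i : Fin n) (α : Fin n → ℕ) {f : EuclideanSpace ℝ (Fin n) → ℝ}
    (hf : ContDiff ℝ (⊤ : ℕ∞) f) :
    pderiv i (mderiv α f) = mderiv (α + Pi.single i 1) f := by
  have smooth : ∀ l : List (Fin n),
      ContDiff ℝ (⊤ : ℕ∞) (l.foldr (fun i g => (pderiv i)^[α i] g) f) := by
    intro l
    induction l with
    | nil => exact hf
    | cons j l ih => exact contDiff_pderiv_iterate _ _ ih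
  have notMem : ∀ l : List (Fin n), i ∉ l →
      l.foldr (fun j g => (pderiv j)^[(α + Pi.single i 1 : Fin n → ℕ) j] g) f =
        l.foldr (fun j g => (pderiv j)^[α j] g) f := by
    intro l hl
    induction l with
    | nil => rfl
    | cons j l ih =>
      rw [List.mem_cons, not_or] at hl
      rw [List.foldr_cons, List.foldr_cons, ih hl.2]
      simp [Pi.single_eq_of_ne (Ne.symm hl.1)]
  have mem : ∀ l : List (Fin n), l.Nodup → i ∈ l →
      pderiv i (l.foldr (fun j g => (pderiv j)^[α j] g) f) =
        l.foldr (fun j g => (pderiv j)^[(α + Pi.single i 1 : Fin n → ℕ) j] g) f := by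
    intro l hl hi
    induction l with
    | nil => simp at hi
    | cons j l ih =>
      rw [List.nodup_cons] at hl
      rw [List.foldr_cons, List.foldr_cons]
      by_cases hij : i = j
      · subst hij
        rw [notMem l hl.1, ← Function.iterate_succ_apply' (pderiv i)]
        simp
      · rw [pderiv_pderiv_iterate i j _ (smooth l),
          ih hl.2 ((List.mem_cons.1 hi).resolve_left hij)]
        simp [Pi.single_eq_of_ne (Ne.symm hij)]
  exact mem _ (List.nodup_finRange n) (List.mem_finRange i)

theorem hasDerivAt_comp_line {f : EuclideanSpace ℝ (Fin n) → ℝ} (hf : Differentiable ℝ f)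
    (a v : EuclideanSpace ℝ (Fin n)) (t : ℝ) :
    HasDerivAt (fun t : ℝ => f (a + t • v)) (∑ i, v i * pderiv i f (a + t • v)) t := by
  have h1 : HasDerivAt (fun t : ℝ => a + t • v) v t := by
    simpa using ((hasDerivAt_id t).smul_const v).const_add a
  have h2 := (hf (a + t • v)).hasFDerivAt.comp_hasDerivAt t h1
  have h3 : v = ∑ i, v i • EuclideanSpace.single i (1 : ℝ) := by
    have := (EuclideanSpace.basisFun (Fin n) ℝ).sum_repr v
    simpa using this.symm
  refine h2.congr_deriv ?_
  rw [show fderiv ℝ f (a + t • v) v = fderiv ℝ f (a + t • v)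
    (∑ i, v i • EuclideanSpace.single i (1 : ℝ)) from congrArg _ h3, map_sum]
  simp [pderiv]

end PartialDerivatives

/-! ### Normalized monomials -/

section Monomials

variable {n : ℕ}

/-- The monomial `v^β / β!`. -/
def mon (β : Fin n → ℕ) (v : Fin n → ℝ) : ℝ := (∏ i, v i ^ β i) / ∏ i, ((β i)! : ℝ)

theorem prod_factorial_pos (β : Fin n → ℕ) : 0 < ∏ i, ((β i)! : ℝ) :=
  Finset.prod_pos fun i _ => by positivity

theorem mem_piAntidiag_univ {k : ℕ} {β : Fin n → ℕ} :
    β ∈ Finset.piAntidiag Finset.univ k ↔ len β = k := by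
  simp [Finset.mem_piAntidiag, len]

theorem len_add (α β : Fin n → ℕ) : len (α + β) = len α + len β := by
  simp [len, Finset.sum_add_distrib]

theorem len_single (i : Fin n) : len (Pi.single i 1 : Fin n → ℕ) = 1 := by
  simp [len]

theorem sum_mon (v : Fin n → ℝ) (k : ℕ) :
    ∑ β ∈ Finset.piAntidiag Finset.univ k, mon β v = (∑ i, v i) ^ k / k ! := by
  rw [Finset.sum_pow_eq_sum_piAntidiag, Finset.sum_div]
  refine Finset.sum_congr rfl fun β hβ => ?_
  have h1 := Nat.multinomial_spec Finset.univ β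
  have h2 : ∑ i, β i = k := mem_piAntidiag_univ.1 hβ
  rw [h2] at h1
  have h3 : (∏ i, ((β i)! : ℝ)) * Nat.multinomial Finset.univ β = k ! := by exact_mod_cast h1
  have h4 := prod_factorial_pos β
  rw [mon, div_eq_div_iff h4.ne' (by positivity), ← h3]
  ring

theorem mon_abs (β : Fin n → ℕ) (v : Fin n → ℝ) : |mon β v| = mon β fun i => |v i| := by
  rw [mon, abs_div, abs_of_pos (prod_factorial_pos β), Finset.abs_prod]
  simp only [abs_pow, mon]

theorem mon_add_single (β : Fin n → ℕ) (v : Fin n → ℝ) (i : Fin n) :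
    ((β i : ℝ) + 1) * mon (β + Pi.single i 1) v = mon β v * v i := by
  have h1 : ∏ j, v j ^ (β + Pi.single i 1 : Fin n → ℕ) j = (∏ j, v j ^ β j) * v i := by
    simp only [Pi.add_apply, pow_add, Finset.prod_mul_distrib]
    congr 1
    rw [Finset.prod_eq_single i] <;> simp +contextual
  have h2 : ∏ j, (((β + Pi.single i 1 : Fin n → ℕ) j)! : ℝ) =
      (∏ j, ((β j)! : ℝ)) * (β i + 1) := by
    rw [← Finset.mul_prod_erase _ _ (Finset.mem_univ i),
      ← Finset.mul_prod_erase Finset.univ (fun j => ((β j)! : ℝ)) (Finset.mem_univ i)]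
    have : ∀ j ∈ Finset.univ.erase i, (((β + Pi.single i 1 : Fin n → ℕ) j)! : ℝ) = (β j)! := by
      intro j hj
      simp [Pi.single_eq_of_ne (Finset.ne_of_mem_erase hj)]
    rw [Finset.prod_congr rfl this]
    simp only [Pi.add_apply, Pi.single_eq_same, Nat.factorial_succ]
    push_cast
    ring
  have h4 := (prod_factorial_pos β).ne'
  rw [mon, mon, h1, h2]
  field_simp

/-- The shift by the `i`-th unit multi-index misses exactly the `γ` with `γ i = 0`, where `F`
vanishes. -/
theorem sum_piAntidiag_add_single (i : Fin n) (k : ℕ) (F : (Fin n → ℕ) → ℝ)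
    (hF : ∀ γ, γ i = 0 → F γ = 0) :
    ∑ β ∈ Finset.piAntidiag Finset.univ k, F (β + Pi.single i 1) =
      ∑ γ ∈ Finset.piAntidiag Finset.univ (k + 1), F γ := by
  refine Finset.sum_of_injOn (fun β => β + Pi.single i 1) (fun β _ γ _ h => add_right_cancel h)
    (fun β hβ => ?_) (fun γ hγ h => hF γ ?_) fun _ _ => rfl
  · have := mem_piAntidiag_univ.1 (Finset.mem_coe.1 hβ)
    exact Finset.mem_coe.2 (mem_piAntidiag_univ.2 (by rw [len_add, len_single, this]))
  · by_contra hi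
    refine h ⟨γ - Pi.single i 1, ?_, ?_⟩
    · have h1 : γ - Pi.single i 1 + Pi.single i 1 = γ := by
        ext j
        rcases eq_or_ne j i with rfl | hj
        · simp; omega
        · simp [Pi.single_eq_of_ne hj]
      have h2 := mem_piAntidiag_univ.1 hγ
      rw [← h1, len_add, len_single] at h2
      exact Finset.mem_coe.2 (mem_piAntidiag_univ.2 (by omega))
    · ext j
      rcases eq_or_ne j i with rfl | hj
      · simp; omega
      · simp [Pi.single_eq_of_ne hj]

end Monomials

/-! ### Taylor's formula -/

section Taylor

variable {n : ℕ}

/-- The derivative of the Taylor error is the Taylor error of the shifted family, whose bound by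
induction is the derivative of the claimed bound. -/
theorem abs_sub_taylor_le {g : ℕ → ℝ → ℝ} (hg : ∀ k t, HasDerivAt (g k) (g (k + 1) t) t) {B : ℝ}
    (m : ℕ) (hB : ∀ t ∈ Icc (0 : ℝ) 1, |g m t| ≤ B) :
    ∀ t ∈ Icc (0 : ℝ) 1, |g 0 t - ∑ k ∈ Finset.range m, g k 0 * t ^ k / k !| ≤ B * t ^ m / m ! := by
  induction m generalizing g with
  | zero => simpa using hB
  | succ m ih =>
    have h1 := ih (g := fun k => g (k + 1)) (fun k t => hg (k + 1) t) hB
    have hpow : ∀ (c : ℝ) (k : ℕ) (t : ℝ),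
        HasDerivAt (fun t => c * t ^ (k + 1) / (k + 1)!) (c * t ^ k / k !) t := by
      intro c k t
      have := ((hasDerivAt_pow (k + 1) t).const_mul c).div_const ((k + 1)! : ℝ)
      refine this.congr_deriv ?_
      rw [Nat.factorial_succ]
      push_cast
      have : ((k : ℝ) + 1) ≠ 0 := by positivity
      field_simp
    have hderiv : ∀ t, HasDerivAt (fun t => g 0 t - ∑ k ∈ Finset.range (m + 1), g k 0 * t ^ k / k !)
        (g 1 t - ∑ k ∈ Finset.range m, g (k + 1) 0 * t ^ k / k !) t := by
      intro t
      refine (hg 0 t).sub ?_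
      simp only [Finset.sum_range_succ']
      simp only [pow_zero, mul_one]
      exact (HasDerivAt.fun_sum fun k _ => hpow (g (k + 1) 0) k t).add_const _
    refine image_norm_le_of_norm_deriv_right_le_deriv_boundary
      (fun t _ => (hderiv t).continuousAt.continuousWithinAt)
      (fun t _ => (hderiv t).hasDerivWithinAt) ?_ (fun t => hpow B m t)
      fun t ht => h1 t ⟨ht.1, ht.2.le⟩
    simp [Finset.sum_range_succ']

/-- Differentiation in direction `i` sends `β` to `γ = β + e_i` with weight `γ i`, by
`mon_add_single`. Summed over `i`, every `γ` receives the weight `|γ| = k + 1`. -/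
theorem hasDerivAt_sum_mon_mderiv {f : EuclideanSpace ℝ (Fin n) → ℝ}
    (hf : ContDiff ℝ (⊤ : ℕ∞) f) (α : Fin n → ℕ) (a v : EuclideanSpace ℝ (Fin n)) (k : ℕ) (t : ℝ) :
    HasDerivAt (fun t : ℝ => ∑ β ∈ Finset.piAntidiag Finset.univ k,
        mon β v * mderiv (α + β) f (a + t • v))
      ((k + 1) * ∑ β ∈ Finset.piAntidiag Finset.univ (k + 1),
        mon β v * mderiv (α + β) f (a + t • v)) t := by
  have h1 : HasDerivAt (fun t : ℝ => ∑ β ∈ Finset.piAntidiag Finset.univ k,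
      mon β v * mderiv (α + β) f (a + t • v))
      (∑ β ∈ Finset.piAntidiag Finset.univ k,
        mon β v * ∑ i, v i * pderiv i (mderiv (α + β) f) (a + t • v)) t :=
    HasDerivAt.fun_sum fun β _ => (hasDerivAt_comp_line
      ((contDiff_mderiv _ hf).differentiable (by simp)) a v t).const_mul _
  refine h1.congr_deriv ?_
  have h2 : ∀ i : Fin n, ∑ β ∈ Finset.piAntidiag Finset.univ k,
      mon β v * (v i * pderiv i (mderiv (α + β) f) (a + t • v)) =
      ∑ γ ∈ Finset.piAntidiag Finset.univ (k + 1),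
        γ i * (mon γ v * mderiv (α + γ) f (a + t • v)) := by
    intro i
    rw [← sum_piAntidiag_add_single i k fun γ => γ i * (mon γ v * mderiv (α + γ) f (a + t • v))]
    · refine Finset.sum_congr rfl fun β _ => ?_
      rw [pderiv_mderiv i _ hf, ← mul_assoc, ← mon_add_single, add_assoc]
      simp only [Pi.add_apply, Pi.single_eq_same]
      push_cast
      ring
    · intro γ hγ
      simp [hγ]
  simp only [Finset.mul_sum]
  symm
  rw [Finset.sum_comm, Finset.sum_congr rfl fun i _ => h2 i, Finset.sum_comm]
  refine Finset.sum_congr rfl fun γ hγ => ?_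
  rw [← Finset.sum_mul]
  congr 1
  have := mem_piAntidiag_univ.1 hγ
  rw [len] at this
  exact_mod_cast this.symm

/-- One-variable Taylor along `t ↦ a + t (b - a)`; the multinomial theorem sums the monomials of
degree `m` to `(∑ |v i|)^m / m!`, and `∑ |v i| ≤ n ‖v‖`. -/
theorem abs_sub_sum_mon_mderiv_le {f : EuclideanSpace ℝ (Fin n) → ℝ}
    (hf : ContDiff ℝ (⊤ : ℕ∞) f) (α : Fin n → ℕ) {m : ℕ} {B : ℝ}
    (hB : ∀ γ, len γ = len α + m → ∀ x, |mderiv γ f x| ≤ B) (a b : EuclideanSpace ℝ (Fin n)) :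
    |mderiv α f b - ∑ k ∈ Finset.range m, ∑ β ∈ Finset.piAntidiag Finset.univ k,
        mon β (fun i => b i - a i) * mderiv (α + β) f a| ≤
      B * (n * ‖b - a‖) ^ m / m ! := by
  set v := b - a with hv
  set g : ℕ → ℝ → ℝ := fun k t => k ! * ∑ β ∈ Finset.piAntidiag Finset.univ k,
    mon β v * mderiv (α + β) f (a + t • v) with hg
  have hd : ∀ k t, HasDerivAt (g k) (g (k + 1) t) t := by
    intro k t
    refine ((hasDerivAt_sum_mon_mderiv hf α a v k t).const_mul (k ! : ℝ)).congr_deriv ?_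
    simp only [hg, Nat.factorial_succ]
    push_cast
    ring
  have hsum : ∑ i, |v i| ≤ n * ‖v‖ := by
    calc ∑ i, |v i| ≤ ∑ _i : Fin n, ‖v‖ := Finset.sum_le_sum fun i _ => by
          simpa using PiLp.norm_apply_le v i
      _ = n * ‖v‖ := by simp
  have hbd : ∀ t ∈ Icc (0 : ℝ) 1, |g m t| ≤ B * (n * ‖v‖) ^ m := by
    intro t _
    by_cases hB0 : ∃ γ : Fin n → ℕ, len γ = len α + m
    · obtain ⟨γ, hγ⟩ := hB0
      have hBn : 0 ≤ B := (abs_nonneg _).trans (hB γ hγ 0)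
      calc |g m t| = m ! * |∑ β ∈ Finset.piAntidiag Finset.univ m,
            mon β v * mderiv (α + β) f (a + t • v)| := by
            simp only [hg]
            rw [abs_mul, abs_of_pos (by positivity : (0 : ℝ) < m !)]
        _ ≤ m ! * ∑ β ∈ Finset.piAntidiag Finset.univ m, mon β (fun i => |v i|) * B := by
            gcongr
            refine (Finset.abs_sum_le_sum_abs _ _).trans (Finset.sum_le_sum fun β hβ => ?_)
            rw [abs_mul, mon_abs]
            refine mul_le_mul_of_nonneg_left (hB _ ?_ _) (mon_abs β v ▸ abs_nonneg _)
            rw [len_add, mem_piAntidiag_univ.1 hβ]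
        _ = B * (∑ i, |v i|) ^ m := by
            rw [← Finset.sum_mul, sum_mon]
            field_simp
        _ ≤ B * (n * ‖v‖) ^ m := by
            have : 0 ≤ ∑ i, |v i| := Finset.sum_nonneg fun i _ => abs_nonneg _
            gcongr
    -- Without a multi-index of the required length `hB` says nothing about the sign of `B`. This
    -- forces `n = 0` and `m ≠ 0`, and both sides vanish.
    · have hempty : Finset.piAntidiag (Finset.univ : Finset (Fin n)) m = ∅ := by
        refine Finset.eq_empty_of_forall_notMem fun β hβ => hB0 ⟨α + β, ?_⟩
        rw [len_add, mem_piAntidiag_univ.1 hβ]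
      have hm : n = 0 ∧ m ≠ 0 := by
        refine ⟨?_, ?_⟩
        · by_contra hn
          refine hB0 ⟨α + Pi.single ⟨0, by omega⟩ m, ?_⟩
          rw [len_add]
          simp [len]
        · rintro rfl
          exact hB0 ⟨α, by simp⟩
      simp only [hg, hempty]
      simp [hm.1, hm.2]
  have h := abs_sub_taylor_le hd m hbd 1 (by simp)
  have h0 : g 0 1 = mderiv α f b := by
    have : Finset.piAntidiag (Finset.univ : Finset (Fin n)) 0 = {0} := by simp
    simp [hg, this, mon, hv]
  have hk : ∀ k, g k 0 * 1 ^ k / k ! = ∑ β ∈ Finset.piAntidiag Finset.univ k,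
      mon β (fun i => b i - a i) * mderiv (α + β) f a := by
    intro k
    simp only [hg, hv]
    have : (k ! : ℝ) ≠ 0 := by positivity
    rw [one_pow, mul_one, mul_div_cancel_left₀ _ this, zero_smul, add_zero]
    rfl
  simp only [h0, hk] at h
  simpa only [one_pow, mul_one] using h

end Taylor

/-! ### Restriction of ultradifferentiable functions -/

theorem mapsTo_jetMap (ω : ℝ → ℝ) {n : ℕ} (E : Set (EuclideanSpace ℝ (Fin n))) :
    MapsTo (jetMap E) (ultraFun ω n) (whitneyJet ω E) := by
  rintro ⟨f, hf⟩ ⟨ρ, hρ, C, hC⟩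
  have hb : ∀ (α : Fin n → ℕ) x, |mderiv α f x| ≤ (|C| + 1) * weightSeq ω ρ (len α) := by
    intro α x
    have h := hC α x
    rw [Real.exp_neg, ← div_eq_mul_inv, div_le_iff₀ (Real.exp_pos _)] at h
    refine h.trans ?_
    have := (weightSeq_pos (ω := ω) ρ (len α)).le
    exact mul_le_mul_of_nonneg_right (by linarith [le_abs_self C]) this
  refine ⟨weightSeq ω ρ, ⟨ρ, by exact_mod_cast hρ, rfl⟩, n + 1, by positivity, |C| + 1,
    by positivity, fun α a => ?_, fun p α hα a b => ?_⟩
  · refine (hb α a).trans ?_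
    have := (weightSeq_pos (ω := ω) ρ (len α)).le
    refine mul_le_mul_of_nonneg_right ?_ this
    refine le_mul_of_one_le_right (by positivity) (one_le_pow₀ ?_)
    linarith [Nat.cast_nonneg (α := ℝ) n]
  · have h := abs_sub_sum_mon_mderiv_le hf α (m := p + 1 - len α)
      (B := (|C| + 1) * weightSeq ω ρ (p + 1))
      (fun γ hγ x => by
        have := hb γ x
        rwa [hγ, show len α + (p + 1 - len α) = p + 1 by omega] at this) a.1 b.1
    have h1 : p + 1 - len α = p - len α + 1 := by omega
    have h2 : remainder (jetMap E ⟨f, hf⟩) p α a b =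
        mderiv α f b - ∑ k ∈ Finset.range (p + 1 - len α),
          ∑ β ∈ Finset.piAntidiag Finset.univ k,
            mon β (fun i => b.1 i - a.1 i) * mderiv (α + β) f a := by
      rw [h1]
      rfl
    rw [h2]
    refine h.trans ?_
    have hw := (weightSeq_pos (ω := ω) ρ (p + 1)).le
    have hn : (n : ℝ) ^ (p + 1 - len α) ≤ (n + 1) ^ (p + 1) :=
      (pow_le_pow_left₀ (Nat.cast_nonneg n) (by linarith) _).trans
        (pow_le_pow_right₀ (by linarith [Nat.cast_nonneg (α := ℝ) n]) (by omega))
    rw [mul_pow, ← mul_assoc, mul_div_assoc]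
    refine mul_le_mul_of_nonneg_right ?_ (by positivity)
    calc (|C| + 1) * weightSeq ω ρ (p + 1) * (n : ℝ) ^ (p + 1 - len α)
        ≤ (|C| + 1) * weightSeq ω ρ (p + 1) * (n + 1) ^ (p + 1) := by gcongr
      _ = _ := by ring

/-! ### Derivatives of polynomials -/

section Polynomials

variable {n : ℕ}

theorem contDiff_coord_sub (i : Fin n) (c : ℝ) :
    ContDiff ℝ (⊤ : ℕ∞) fun y : EuclideanSpace ℝ (Fin n) => y i - c := by
  fun_prop

theorem norm_iteratedFDeriv_mul_const_le {f : EuclideanSpace ℝ (Fin n) → ℝ}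
    (hf : ContDiff ℝ (⊤ : ℕ∞) f) (c : ℝ) (k : ℕ) (x : EuclideanSpace ℝ (Fin n)) :
    ‖iteratedFDeriv ℝ k (fun y => f y * c) x‖ ≤ ‖iteratedFDeriv ℝ k f x‖ * |c| := by
  have h1 : (fun y => f y * c) = fun y => c • f y := by
    ext y
    simp [mul_comm]
  rw [h1, iteratedFDeriv_const_smul_apply' (hf.of_le (by exact_mod_cast le_top)).contDiffAt,
    norm_smul, Real.norm_eq_abs, mul_comm]

theorem norm_fderiv_coord_sub_le (i : Fin n) (c : ℝ) (x : EuclideanSpace ℝ (Fin n)) :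
    ‖fderiv ℝ (fun y : EuclideanSpace ℝ (Fin n) => y i - c) x‖ ≤ 1 := by
  have h : HasFDerivAt (fun y : EuclideanSpace ℝ (Fin n) => y i - c)
      (EuclideanSpace.proj i : EuclideanSpace ℝ (Fin n) →L[ℝ] ℝ) x :=
    (EuclideanSpace.proj i : EuclideanSpace ℝ (Fin n) →L[ℝ] ℝ).hasFDerivAt.sub_const c
  rw [h.fderiv]
  refine ContinuousLinearMap.opNorm_le_bound _ zero_le_one fun y => ?_
  simpa using PiLp.norm_apply_le y i

theorem iteratedFDeriv_coord_sub (i : Fin n) (c : ℝ) (k : ℕ) (x : EuclideanSpace ℝ (Fin n)) :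
    ‖iteratedFDeriv ℝ (k + 2) (fun y : EuclideanSpace ℝ (Fin n) => y i - c) x‖ = 0 := by
  have h : fderiv ℝ (fun y : EuclideanSpace ℝ (Fin n) => y i - c) =
      fun _ => (EuclideanSpace.proj i : EuclideanSpace ℝ (Fin n) →L[ℝ] ℝ) := by
    ext1 y
    exact ((EuclideanSpace.proj i : EuclideanSpace ℝ (Fin n) →L[ℝ] ℝ).hasFDerivAt.sub_const
      c).fderiv
  rw [← norm_iteratedFDeriv_fderiv, h, iteratedFDeriv_succ_const]
  simp

/-- The bound is the `k`-th derivative of `t^j` at `r`. An affine factor leaves only two terms in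
Leibniz' rule, and `(k + 1) + (j - k) = j + 1` reproduces the bound for `t^{j+1}`. -/
theorem norm_iteratedFDeriv_coord_mul_le {g : EuclideanSpace ℝ (Fin n) → ℝ}
    (hg : ContDiff ℝ (⊤ : ℕ∞) g) {r : ℝ} (hr : 0 ≤ r) (i : Fin n) (c : ℝ)
    {x : EuclideanSpace ℝ (Fin n)} (hx : |x i - c| ≤ r) {j : ℕ}
    (h : ∀ k, ‖iteratedFDeriv ℝ k g x‖ ≤ j.descFactorial k * r ^ (j - k)) (k : ℕ) :
    ‖iteratedFDeriv ℝ k (fun y => (y i - c) * g y) x‖ ≤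
      (j + 1).descFactorial k * r ^ (j + 1 - k) := by
  have h1 := norm_iteratedFDeriv_mul_le (contDiff_coord_sub i c) hg x (n := k)
    (by exact_mod_cast le_top)
  refine h1.trans ?_
  rcases k with _ | k
  · have h2 := h 0
    simp only [Nat.descFactorial_zero, Nat.cast_one, one_mul, Nat.sub_zero] at h2
    simp only [zero_add, Finset.range_one, Finset.sum_singleton, Nat.choose_self, Nat.cast_one,
      one_mul, norm_iteratedFDeriv_zero, Nat.sub_zero, Nat.descFactorial_zero]
    rw [norm_iteratedFDeriv_zero] at h2
    rw [pow_succ', Real.norm_eq_abs]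
    exact mul_le_mul hx h2 (norm_nonneg _) hr
  · rw [Finset.sum_range_succ', Finset.sum_range_succ',
      Finset.sum_eq_zero fun m _ => by rw [iteratedFDeriv_coord_sub]; simp]
    have h2 := h k
    have h3 := h (k + 1)
    have h4 := norm_fderiv_coord_sub_le i c x
    simp only [zero_add, Nat.choose_one_right, Nat.choose_zero_right, Nat.cast_one, one_mul,
      Nat.sub_zero, norm_iteratedFDeriv_zero,
      Nat.succ_descFactorial_succ, Nat.add_sub_add_right, Real.norm_eq_abs]
    rw [show (0 : ℕ) + 1 = 1 from rfl, norm_iteratedFDeriv_one, Nat.add_sub_cancel]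
    have h5 : ((k + 1 : ℕ) : ℝ) * ‖fderiv ℝ (fun y : EuclideanSpace ℝ (Fin n) => y i - c) x‖ *
        ‖iteratedFDeriv ℝ k g x‖ ≤ ((k + 1 : ℕ) : ℝ) * 1 * (j.descFactorial k * r ^ (j - k)) := by
      gcongr
    have h6 : |x i - c| * ‖iteratedFDeriv ℝ (k + 1) g x‖ ≤
        r * (j.descFactorial (k + 1) * r ^ (j - (k + 1))) := by
      gcongr
    refine (add_le_add h5 h6).trans ?_
    rcases lt_trichotomy k j with hk | rfl | hk
    · have h7 : r ^ (j - k) = r * r ^ (j - (k + 1)) := by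
        rw [← pow_succ']
        congr 1
        omega
      rw [Nat.descFactorial_succ, h7]
      push_cast [Nat.cast_sub hk.le]
      apply le_of_eq
      ring
    · rw [Nat.descFactorial_of_lt (Nat.lt_succ_self k)]
      push_cast
      apply le_of_eq
      ring
    · rw [Nat.descFactorial_of_lt hk, Nat.descFactorial_of_lt (hk.trans (Nat.lt_succ_self k))]
      simp

theorem contDiff_mon (β : Fin n → ℕ) (a : EuclideanSpace ℝ (Fin n)) :
    ContDiff ℝ (⊤ : ℕ∞) fun y : EuclideanSpace ℝ (Fin n) => mon β fun i => y i - a i :=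
  (contDiff_prod fun i _ => (contDiff_coord_sub i (a i)).pow (β i)).div_const _

theorem norm_iteratedFDeriv_mon_le (β : Fin n → ℕ) {r : ℝ} (hr : 0 ≤ r)
    {a x : EuclideanSpace ℝ (Fin n)} (hx : ∀ i, |x i - a i| ≤ r) (k : ℕ) :
    ‖iteratedFDeriv ℝ k (fun y : EuclideanSpace ℝ (Fin n) => mon β fun i => y i - a i) x‖ ≤
      (len β).descFactorial k * r ^ (len β - k) * mon β fun _ => 1 := by
  have hpow : ∀ (i : Fin n) (g : EuclideanSpace ℝ (Fin n) → ℝ) (j m : ℕ),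
      ContDiff ℝ (⊤ : ℕ∞) g →
      (∀ k, ‖iteratedFDeriv ℝ k g x‖ ≤ j.descFactorial k * r ^ (j - k)) →
      ∀ k, ‖iteratedFDeriv ℝ k (fun y => (y i - a i) ^ m * g y) x‖ ≤
        (m + j).descFactorial k * r ^ (m + j - k) := by
    intro i g j m hg h
    induction m with
    | zero => simpa using h
    | succ m ih =>
      have h1 := norm_iteratedFDeriv_coord_mul_le
        (((contDiff_coord_sub i (a i)).pow m).mul hg) hr i (a i) (hx i) ih
      simp only [← mul_assoc, ← pow_succ'] at h1
      rwa [show m + 1 + j = m + j + 1 by omega]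
  have hprod : ∀ s : Finset (Fin n), ∀ k,
      ‖iteratedFDeriv ℝ k (fun y : EuclideanSpace ℝ (Fin n) => ∏ i ∈ s, (y i - a i) ^ β i) x‖ ≤
        (∑ i ∈ s, β i).descFactorial k * r ^ (∑ i ∈ s, β i - k) := by
    intro s
    induction s using Finset.induction_on with
    | empty =>
      intro k
      rcases k with _ | k
      · simp
      · simp [iteratedFDeriv_succ_const]
    | insert i s hi ih =>
      simp only [Finset.prod_insert hi, Finset.sum_insert hi]
      exact hpow i _ _ _ (contDiff_prod fun i _ => (contDiff_coord_sub i (a i)).pow (β i)) ih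
  have h1 : (fun y : EuclideanSpace ℝ (Fin n) => mon β fun i => y i - a i) =
      fun y => (∏ i, (y i - a i) ^ β i) * mon β fun _ => 1 := by
    ext y
    simp [mon, div_eq_mul_inv]
  rw [h1]
  refine (norm_iteratedFDeriv_mul_const_le
    (contDiff_prod fun i _ => (contDiff_coord_sub i (a i)).pow (β i)) _ k x).trans ?_
  have h2 : 0 ≤ mon β fun _ => 1 := by simp [mon]; exact (prod_factorial_pos β).le
  rw [abs_of_nonneg h2]
  exact mul_le_mul_of_nonneg_right (hprod Finset.univ k) h2

/-- The polynomial with coefficients `c β / β!` at the multi-indices with length in `J`, centred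
at `a`. -/
def polyOn (c : (Fin n → ℕ) → ℝ) (J : Finset ℕ) (a x : EuclideanSpace ℝ (Fin n)) : ℝ :=
  ∑ j ∈ J, ∑ β ∈ Finset.piAntidiag Finset.univ j, (mon β fun i => x i - a i) * c β

theorem contDiff_polyOn (c : (Fin n → ℕ) → ℝ) (J : Finset ℕ) (a : EuclideanSpace ℝ (Fin n)) :
    ContDiff ℝ (⊤ : ℕ∞) (polyOn c J a) :=
  ContDiff.sum fun _ _ => ContDiff.sum fun β _ => (contDiff_mon β a).mul contDiff_const

theorem norm_iteratedFDeriv_polyOn_le {c : (Fin n → ℕ) → ℝ} {J : Finset ℕ} {B : ℕ → ℝ}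
    (hc : ∀ β, len β ∈ J → |c β| ≤ B (len β)) {r : ℝ} (hr : 0 ≤ r)
    {a x : EuclideanSpace ℝ (Fin n)} (hx : ∀ i, |x i - a i| ≤ r) (k : ℕ) :
    ‖iteratedFDeriv ℝ k (polyOn c J a) x‖ ≤
      ∑ j ∈ J, B j * ((n : ℝ) ^ j / j !) * (j.descFactorial k * r ^ (j - k)) := by
  have hk : ((k : ℕ∞) : WithTop ℕ∞) ≤ ((⊤ : ℕ∞) : WithTop ℕ∞) := by exact_mod_cast le_top
  have hsm : ∀ β : Fin n → ℕ, ContDiff ℝ (⊤ : ℕ∞)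
      fun y : EuclideanSpace ℝ (Fin n) => (mon β fun i => y i - a i) * c β :=
    fun β => (contDiff_mon β a).mul contDiff_const
  have h1 : polyOn c J a = fun x => ∑ j ∈ J, ∑ β ∈ Finset.piAntidiag Finset.univ j,
      (mon β fun i => x i - a i) * c β := rfl
  rw [h1, iteratedFDeriv_fun_sum_apply fun j _ =>
    ((ContDiff.sum fun β _ => hsm β).of_le hk).contDiffAt]
  refine (norm_sum_le _ _).trans (Finset.sum_le_sum fun j hj => ?_)
  rw [iteratedFDeriv_fun_sum_apply fun β _ => ((hsm β).of_le hk).contDiffAt]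
  have h2 : (n : ℝ) ^ j / j ! = ∑ β ∈ Finset.piAntidiag (Finset.univ : Finset (Fin n)) j,
      mon β fun _ => 1 := by
    rw [sum_mon]
    simp
  rw [h2, Finset.mul_sum, Finset.sum_mul]
  refine (norm_sum_le _ _).trans (Finset.sum_le_sum fun β hβ => ?_)
  have hl := mem_piAntidiag_univ.1 hβ
  have h3 := norm_iteratedFDeriv_mon_le β hr hx k
  rw [hl] at h3
  have h4 := hc β (by rwa [hl])
  rw [hl] at h4
  have h5 : 0 ≤ mon β fun _ => 1 := by simp [mon]; exact (prod_factorial_pos β).le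
  refine (norm_iteratedFDeriv_mul_const_le (contDiff_mon β a) (c β) k x).trans ?_
  refine (mul_le_mul h3 h4 (abs_nonneg _) (by positivity)).trans (le_of_eq ?_)
  ring

/-! ### Change of the centre -/

theorem pow_add_div_factorial (u v : ℝ) (m : ℕ) :
    (u + v) ^ m / m ! =
      ∑ p ∈ Finset.HasAntidiagonal.antidiagonal m, u ^ p.1 / (p.1)! * (v ^ p.2 / (p.2)!) := by
  rw [(Commute.all u v).add_pow', Finset.sum_div]
  refine Finset.sum_congr rfl fun p hp => ?_
  have h1 := Finset.HasAntidiagonal.mem_antidiagonal.1 hp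
  have h2 : ((p.1 + p.2).choose p.1 : ℝ) * (p.1)! * (p.2)! = (p.1 + p.2)! := by
    rw [Nat.choose_symm_add]
    exact_mod_cast Nat.add_choose_mul_factorial_mul_factorial p.1 p.2
  rw [← h1, ← h2, nsmul_eq_mul]
  have : (((p.1 + p.2).choose p.1 : ℕ) : ℝ) ≠ 0 := by
    exact_mod_cast (Nat.choose_pos (Nat.le_add_right _ _)).ne'
  field_simp

theorem mon_eq_prod (β : Fin n → ℕ) (v : Fin n → ℝ) : mon β v = ∏ i, v i ^ β i / (β i)! := by
  rw [mon, Finset.prod_div_distrib]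

theorem mon_add (β : Fin n → ℕ) (u v : Fin n → ℝ) :
    mon β (fun i => u i + v i) = ∑ p ∈ Fintype.piFinset fun i => Finset.HasAntidiagonal.antidiagonal (β i),
      mon (fun i => (p i).1) u * mon (fun i => (p i).2) v := by
  simp only [mon_eq_prod, pow_add_div_factorial, ← Finset.prod_mul_distrib]
  rw [Finset.prod_univ_sum]

/-- The multi-indices of length less than `q`. -/
def lenLT (n q : ℕ) : Finset (Fin n → ℕ) :=
  (Finset.range q).biUnion fun k => Finset.piAntidiag Finset.univ k

theorem mem_lenLT {q : ℕ} {β : Fin n → ℕ} : β ∈ lenLT n q ↔ len β < q := by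
  simp only [lenLT, Finset.mem_biUnion, mem_piAntidiag_univ, Finset.mem_range, exists_eq_right']

theorem sum_lenLT (q : ℕ) (f : (Fin n → ℕ) → ℝ) :
    ∑ β ∈ lenLT n q, f β =
      ∑ k ∈ Finset.range q, ∑ β ∈ Finset.piAntidiag Finset.univ k, f β := by
  refine Finset.sum_biUnion fun i _ j _ hij => Finset.disjoint_left.2 fun β h1 h2 => hij ?_
  rw [← mem_piAntidiag_univ.1 h1, ← mem_piAntidiag_univ.1 h2]

/-- Expanding `x - a = (x - b) + (b - a)` matches each `β` together with a splitting of it with a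
pair `(γ, δ)`, `γ + δ = β`. For a jet the inner sum is the one subtracted in `remainder`. -/
theorem polyOn_range_eq (c : (Fin n → ℕ) → ℝ) (q : ℕ) (a b x : EuclideanSpace ℝ (Fin n)) :
    polyOn c (Finset.range q) a x =
      ∑ β ∈ lenLT n q, (mon β fun i => x i - b i) *
        ∑ γ ∈ lenLT n (q - len β), (mon γ fun i => b i - a i) * c (β + γ) := by
  have h1 : ∀ β, (mon β fun i => x i - a i) * c β =
      ∑ p ∈ Fintype.piFinset fun i => Finset.HasAntidiagonal.antidiagonal (β i),
        (mon (fun i => (p i).1) fun i => x i - b i) *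
          (mon (fun i => (p i).2) fun i => b i - a i) * c β := by
    intro β
    rw [← Finset.sum_mul, ← mon_add]
    congr 2
    ext i
    ring
  rw [polyOn, ← sum_lenLT]
  simp only [h1, Finset.mul_sum]
  rw [Finset.sum_sigma', Finset.sum_sigma']
  refine Finset.sum_bij' (fun s _ => ⟨fun i => (s.2 i).1, fun i => (s.2 i).2⟩)
    (fun s _ => ⟨s.1 + s.2, fun i => (s.1 i, s.2 i)⟩) ?_ ?_ ?_ ?_ ?_
  · rintro ⟨β, p⟩ h
    simp only [Finset.mem_sigma, mem_lenLT, Fintype.mem_piFinset, Finset.HasAntidiagonal.mem_antidiagonal] at h ⊢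
    have h2 : len β = len (fun i => (p i).1) + len fun i => (p i).2 := by
      rw [← len_add]
      congr 1
      ext i
      exact (h.2 i).symm
    omega
  · rintro ⟨γ, δ⟩ h
    simp only [Finset.mem_sigma, mem_lenLT, Fintype.mem_piFinset, Finset.HasAntidiagonal.mem_antidiagonal] at h ⊢
    refine ⟨?_, fun i => rfl⟩
    rw [len_add]
    omega
  · rintro ⟨β, p⟩ h
    simp only [Finset.mem_sigma, mem_lenLT, Fintype.mem_piFinset, Finset.HasAntidiagonal.mem_antidiagonal] at h
    have : β = (fun i => (p i).1) + fun i => (p i).2 := by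
      ext i
      exact (h.2 i).symm
    subst this
    rfl
  · rintro ⟨γ, δ⟩ _
    rfl
  · rintro ⟨β, p⟩ h
    simp only [Finset.mem_sigma, mem_lenLT, Fintype.mem_piFinset, Finset.HasAntidiagonal.mem_antidiagonal] at h
    have : β = (fun i => (p i).1) + fun i => (p i).2 := by
      ext i
      exact (h.2 i).symm
    simp only [← this]
    ring

end Polynomials

/-! ### Taylor polynomials of Whitney jets -/

section TaylorPolynomials

variable {n : ℕ}

theorem pderiv_mon (i : Fin n) (γ : Fin n → ℕ) (a y : EuclideanSpace ℝ (Fin n)) :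
    pderiv i (fun y : EuclideanSpace ℝ (Fin n) => mon γ fun j => y j - a j) y =
      if γ i = 0 then 0 else mon (γ - Pi.single i 1) fun j => y j - a j := by
  set f : EuclideanSpace ℝ (Fin n) → ℝ := fun y => mon γ fun j => y j - a j with hf
  have h1 : HasDerivAt (fun t : ℝ => y + t • EuclideanSpace.single i (1 : ℝ))
      (EuclideanSpace.single i (1 : ℝ)) 0 := by
    simpa using ((hasDerivAt_id (0 : ℝ)).smul_const (EuclideanSpace.single i (1 : ℝ))).const_add y
  have h2 := ((contDiff_mon γ a).differentiable (by simp)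
    (y + (0 : ℝ) • EuclideanSpace.single i (1 : ℝ))).hasFDerivAt.comp_hasDerivAt 0 h1
  rw [zero_smul, add_zero] at h2
  set K := ∏ j ∈ Finset.univ.erase i, (y j - a j) ^ γ j / ((γ j)! : ℝ) with hK
  have h3 : (f ∘ fun t : ℝ => y + t • EuclideanSpace.single i (1 : ℝ)) =
      fun t => (y i - a i + t) ^ γ i / ((γ i)! : ℝ) * K := by
    ext t
    simp only [Function.comp_apply, hf, mon_eq_prod]
    rw [← Finset.mul_prod_erase _ _ (Finset.mem_univ i)]
    congr 1
    · simp
      ring_nf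
    · refine Finset.prod_congr rfl fun j hj => ?_
      simp [Finset.ne_of_mem_erase hj]
  have h4 : HasDerivAt (fun t : ℝ => (y i - a i + t) ^ γ i / ((γ i)! : ℝ) * K)
      ((γ i : ℝ) * (y i - a i) ^ (γ i - 1) / ((γ i)! : ℝ) * K) 0 := by
    have := ((((hasDerivAt_id (0 : ℝ)).const_add (y i - a i)).pow (γ i)).div_const
      ((γ i)! : ℝ)).mul_const K
    simpa using this
  rw [h3] at h2
  have h5 : pderiv i f y = (γ i : ℝ) * (y i - a i) ^ (γ i - 1) / ((γ i)! : ℝ) * K :=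
    h2.unique h4
  rw [h5]
  split_ifs with h0
  · simp [h0]
  · obtain ⟨m, hm⟩ := Nat.exists_eq_succ_of_ne_zero h0
    rw [mon_eq_prod, ← Finset.mul_prod_erase _ _ (Finset.mem_univ i)]
    congr 1
    · simp only [Pi.sub_apply, Pi.single_eq_same, hm, Nat.succ_eq_add_one, Nat.add_sub_cancel,
        Nat.factorial_succ]
      push_cast
      field_simp
    · refine Finset.prod_congr rfl fun j hj => ?_
      simp [Pi.single_eq_of_ne (Finset.ne_of_mem_erase hj)]

open Classical in
theorem mderiv_mon (α β : Fin n → ℕ) (a : EuclideanSpace ℝ (Fin n)) :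
    mderiv α (fun y : EuclideanSpace ℝ (Fin n) => mon β fun j => y j - a j) =
      fun y => if α ≤ β then mon (β - α) fun j => y j - a j else 0 := by
  induction h : len α generalizing α with
  | zero =>
    have h0 : α = 0 := by
      ext i
      simp only [len, Finset.sum_eq_zero_iff] at h
      exact h i (Finset.mem_univ i)
    subst h0
    have h1 : ∀ (l : List (Fin n)) (f : EuclideanSpace ℝ (Fin n) → ℝ),
        l.foldr (fun i g => (pderiv i)^[(0 : Fin n → ℕ) i] g) f = f := by
      intro l f
      induction l with
      | nil => rfl
      | cons i l ih => rw [List.foldr_cons, ih]; rfl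
    rw [mderiv, h1]
    simp
  | succ m ih =>
    obtain ⟨i, hi⟩ : ∃ i, α i ≠ 0 := by
      by_contra! h0
      simp [len, h0] at h
    set α' := α - Pi.single i 1 with hα'
    have hα : α = α' + Pi.single i 1 := by
      ext j
      rcases eq_or_ne j i with rfl | hj
      · simp [hα']; omega
      · simp [hα', Pi.single_eq_of_ne hj]
    have hlen : len α' = m := by
      rw [hα, len_add, len_single] at h
      omega
    rw [hα, ← pderiv_mderiv i α' (contDiff_mon β a), ih α' hlen]
    ext y
    by_cases hle : α' ≤ β
    · simp only [hle, if_true]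
      rw [pderiv_mon]
      have h1 : α' + Pi.single i 1 ≤ β ↔ (β - α') i ≠ 0 := by
        constructor
        · intro h2
          have := h2 i
          simp at this ⊢
          omega
        · intro h2 j
          have h3 := hle j
          rcases eq_or_ne j i with rfl | hj
          · simp at h2 ⊢; omega
          · simpa [Pi.single_eq_of_ne hj] using h3
      by_cases h0 : (β - α') i = 0
      · rw [if_pos h0, if_neg fun h2 => h1.1 h2 h0]
      · rw [if_neg h0, if_pos (h1.2 h0), tsub_tsub]
    · have h1 : ¬ α' + Pi.single i 1 ≤ β := fun h2 => hle (le_trans (le_add_of_nonneg_right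
        (fun j => Nat.zero_le _)) h2)
      simp [hle, h1, pderiv]

open Classical in
theorem mderiv_polyOn_self (c : (Fin n → ℕ) → ℝ) {q : ℕ} (a : EuclideanSpace ℝ (Fin n))
    {α : Fin n → ℕ} (hα : len α < q) : mderiv α (polyOn c (Finset.range q) a) a = c α := by
  have h1 : polyOn c (Finset.range q) a = fun y =>
      ∑ β ∈ lenLT n q, (mon β fun i => y i - a i) * c β := by
    ext y
    rw [sum_lenLT]
    rfl
  rw [h1, mderiv_sum α _ fun β => (contDiff_mon β a).mul contDiff_const]
  have h2 : ∀ β, mderiv α (fun y => (mon β fun i => y i - a i) * c β) a =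
      if α = β then c β else 0 := by
    intro β
    rw [mderiv_mul_const α (contDiff_mon β a), mderiv_mon]
    simp only [sub_self]
    by_cases hle : α ≤ β
    · rw [if_pos hle]
      by_cases h : α = β
      · subst h
        simp [mon]
      · obtain ⟨i, hi⟩ := Function.ne_iff.1 h
        have hi' : (β - α) i ≠ 0 := by
          have : α i ≤ β i := hle i
          simp only [Pi.sub_apply]
          omega
        rw [if_neg h, mon, Finset.prod_eq_zero (Finset.mem_univ i) (zero_pow hi')]
        simp
    · rw [if_neg hle, if_neg fun h => hle h.le, zero_mul]
  simp only [h2]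
  rw [Finset.sum_ite_eq, if_pos (mem_lenLT.2 hα)]

variable {E : Set (EuclideanSpace ℝ (Fin n))}

/-- Bounds for a Whitney jet in terms of the sequence `k! ∏_{i < k} l i`. -/
structure JetBound (F : Jet E) (C : ℝ) (l : ℕ → ℝ) : Prop where
  coeff_le : ∀ (α : Fin n → ℕ) (a : E),
    |F α a| ≤ C * ((len α)! * ∏ i ∈ Finset.range (len α), l i)
  remainder_le : ∀ (p : ℕ) (α : Fin n → ℕ), len α ≤ p → ∀ a b : E, |remainder F p α a b| ≤
    C * ((p + 1)! * ∏ i ∈ Finset.range (p + 1), l i) *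
      (‖(b : EuclideanSpace ℝ (Fin n)) - a‖ ^ (p + 1 - len α) / ((p + 1 - len α)! : ℝ))

/-- The Taylor polynomial of degree less than `q` of a jet. -/
def taylorPoly (F : Jet E) (q : ℕ) (a : E) : EuclideanSpace ℝ (Fin n) → ℝ :=
  polyOn (fun β => F β a) (Finset.range q) a

theorem contDiff_taylorPoly (F : Jet E) (q : ℕ) (a : E) :
    ContDiff ℝ (⊤ : ℕ∞) (taylorPoly F q a) :=
  contDiff_polyOn _ _ _

theorem descFactorial_mul_pow_le {r : ℝ} (hr : 0 < r) (j k : ℕ) :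
    (j.descFactorial k : ℝ) * r ^ (j - k) ≤ k ! * 2 ^ j * r ^ j / r ^ k := by
  rcases le_or_gt k j with h | h
  · rw [pow_sub₀ _ hr.ne' h, ← div_eq_mul_inv, ← mul_div_assoc]
    have h1 : (j.descFactorial k : ℝ) ≤ k ! * 2 ^ j := by
      rw [Nat.descFactorial_eq_factorial_mul_choose]
      exact_mod_cast Nat.mul_le_mul_left _ (Nat.choose_le_two_pow j k)
    gcongr
  · rw [Nat.descFactorial_of_lt h]
    simp only [Nat.cast_zero, zero_mul]
    positivity

/-- In the factor `4 (n + 1)`, the `n + 1` pays for the number of multi-indices, one 2 for the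
binomial coefficient in the falling factorial, and the other 2 leaves a geometric series over the
degrees. -/
theorem JetBound.norm_iteratedFDeriv_polyOn_le {F : Jet E} {C : ℝ} {l : ℕ → ℝ} (hC : 0 ≤ C)
    (hl : ∀ i, 0 < l i) (hF : JetBound F C l) {J : Finset ℕ} {r H : ℝ} (hr : 0 < r) (hH0 : 0 ≤ H)
    (hH : ∀ j ∈ J, ∏ i ∈ Finset.range j, (l i * (4 * (n + 1) * r)) ≤ H) (b : E)
    {x : EuclideanSpace ℝ (Fin n)} (hx : ∀ i, |x i - b.1 i| ≤ r) (k : ℕ) :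
    ‖iteratedFDeriv ℝ k (polyOn (fun β => F β b) J b) x‖ ≤ 2 * C * H * (k ! / r ^ k) := by
  have h1 := Ultradiff.norm_iteratedFDeriv_polyOn_le (c := fun β => F β b) (J := J)
    (B := fun j => C * (j ! * ∏ i ∈ Finset.range j, l i)) (fun β _ => hF.coeff_le β b) hr.le hx k
  refine h1.trans ?_
  have h2 : ∀ j ∈ J, C * (j ! * ∏ i ∈ Finset.range j, l i) * ((n : ℝ) ^ j / j !) *
      (j.descFactorial k * r ^ (j - k)) ≤ C * H * (k ! / r ^ k) * (1 / 2) ^ j := by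
    intro j hj
    have h3 := hH j hj
    rw [Finset.prod_mul_distrib, Finset.prod_const, Finset.card_range] at h3
    have hP : 0 < ∏ i ∈ Finset.range j, l i := Finset.prod_pos fun i _ => hl i
    have h4 := descFactorial_mul_pow_le hr j k
    calc C * (j ! * ∏ i ∈ Finset.range j, l i) * ((n : ℝ) ^ j / j !) *
          (j.descFactorial k * r ^ (j - k))
        ≤ C * (j ! * ∏ i ∈ Finset.range j, l i) * ((n + 1 : ℝ) ^ j / j !) *
          (k ! * 2 ^ j * r ^ j / r ^ k) := by
          gcongr
          linarith
      _ = C * ((∏ i ∈ Finset.range j, l i) * (4 * (n + 1) * r) ^ j) * (k ! / r ^ k) *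
          (1 / 2) ^ j := by
          have : (4 : ℝ) = 2 * 2 := by norm_num
          rw [this]
          simp only [mul_pow, div_pow, one_pow]
          field_simp
      _ ≤ _ := by gcongr
  refine (Finset.sum_le_sum h2).trans ?_
  rw [← Finset.mul_sum]
  have h5 : ∑ j ∈ J, (1 / 2 : ℝ) ^ j ≤ 2 := by
    refine le_trans ?_ tsum_geometric_two.le
    exact summable_geometric_two.sum_le_tsum J fun j _ => by positivity
  calc C * H * (k ! / r ^ k) * ∑ j ∈ J, (1 / 2 : ℝ) ^ j ≤ C * H * (k ! / r ^ k) * 2 := by gcongr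
    _ = _ := by ring

/-- Recentred at `b`, the difference has the remainders from `a` to `b` as coefficients. Their
denominators `(p + 1 - j)!` and the `j!` of the monomials combine with `(p + 1)!` to binomial
coefficients, with sum at most `2^{p+1}`. -/
theorem JetBound.norm_iteratedFDeriv_taylorPoly_sub_le {F : Jet E} {C : ℝ} {l : ℕ → ℝ} (hC : 0 ≤ C)
    (hl : ∀ i, 0 < l i) (hF : JetBound F C l) {q : ℕ} {r H : ℝ} (hr : 0 < r)
    (hH : ∏ i ∈ Finset.range q, (l i * (4 * (n + 1) * r)) ≤ H) (a b : E)
    {x : EuclideanSpace ℝ (Fin n)} (hx : ∀ i, |x i - b.1 i| ≤ r)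
    (hab : ‖(b : EuclideanSpace ℝ (Fin n)) - a‖ ≤ r) (k : ℕ) :
    ‖iteratedFDeriv ℝ k (fun y => taylorPoly F q b y - taylorPoly F q a y) x‖ ≤
      C * H * (k ! / r ^ k) := by
  have hH0 : 0 ≤ H := (Finset.prod_nonneg fun i _ =>
      (mul_pos (hl i) (by positivity)).le).trans hH
  rcases q with _ | p
  · have : (fun y => taylorPoly F 0 b y - taylorPoly F 0 a y) = fun _ => 0 := by
      ext y
      simp [taylorPoly, polyOn]
    rw [this]
    simp only [iteratedFDeriv_fun_zero, Pi.zero_apply, norm_zero]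
    positivity
  have h0 : (fun y => taylorPoly F (p + 1) b y - taylorPoly F (p + 1) a y) =
      polyOn (fun β => remainder F p β a b) (Finset.range (p + 1)) b := by
    ext y
    rw [taylorPoly, taylorPoly, polyOn_range_eq _ _ a.1 b.1, polyOn, polyOn, ← sum_lenLT,
      ← sum_lenLT, ← Finset.sum_sub_distrib]
    refine Finset.sum_congr rfl fun β hβ => ?_
    have h1 := mem_lenLT.1 hβ
    rw [sum_lenLT, ← mul_sub, remainder, show p + 1 - len β = p - len β + 1 by omega]
    rfl
  rw [h0]
  set P := ∏ i ∈ Finset.range (p + 1), l i with hP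
  have hP0 : 0 < P := Finset.prod_pos fun i _ => hl i
  have h1 := Ultradiff.norm_iteratedFDeriv_polyOn_le (c := fun β => remainder F p β a b)
    (J := Finset.range (p + 1))
    (B := fun j => C * ((p + 1)! * P) * (r ^ (p + 1 - j) / (p + 1 - j)!))
    (fun β hβ => (hF.remainder_le p β (by simpa [Nat.lt_succ_iff] using hβ) a b).trans
      (by gcongr)) hr.le hx k
  refine h1.trans ?_
  rw [Finset.prod_mul_distrib, Finset.prod_const, Finset.card_range, ← hP] at hH
  have h2 : ∀ j ∈ Finset.range (p + 1), C * ((p + 1)! * P) * (r ^ (p + 1 - j) / (p + 1 - j)!) *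
      ((n : ℝ) ^ j / j !) * (j.descFactorial k * r ^ (j - k)) ≤
        C * P * (2 * (n + 1) * r) ^ (p + 1) * (k ! / r ^ k) * (p + 1).choose j := by
    intro j hj
    have hj' : j ≤ p + 1 := (Finset.mem_range.1 hj).le
    have h4 := descFactorial_mul_pow_le hr j k
    have h5 : (n : ℝ) ^ j * 2 ^ j ≤ (2 * (n + 1)) ^ (p + 1) := by
      rw [← mul_pow]
      refine (pow_le_pow_left₀ (by positivity) (by linarith) j).trans
        (pow_le_pow_right₀ ?_ hj')
      linarith [Nat.cast_nonneg (α := ℝ) n]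
    have h6 : ((p + 1).choose j : ℝ) * j ! * (p + 1 - j)! = (p + 1)! := by
      exact_mod_cast Nat.choose_mul_factorial_mul_factorial hj'
    have h7 : r ^ (p + 1) = r ^ (p + 1 - j) * r ^ j := by
      rw [← pow_add]
      congr 1
      omega
    calc C * ((p + 1)! * P) * (r ^ (p + 1 - j) / (p + 1 - j)!) *
          ((n : ℝ) ^ j / j !) * (j.descFactorial k * r ^ (j - k))
        ≤ C * ((p + 1)! * P) * (r ^ (p + 1 - j) / (p + 1 - j)!) *
          ((n : ℝ) ^ j / j !) * (k ! * 2 ^ j * r ^ j / r ^ k) := by gcongr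
      _ = C * P * ((n : ℝ) ^ j * 2 ^ j * r ^ (p + 1)) * (k ! / r ^ k) * (p + 1).choose j := by
          rw [← h6, h7]
          field_simp
      _ ≤ C * P * ((2 * (n + 1)) ^ (p + 1) * r ^ (p + 1)) * (k ! / r ^ k) * (p + 1).choose j := by
          gcongr
      _ = _ := by rw [← mul_pow]
  refine (Finset.sum_le_sum h2).trans ?_
  rw [← Finset.mul_sum]
  have h8 : ∑ j ∈ Finset.range (p + 1), ((p + 1).choose j : ℝ) ≤ 2 ^ (p + 1) := by
    have := Nat.sum_range_choose (p + 1)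
    rw [Finset.sum_range_succ] at this
    have h9 : ∑ j ∈ Finset.range (p + 1), (p + 1).choose j ≤ 2 ^ (p + 1) := by omega
    exact_mod_cast h9
  calc C * P * (2 * (n + 1) * r) ^ (p + 1) * (k ! / r ^ k) *
        ∑ j ∈ Finset.range (p + 1), ((p + 1).choose j : ℝ)
      ≤ C * P * (2 * (n + 1) * r) ^ (p + 1) * (k ! / r ^ k) * 2 ^ (p + 1) := by gcongr
    _ = C * (P * (4 * (n + 1) * r) ^ (p + 1)) * (k ! / r ^ k) := by
        have : (4 : ℝ) = 2 * 2 := by norm_num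
        rw [this]
        simp only [mul_pow]
        ring
    _ ≤ _ := by gcongr

/-- The difference of the Taylor polynomials at neighbouring points, with degrees adapted to
neighbouring scales. -/
theorem JetBound.norm_iteratedFDeriv_taylorPoly_sub_le_minProd {F : Jet E} {C : ℝ} {l : ℕ → ℝ}
    (hC : 0 ≤ C) (hl : IsGrowing l) (hF : JetBound F C l) {r η η' : ℝ} (hr : 0 < r)
    (hη : 4 * (n + 1) * r ≤ η') (hηη' : η' ≤ η) (a b : E)
    {x : EuclideanSpace ℝ (Fin n)} (hx : ∀ i, |x i - b.1 i| ≤ r)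
    (hab : ‖(b : EuclideanSpace ℝ (Fin n)) - a‖ ≤ r) (k : ℕ) :
    ‖iteratedFDeriv ℝ k (fun y => taylorPoly F (minIndex l η') b y -
      taylorPoly F (minIndex l η) a y) x‖ ≤ 3 * C * minProd l η * (k ! / r ^ k) := by
  have hη0 : 0 < η' := lt_of_lt_of_le (by positivity) hη
  set q := minIndex l η with hq
  set q' := minIndex l η' with hq'
  have hqq' : q ≤ q' := hl.minIndex_anti hη0 hηη'
  have hmono : ∀ {s t : ℝ} (j : ℕ), 0 < s → s ≤ t →
      ∏ i ∈ Finset.range j, (l i * s) ≤ ∏ i ∈ Finset.range j, (l i * t) := fun j hs hst =>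
    Finset.prod_le_prod (fun i _ => (mul_pos (hl.pos i) hs).le)
      fun i _ => mul_le_mul_of_nonneg_left hst (hl.pos i).le
  have h1 := hF.norm_iteratedFDeriv_taylorPoly_sub_le hC hl.pos (q := q) hr
    (H := minProd l η) (hmono q (by positivity) (hη.trans hηη')) a b hx hab k
  -- The centre is changed at the lower degree `q`; the extra terms at `b` have degree `q ≤ j < q'`.
  -- Up to `q'` the products at scale `η'` decrease, so each is at most the one at `q`, hence at
  -- most `minProd l η`.
  have h2 := hF.norm_iteratedFDeriv_polyOn_le hC hl.pos (J := Finset.Ico q q') hr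
    (H := minProd l η) (hl.minProd_pos (hη0.trans_le hηη')).le (fun j hj => by
      have hj' := Finset.mem_Ico.1 hj
      refine (hmono j (by positivity) hη).trans ((hl.prod_anti hη0 hj'.1 hj'.2.le).trans ?_)
      exact hmono q hη0 hηη') b hx k
  have hsplit : (fun y => taylorPoly F q' b y - taylorPoly F q a y) =
      (polyOn (fun β => F β b) (Finset.Ico q q') b) +
        fun y => taylorPoly F q b y - taylorPoly F q a y := by
    ext y
    have : taylorPoly F q' b y =
        polyOn (fun β => F β b) (Finset.Ico q q') b y + taylorPoly F q b y := by
      rw [taylorPoly, taylorPoly, polyOn, polyOn, polyOn, add_comm,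
        Finset.sum_range_add_sum_Ico _ hqq']
    simp only [Pi.add_apply]
    rw [this]
    ring
  have hk : ((k : ℕ∞) : WithTop ℕ∞) ≤ ((⊤ : ℕ∞) : WithTop ℕ∞) := by exact_mod_cast le_top
  rw [hsplit, iteratedFDeriv_add_apply ((contDiff_polyOn _ _ _).of_le hk).contDiffAt
    (((contDiff_taylorPoly F q b).sub (contDiff_taylorPoly F q a)).of_le hk).contDiffAt]
  refine (norm_add_le _ _).trans ((add_le_add h2 h1).trans (le_of_eq ?_))
  ring

end TaylorPolynomials

/-! ### Bounds for all derivatives at a point -/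

section DerivBound

variable {n : ℕ} {M : ℕ → ℝ} {f g : EuclideanSpace ℝ (Fin n) → ℝ} {x : EuclideanSpace ℝ (Fin n)}
  {A B σ τ : ℝ}

/-- The iterated derivatives of `f` at `x` are bounded by `A σ^k M k`. -/
def DerivBound (M : ℕ → ℝ) (f : EuclideanSpace ℝ (Fin n) → ℝ) (x : EuclideanSpace ℝ (Fin n))
    (A σ : ℝ) : Prop :=
  ∀ k, ‖iteratedFDeriv ℝ k f x‖ ≤ A * (σ ^ k * M k)

theorem DerivBound.mono (hM : IsLogConvexSeq M) (h : DerivBound M f x A σ) (hB : 0 ≤ B)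
    (hAB : A ≤ B) (hσ : 0 ≤ σ) (hστ : σ ≤ τ) : DerivBound M f x B τ := by
  intro k
  have := (hM.pos k).le
  refine (h k).trans ?_
  gcongr

/-- Leibniz' rule: `M i * M (k - i) ≤ M k` extracts `M k`, and the binomial theorem adds the
geometric rates. -/
theorem DerivBound.mul (hM : IsLogConvexSeq M) (hf : ContDiff ℝ (⊤ : ℕ∞) f)
    (hg : ContDiff ℝ (⊤ : ℕ∞) g) (hA : 0 ≤ A) (hσ : 0 ≤ σ) (hB : 0 ≤ B) (hτ : 0 ≤ τ)
    (hfb : DerivBound M f x A σ) (hgb : DerivBound M g x B τ) :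
    DerivBound M (fun y => f y * g y) x (A * B) (σ + τ) := by
  intro k
  refine (norm_iteratedFDeriv_mul_le hf hg x (by exact_mod_cast le_top)).trans ?_
  rw [add_pow, Finset.sum_mul, Finset.mul_sum]
  refine Finset.sum_le_sum fun i hi => ?_
  have hi' : i + (k - i) = k := Nat.add_sub_cancel' (Nat.lt_succ_iff.1 (Finset.mem_range.1 hi))
  have h1 := hM.mul_le i (k - i)
  rw [hi'] at h1
  have h2 := (hM.pos i).le
  calc (k.choose i : ℝ) * ‖iteratedFDeriv ℝ i f x‖ * ‖iteratedFDeriv ℝ (k - i) g x‖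
      ≤ k.choose i * (A * (σ ^ i * M i)) * (B * (τ ^ (k - i) * M (k - i))) := by
        gcongr
        · exact hfb i
        · exact hgb (k - i)
    _ = A * B * (σ ^ i * τ ^ (k - i) * k.choose i * (M i * M (k - i))) := by ring
    _ ≤ A * B * (σ ^ i * τ ^ (k - i) * k.choose i * M k) := by gcongr
    _ = _ := by ring

theorem DerivBound.prod {ι : Type*} (hM : IsLogConvexSeq M) (s : Finset ι)
    {f : ι → EuclideanSpace ℝ (Fin n) → ℝ} (hf : ∀ i, ContDiff ℝ (⊤ : ℕ∞) (f i)) (hA : 0 ≤ A)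
    (hσ : 0 ≤ σ) (h : ∀ i, DerivBound M (f i) x A σ) :
    DerivBound M (fun y => ∏ i ∈ s, f i y) x (A ^ s.card) (s.card * σ) := by
  classical
  induction s using Finset.induction_on with
  | empty =>
    intro k
    rcases k with _ | k
    · simp [hM.zero]
    · simp [iteratedFDeriv_succ_const]
  | insert i s hi ih =>
    simp only [Finset.prod_insert hi, Finset.card_insert_of_notMem hi]
    have h1 := (h i).mul hM (hf i) (contDiff_prod fun i _ => hf i) hA hσ (by positivity)
      (by positivity) ih
    convert h1 using 1
    · ring
    · push_cast; ring

theorem iteratedFDeriv_eq_zero_of_eventuallyEq (h : f =ᶠ[𝓝 x] 0) (k : ℕ) :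
    iteratedFDeriv ℝ k f x = 0 := by
  rw [(h.iteratedFDeriv ℝ k).eq_of_nhds]
  simp

/-- Only the terms that do not vanish near `x` enter, so the constant depends on the overlap `N` and
not on the size of `s`. -/
theorem DerivBound.sum {ι : Type*} (hM : IsLogConvexSeq M) {s t : Finset ι} (hts : t ⊆ s) {N : ℕ}
    (hN : t.card ≤ N) {f : ι → EuclideanSpace ℝ (Fin n) → ℝ}
    (hf : ∀ i, ContDiff ℝ (⊤ : ℕ∞) (f i)) (hA : 0 ≤ A) (hσ : 0 ≤ σ)
    (h0 : ∀ i ∈ s, i ∉ t → f i =ᶠ[𝓝 x] 0) (h : ∀ i ∈ t, DerivBound M (f i) x A σ) :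
    DerivBound M (fun y => ∑ i ∈ s, f i y) x (N * A) σ := by
  intro k
  have hk : ((k : ℕ∞) : WithTop ℕ∞) ≤ ((⊤ : ℕ∞) : WithTop ℕ∞) := by exact_mod_cast le_top
  rw [iteratedFDeriv_fun_sum_apply fun i _ => ((hf i).of_le hk).contDiffAt,
    ← Finset.sum_subset hts fun i hi hit =>
      iteratedFDeriv_eq_zero_of_eventuallyEq (h0 i hi hit) k]
  refine (norm_sum_le _ _).trans ((Finset.sum_le_sum fun i hi => h i hi k).trans ?_)
  rw [Finset.sum_const, nsmul_eq_mul, mul_assoc]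
  have := (hM.pos k).le
  have hN' : (t.card : ℝ) ≤ N := by exact_mod_cast hN
  gcongr

theorem norm_iteratedFDeriv_comp_coord_le {g : ℝ → ℝ} (hg : ContDiff ℝ (⊤ : ℕ∞) g) (i : Fin n)
    (c : ℝ) (k : ℕ) (x : EuclideanSpace ℝ (Fin n)) :
    ‖iteratedFDeriv ℝ k (fun y : EuclideanSpace ℝ (Fin n) => g (y i - c)) x‖ ≤
      |iteratedDeriv k g (x i - c)| := by
  set L : EuclideanSpace ℝ (Fin n) →L[ℝ] ℝ := EuclideanSpace.proj i with hL
  have hL1 : ‖L‖ ≤ 1 := ContinuousLinearMap.opNorm_le_bound _ zero_le_one fun y => by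
    simpa [hL] using PiLp.norm_apply_le y i
  have hg' : ContDiff ℝ (⊤ : ℕ∞) fun t => g (t - c) := hg.comp (contDiff_id.sub contDiff_const)
  have h1 := L.iteratedFDeriv_comp_right hg' x (i := k) (by exact_mod_cast le_top)
  have h2 : (fun y : EuclideanSpace ℝ (Fin n) => g (y i - c)) = (fun t => g (t - c)) ∘ L := rfl
  rw [h2, h1]
  refine (ContinuousMultilinearMap.norm_compContinuousLinearMap_le _ _).trans ?_
  rw [norm_iteratedFDeriv_eq_norm_iteratedDeriv, iteratedDeriv_comp_sub_const, Real.norm_eq_abs]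
  refine mul_le_of_le_one_right (abs_nonneg _) ?_
  rw [Finset.prod_const]
  exact pow_le_one₀ (norm_nonneg _) hL1

end DerivBound

/-! ### Partitions of unity at a given scale -/

section Partition

variable {n : ℕ}

/-- A partition of unity near `E` by functions supported in balls of radius comparable to `ε`
around points of `E`, with derivatives bounded by `A σ^k M k`. -/
structure WhitneyPartition (E : Set (EuclideanSpace ℝ (Fin n))) (M : ℕ → ℝ) (ε A σ : ℝ) where
  index : Finset (Fin n → ℕ)
  fn : (Fin n → ℕ) → EuclideanSpace ℝ (Fin n) → ℝ
  pt : (Fin n → ℕ) → E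
  contDiff : ∀ Q, ContDiff ℝ (⊤ : ℕ∞) (fn Q)
  active : ∀ x : EuclideanSpace ℝ (Fin n), ∃ t ⊆ index, t.card ≤ 3 ^ n ∧
    (∀ Q ∈ index, Q ∉ t → fn Q =ᶠ[𝓝 x] 0) ∧ ∀ Q ∈ t, ∀ i, |x i - (pt Q).1 i| ≤ 3 * ε
  sum_eq : ∀ a ∈ E, ∀ᶠ y in 𝓝 a, ∑ Q ∈ index, fn Q y = 1
  bound : ∀ Q x, DerivBound M (fn Q) x A σ

theorem card_filter_grid_le {ε : ℝ} (hε : 0 < ε) (m : ℕ) (t : ℝ) :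
    ((Finset.range (2 * m)).filter fun q : ℕ =>
      0 ≤ t - ε * ((q : ℝ) - m) ∧ t - ε * ((q : ℝ) - m) ≤ 2 * ε).card ≤ 3 := by
  set s := (Finset.range (2 * m)).filter fun q : ℕ =>
      0 ≤ t - ε * ((q : ℝ) - m) ∧ t - ε * ((q : ℝ) - m) ≤ 2 * ε with hs
  rcases s.eq_empty_or_nonempty with h | h
  · simp [h]
  · have h1 : s ⊆ Finset.Icc (s.min' h) (s.min' h + 2) := by
      intro q hq
      refine Finset.mem_Icc.2 ⟨s.min'_le q hq, ?_⟩
      have h2 := (Finset.mem_filter.1 (s.min'_mem h)).2.2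
      have h3 := (Finset.mem_filter.1 hq).2.1
      have h4 : ε * (q : ℝ) ≤ ε * ((s.min' h + 2 : ℕ) : ℝ) := by
        push_cast
        linarith
      exact_mod_cast le_of_mul_le_mul_left h4 hε
    refine (Finset.card_le_card h1).trans ?_
    simp
    omega

/-- Tensor products of the translates of `g` to the grid points. -/
def gridFun (g : ℝ → ℝ) (ε : ℝ) (m : ℕ) (Q : Fin n → ℕ) (x : EuclideanSpace ℝ (Fin n)) : ℝ :=
  ∏ i, g (x i - ε * ((Q i : ℝ) - m))

theorem exists_whitneyPartition {E : Set (EuclideanSpace ℝ (Fin n))} (hE : Bornology.IsBounded E)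
    (hne : E.Nonempty) {M : ℕ → ℝ} (hM : IsLogConvexSeq M) {ε A σ : ℝ} (hε : 0 < ε) (hA : 0 ≤ A)
    (hσ : 0 ≤ σ) {g : ℝ → ℝ} (hg : ContDiff ℝ (⊤ : ℕ∞) g)
    (hsupp : ∀ t, t < 0 ∨ 2 * ε < t → g t = 0)
    (hsum : ∀ (m : ℕ) (t : ℝ), |t| + ε ≤ m * ε →
      ∑ q ∈ Finset.range (2 * m), g (t - ε * ((q : ℝ) - m)) = 1)
    (hbound : ∀ (j : ℕ) (t : ℝ), |iteratedDeriv j g t| ≤ A * σ ^ j * M j) :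
    Nonempty (WhitneyPartition E M ε (A ^ n) (n * σ)) := by
  classical
  obtain ⟨R, hR⟩ := hE.exists_norm_le
  obtain ⟨m, hm⟩ := exists_nat_ge ((R + 2 * ε) / ε)
  rw [div_le_iff₀ hε] at hm
  -- Only cubes whose centre is within `2 ε`, coordinatewise, of a point of `E` are kept; the
  -- discarded functions vanish within `ε` of `E`. A support point is within `ε` of the centre,
  -- hence within `3 ε` of the chosen point of `E`.
  set near : (Fin n → ℕ) → E → Prop := fun Q a =>
    ∀ i, |a.1 i - ε * ((Q i : ℝ) - m) - ε| ≤ 2 * ε with hnear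
  set box : Finset (Fin n → ℕ) := Fintype.piFinset fun _ => Finset.range (2 * m) with hbox
  have hcd : ∀ (Q : Fin n → ℕ) (i : Fin n), ContDiff ℝ (⊤ : ℕ∞)
      fun x : EuclideanSpace ℝ (Fin n) => g (x i - ε * ((Q i : ℝ) - m)) :=
    fun Q i => hg.comp (contDiff_coord_sub i _)
  refine ⟨{
    index := box.filter fun Q => ∃ a, near Q a
    fn := gridFun g ε m
    pt := fun Q => if h : ∃ a, near Q a then h.choose else ⟨hne.some, hne.some_mem⟩
    contDiff := fun Q => contDiff_prod fun i _ => hcd Q i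
    active := ?_
    sum_eq := ?_
    bound := ?_ }⟩
  · intro x
    set t := (box.filter fun Q => ∃ a, near Q a).filter fun Q => ∀ i,
      0 ≤ x i - ε * ((Q i : ℝ) - m) ∧ x i - ε * ((Q i : ℝ) - m) ≤ 2 * ε with ht
    refine ⟨t, Finset.filter_subset _ _, ?_, ?_, ?_⟩
    · have h1 : t ⊆ Fintype.piFinset fun i => (Finset.range (2 * m)).filter fun q : ℕ =>
          0 ≤ x i - ε * ((q : ℝ) - m) ∧ x i - ε * ((q : ℝ) - m) ≤ 2 * ε := by
        intro Q hQ
        rw [ht, Finset.mem_filter, Finset.mem_filter, hbox, Fintype.mem_piFinset] at hQ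
        rw [Fintype.mem_piFinset]
        exact fun i => Finset.mem_filter.2 ⟨hQ.1.1 i, hQ.2 i⟩
      refine (Finset.card_le_card h1).trans ?_
      rw [Fintype.card_piFinset]
      refine (Finset.prod_le_prod' fun i _ => card_filter_grid_le hε m (x i)).trans ?_
      simp
    · intro Q hQ hQt
      have h1 : ∃ i, ¬ (0 ≤ x i - ε * ((Q i : ℝ) - m) ∧ x i - ε * ((Q i : ℝ) - m) ≤ 2 * ε) := by
        by_contra! h
        exact hQt (Finset.mem_filter.2 ⟨hQ, h⟩)
      obtain ⟨i, hi⟩ := h1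
      have hc : Continuous fun y : EuclideanSpace ℝ (Fin n) => y i - ε * ((Q i : ℝ) - m) := by
        fun_prop
      have hopen : ∀ᶠ y in 𝓝 x, y i - ε * ((Q i : ℝ) - m) ∈ (Icc 0 (2 * ε))ᶜ :=
        hc.continuousAt.eventually (isClosed_Icc.isOpen_compl.mem_nhds hi)
      filter_upwards [hopen] with y hy
      refine Finset.prod_eq_zero (Finset.mem_univ i) (hsupp _ ?_)
      by_contra! h
      exact hy h
    · intro Q hQ i
      rw [ht, Finset.mem_filter, Finset.mem_filter] at hQ
      rw [dif_pos hQ.1.2]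
      have h1 := abs_le.1 (hQ.1.2.choose_spec i)
      have h2 := hQ.2 i
      rw [abs_le]
      constructor <;> linarith [h1.1, h1.2, h2.1, h2.2]
  · intro a ha
    filter_upwards [Metric.ball_mem_nhds a hε] with y hy
    have hya : ∀ i, |y i - a i| ≤ ε := fun i => by
      have h1 := PiLp.norm_apply_le (y - a) i
      rw [Metric.mem_ball, dist_eq_norm] at hy
      simp only [PiLp.sub_apply, Real.norm_eq_abs] at h1
      linarith
    have hai : ∀ i, |a i| ≤ R := fun i => by
      have h1 := PiLp.norm_apply_le a i
      rw [Real.norm_eq_abs] at h1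
      exact h1.trans (hR a ha)
    have h1 : ∑ Q ∈ box, gridFun g ε m Q y = 1 := by
      have h2 := Finset.prod_univ_sum (fun _ : Fin n => Finset.range (2 * m))
        fun i q => g (y i - ε * ((q : ℝ) - m))
      rw [Finset.prod_congr rfl fun i _ => hsum m (y i) ?_, Finset.prod_const_one] at h2
      · exact h2.symm
      · have h3 := abs_add_le (y i - a i) (a i)
        rw [sub_add_cancel] at h3
        linarith [hya i, hai i]
    rw [← h1]
    refine Finset.sum_subset (Finset.filter_subset _ _) fun Q hQ hQn => ?_
    by_contra h
    refine hQn (Finset.mem_filter.2 ⟨hQ, ⟨a, ha⟩, fun i => ?_⟩)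
    have h2 : g (y i - ε * ((Q i : ℝ) - m)) ≠ 0 := fun h0 =>
      h (Finset.prod_eq_zero (Finset.mem_univ i) h0)
    have h3 : ¬ (y i - ε * ((Q i : ℝ) - m) < 0 ∨ 2 * ε < y i - ε * ((Q i : ℝ) - m)) :=
      fun h0 => h2 (hsupp _ h0)
    push Not at h3
    have h4 := abs_le.1 (hya i)
    rw [abs_le]
    constructor <;> linarith [h3.1, h3.2, h4.1, h4.2]
  · intro Q x
    have h1 : ∀ i, DerivBound M
        (fun x : EuclideanSpace ℝ (Fin n) => g (x i - ε * ((Q i : ℝ) - m))) x A σ := fun i k =>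
      (norm_iteratedFDeriv_comp_coord_le hg i _ k x).trans
        ((hbound k _).trans (le_of_eq (by ring)))
    have h2 := DerivBound.prod hM Finset.univ (hcd Q) hA hσ h1
    rwa [Finset.card_univ, Fintype.card_fin] at h2

end Partition

/-! ### Gluing Taylor polynomials -/

section Gluing

variable {n : ℕ} {E : Set (EuclideanSpace ℝ (Fin n))} {M : ℕ → ℝ}

namespace WhitneyPartition

variable {ε ε' A A' σ : ℝ}

/-- The Taylor polynomials of degree less than `q` of `F`, glued by a partition of unity. -/
def approx (P : WhitneyPartition E M ε A σ) (F : Jet E) (q : ℕ) (y : EuclideanSpace ℝ (Fin n)) :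
    ℝ :=
  ∑ Q ∈ P.index, P.fn Q y * taylorPoly F q (P.pt Q) y

/-- The difference of two glued families, extended by means of both partitions of unity. -/
def glue (P : WhitneyPartition E M ε A σ) (P' : WhitneyPartition E M ε' A' σ) (F : Jet E)
    (q q' : ℕ) (y : EuclideanSpace ℝ (Fin n)) : ℝ :=
  ∑ Q ∈ P.index, ∑ Q' ∈ P'.index,
    P.fn Q y * (P'.fn Q' y * (taylorPoly F q' (P'.pt Q') y - taylorPoly F q (P.pt Q) y))

theorem contDiff_approx (P : WhitneyPartition E M ε A σ) (F : Jet E) (q : ℕ) :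
    ContDiff ℝ (⊤ : ℕ∞) (P.approx F q) :=
  ContDiff.sum fun Q _ => (P.contDiff Q).mul (contDiff_taylorPoly _ _ _)

theorem contDiff_glue (P : WhitneyPartition E M ε A σ) (P' : WhitneyPartition E M ε' A' σ)
    (F : Jet E) (q q' : ℕ) : ContDiff ℝ (⊤ : ℕ∞) (P.glue P' F q q') :=
  ContDiff.sum fun Q _ => ContDiff.sum fun Q' _ => (P.contDiff Q).mul
    ((P'.contDiff Q').mul ((contDiff_taylorPoly _ _ _).sub (contDiff_taylorPoly _ _ _)))

/-- Both partitions sum to one near `a`, which collapses the double sum. -/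
theorem glue_eq (P : WhitneyPartition E M ε A σ) (P' : WhitneyPartition E M ε' A' σ) (F : Jet E)
    (q q' : ℕ) {a : EuclideanSpace ℝ (Fin n)} (ha : a ∈ E) :
    P.glue P' F q q' =ᶠ[𝓝 a] fun y => P'.approx F q' y - P.approx F q y := by
  filter_upwards [P.sum_eq a ha, P'.sum_eq a ha] with y h h'
  have h1 : ∀ Q, ∑ Q' ∈ P'.index,
      P.fn Q y * (P'.fn Q' y * (taylorPoly F q' (P'.pt Q') y - taylorPoly F q (P.pt Q) y)) =
      P.fn Q y * P'.approx F q' y - P.fn Q y * taylorPoly F q (P.pt Q) y := by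
    intro Q
    rw [← Finset.mul_sum, ← mul_sub]
    congr 1
    simp only [mul_sub, Finset.sum_sub_distrib]
    rw [← Finset.sum_mul, h', one_mul]
    rfl
  rw [glue, Finset.sum_congr rfl fun Q _ => h1 Q, Finset.sum_sub_distrib, ← Finset.sum_mul, h,
    one_mul]
  rfl

theorem approx_sub_eq (P : WhitneyPartition E M ε A σ) (F : Jet E) (q : ℕ) (a : E) :
    (fun y => P.approx F q y - taylorPoly F q a y) =ᶠ[𝓝 a.1]
      fun y => ∑ Q ∈ P.index, P.fn Q y * (taylorPoly F q (P.pt Q) y - taylorPoly F q a y) := by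
  filter_upwards [P.sum_eq a a.2] with y h
  simp only [mul_sub, Finset.sum_sub_distrib]
  rw [← Finset.sum_mul, h, one_mul]
  rfl

variable {F : Jet E} {C D τ r η η' : ℝ} {l : ℕ → ℝ}

theorem _root_.Ultradiff.JetBound.derivBound_taylorPoly_sub (hC : 0 ≤ C) (hl : IsGrowing l)
    (hF : JetBound F C l) (hr : 0 < r) (hD : ∀ k : ℕ, (k ! : ℝ) / r ^ k ≤ D * (τ ^ k * M k))
    (hη : 4 * (n + 1) * r ≤ η') (hηη' : η' ≤ η) (a b : E)
    {x : EuclideanSpace ℝ (Fin n)} (hx : ∀ i, |x i - b.1 i| ≤ r)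
    (hab : ‖(b : EuclideanSpace ℝ (Fin n)) - a‖ ≤ r) :
    DerivBound M (fun y => taylorPoly F (minIndex l η') b y - taylorPoly F (minIndex l η) a y) x
      (3 * C * minProd l η * D) τ := by
  intro k
  have h0 : 0 < η := lt_of_lt_of_le (by positivity) (hη.trans hηη')
  have h2 := (hl.minProd_pos h0).le
  rw [mul_assoc]
  exact (hF.norm_iteratedFDeriv_taylorPoly_sub_le_minProd hC hl hr hη hηη' a b hx hab k).trans
    (mul_le_mul_of_nonneg_left (hD k) (by positivity))

theorem norm_sub_le_of_abs_sub_le {x a b : EuclideanSpace ℝ (Fin n)} (hε : 0 ≤ ε)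
    (ha : ∀ i, |x i - a i| ≤ 3 * ε) (hb : ∀ i, |x i - b i| ≤ 3 * ε) :
    ‖b - a‖ ≤ 6 * (n + 1) * ε := by
  have h1 : b - a = ∑ i, (b i - a i) • EuclideanSpace.single i (1 : ℝ) := by
    have := (EuclideanSpace.basisFun (Fin n) ℝ).sum_repr (b - a)
    simpa using this.symm
  rw [h1]
  refine (norm_sum_le _ _).trans ((Finset.sum_le_sum (g := fun _ => 6 * ε) fun i _ => ?_).trans ?_)
  · rw [norm_smul, PiLp.norm_single, norm_one, mul_one, Real.norm_eq_abs]
    have h2 := abs_le.1 (ha i)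
    have h3 := abs_le.1 (hb i)
    rw [abs_le]
    constructor <;> linarith [h2.1, h2.2, h3.1, h3.2]
  · rw [Finset.sum_const, Finset.card_univ, Fintype.card_fin, nsmul_eq_mul]
    linarith

/-- At most `3^n * 3^n` pairs are active at `x`. Their base points are within `3 ε` of `x` in each
coordinate, hence at distance at most `6 (n + 1) ε`, the radius at which the Taylor polynomials are
compared. -/
theorem derivBound_glue (hM : IsLogConvexSeq M) (hC : 0 ≤ C) (hl : IsGrowing l)
    (hF : JetBound F C l) (P : WhitneyPartition E M ε A σ) (P' : WhitneyPartition E M ε' A' σ)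
    (hε : 0 < ε) (hε' : ε' ≤ ε) (hA : 0 ≤ A) (hA' : 0 ≤ A') (hσ : 0 ≤ σ) (hτ : 0 ≤ τ) (hD0 : 0 ≤ D)
    (hD : ∀ k : ℕ, (k ! : ℝ) / (6 * (n + 1) * ε) ^ k ≤ D * (τ ^ k * M k))
    (hη : 4 * (n + 1) * (6 * (n + 1) * ε) ≤ η') (hηη' : η' ≤ η)
    (x : EuclideanSpace ℝ (Fin n)) :
    DerivBound M (P.glue P' F (minIndex l η) (minIndex l η')) x
      (9 ^ n * (A * (A' * (3 * C * minProd l η * D)))) (σ + (σ + τ)) := by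
  obtain ⟨t, hts, htc, ht0, ht⟩ := P.active x
  obtain ⟨t', hts', htc', ht0', ht'⟩ := P'.active x
  have hη0 : 0 < η := lt_of_lt_of_le (by positivity) (hη.trans hηη')
  have hm := (hl.minProd_pos hη0).le
  have h9 : (9 : ℝ) ^ n * (A * (A' * (3 * C * minProd l η * D))) =
      ((3 ^ n : ℕ) : ℝ) * (((3 ^ n : ℕ) : ℝ) * (A * (A' * (3 * C * minProd l η * D)))) := by
    rw [show (9 : ℝ) = 3 * 3 by norm_num, mul_pow]
    push_cast
    ring
  rw [h9]
  have hsm : ∀ Q Q', ContDiff ℝ (⊤ : ℕ∞) fun y => P.fn Q y * (P'.fn Q' y *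
      (taylorPoly F (minIndex l η') (P'.pt Q') y - taylorPoly F (minIndex l η) (P.pt Q) y)) :=
    fun Q Q' => (P.contDiff Q).mul
      ((P'.contDiff Q').mul ((contDiff_taylorPoly _ _ _).sub (contDiff_taylorPoly _ _ _)))
  refine DerivBound.sum hM hts htc (fun Q => ContDiff.sum fun Q' _ => hsm Q Q') (by positivity)
    (by positivity) (fun Q hQ hQt => ?_) fun Q hQ => ?_
  · filter_upwards [ht0 Q hQ hQt] with y hy
    simp [hy]
  · refine DerivBound.sum hM hts' htc' (hsm Q) (by positivity) (by positivity)
      (fun Q' hQ' hQt' => ?_) fun Q' hQ' => ?_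
    · filter_upwards [ht0' Q' hQ' hQt'] with y hy
      simp [hy]
    · have hr3 : 3 * ε ≤ 6 * (n + 1) * ε := by nlinarith [Nat.cast_nonneg (α := ℝ) n]
      have hb : ∀ i, |x i - (P'.pt Q').1 i| ≤ 3 * ε := fun i => (ht' Q' hQ' i).trans (by linarith)
      have h1 := hF.derivBound_taylorPoly_sub hC hl (by positivity) hD hη hηη' (P.pt Q) (P'.pt Q')
        (x := x) (fun i => (hb i).trans hr3) (norm_sub_le_of_abs_sub_le hε.le (ht Q hQ) hb)
      have hs1 := (contDiff_taylorPoly F (minIndex l η') (P'.pt Q')).sub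
        (contDiff_taylorPoly F (minIndex l η) (P.pt Q))
      exact (P.bound Q x).mul hM (P.contDiff Q) ((P'.contDiff Q').mul hs1) hA hσ (by positivity)
        (by positivity)
        ((P'.bound Q' x).mul hM (P'.contDiff Q') hs1 hA' hσ (by positivity) hτ h1)

theorem derivBound_approx_sub (hM : IsLogConvexSeq M) (hC : 0 ≤ C) (hl : IsGrowing l)
    (hF : JetBound F C l) (P : WhitneyPartition E M ε A σ)
    (hε : 0 < ε) (hA : 0 ≤ A) (hσ : 0 ≤ σ) (hτ : 0 ≤ τ) (hD0 : 0 ≤ D)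
    (hD : ∀ k : ℕ, (k ! : ℝ) / (6 * (n + 1) * ε) ^ k ≤ D * (τ ^ k * M k))
    (hη : 4 * (n + 1) * (6 * (n + 1) * ε) ≤ η) (a : E) :
    DerivBound M (fun y => P.approx F (minIndex l η) y - taylorPoly F (minIndex l η) a y) a
      (3 ^ n * (A * (3 * C * minProd l η * D))) (σ + τ) := by
  obtain ⟨t, hts, htc, ht0, ht⟩ := P.active a
  have hη0 : 0 < η := lt_of_lt_of_le (by positivity) hη
  have hm := (hl.minProd_pos hη0).le
  intro k
  rw [((P.approx_sub_eq F (minIndex l η) a).iteratedFDeriv ℝ k).eq_of_nhds]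
  revert k
  have h3 : (3 : ℝ) ^ n = ((3 ^ n : ℕ) : ℝ) := by push_cast; rfl
  rw [h3]
  refine DerivBound.sum hM hts htc (fun Q => (P.contDiff Q).mul
    ((contDiff_taylorPoly _ _ _).sub (contDiff_taylorPoly _ _ _))) (by positivity)
    (by positivity) (fun Q hQ hQt => ?_) fun Q hQ => ?_
  · filter_upwards [ht0 Q hQ hQt] with y hy
    simp [hy]
  · have hr3 : 3 * ε ≤ 6 * (n + 1) * ε := by nlinarith [Nat.cast_nonneg (α := ℝ) n]
    have h1 := hF.derivBound_taylorPoly_sub hC hl (by positivity) hD hη le_rfl a (P.pt Q)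
      (x := a.1) (fun i => (ht Q hQ i).trans hr3)
      (norm_sub_le_of_abs_sub_le hε.le (fun i => by simp; positivity) (ht Q hQ))
    exact (P.bound Q a).mul hM (P.contDiff Q)
      ((contDiff_taylorPoly _ _ _).sub (contDiff_taylorPoly _ _ _)) hA hσ (by positivity) hτ h1

theorem derivBound_approx (hM : IsLogConvexSeq M) (hC : 0 ≤ C) (hl : IsGrowing l)
    (hF : JetBound F C l) (P : WhitneyPartition E M ε A σ)
    (hε : 0 < ε) (hA : 0 ≤ A) (hσ : 0 ≤ σ) (hτ : 0 ≤ τ) (hD0 : 0 ≤ D)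
    (hD : ∀ k : ℕ, (k ! : ℝ) / (6 * (n + 1) * ε) ^ k ≤ D * (τ ^ k * M k))
    (hη : 4 * (n + 1) * (6 * (n + 1) * ε) ≤ η) (x : EuclideanSpace ℝ (Fin n)) :
    DerivBound M (P.approx F (minIndex l η)) x (3 ^ n * (A * (2 * C * D))) (σ + τ) := by
  obtain ⟨t, hts, htc, ht0, ht⟩ := P.active x
  have hη0 : 0 < η := lt_of_lt_of_le (by positivity) hη
  have h3 : (3 : ℝ) ^ n = ((3 ^ n : ℕ) : ℝ) := by push_cast; rfl
  rw [h3]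
  refine DerivBound.sum hM hts htc (fun Q => (P.contDiff Q).mul (contDiff_taylorPoly _ _ _))
    (by positivity) (by positivity) (fun Q hQ hQt => ?_) fun Q hQ => ?_
  · filter_upwards [ht0 Q hQ hQt] with y hy
    simp [hy]
  · have hr3 : 3 * ε ≤ 6 * (n + 1) * ε := by nlinarith [Nat.cast_nonneg (α := ℝ) n]
    have h1 : DerivBound M (taylorPoly F (minIndex l η) (P.pt Q)) x (2 * C * D) τ := by
      intro k
      have h2 := hF.norm_iteratedFDeriv_polyOn_le hC hl.pos
        (J := Finset.range (minIndex l η)) (r := 6 * (n + 1) * ε) (by positivity) zero_le_one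
        (fun j hj => by
          have h4 := hl.prod_anti hη0 (Nat.zero_le j) (Finset.mem_range.1 hj).le
          rw [Finset.prod_range_zero] at h4
          refine le_trans (Finset.prod_le_prod (fun i _ => ?_) fun i _ => ?_) h4
          · have := hl.pos i
            positivity
          · exact mul_le_mul_of_nonneg_left hη (hl.pos i).le)
        (P.pt Q) (x := x) (fun i => (ht Q hQ i).trans hr3) k
      rw [mul_one] at h2
      refine h2.trans ?_
      rw [mul_assoc (2 * C) D]
      exact mul_le_mul_of_nonneg_left (hD k) (by positivity)
    exact (P.bound Q x).mul hM (P.contDiff Q) (contDiff_taylorPoly _ _ _) hA hσ (by positivity)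
      hτ h1

end WhitneyPartition

/-! ### The extension -/

theorem tendsto_minIndex {l : ℕ → ℝ} (hl : IsGrowing l) {η : ℕ → ℝ} (hη : ∀ s, 0 < η s)
    (h0 : Tendsto η atTop (𝓝 0)) (N : ℕ) : ∀ᶠ s in atTop, N < minIndex l (η s) := by
  have h1 : Tendsto (fun s => l N * η s) atTop (𝓝 0) := by simpa using h0.const_mul (l N)
  filter_upwards [h1.eventually_lt_const zero_lt_one] with s hs
  by_contra! h
  exact absurd (hl.one_le_of_minIndex_le (hη s) h) (not_le.2 hs)

/-- By `h₂` the terms of the telescoping series are bounded by `(1/2)^s` in one fixed class, so the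
sum is differentiated termwise. Near `a ∈ E` its partial sums are glued approximations; by `h₁`
their derivatives at `a` approach those of the Taylor polynomial at `a`, which equal the jet once
the degree exceeds `|α|`. -/
theorem exists_extension {F : Jet E} {C K σ τ : ℝ} {l A D η : ℕ → ℝ} (hM : IsLogConvexSeq M)
    (hC : 0 ≤ C) (hl : IsGrowing l) (hF : JetBound F C l)
    (P : ∀ s : ℕ, WhitneyPartition E M ((1 / 2) ^ s) (A s) σ)
    (hη : η = fun s => 48 * ((n : ℝ) + 1) ^ 2 * (1 / 2) ^ s)
    (hA : ∀ s, 0 ≤ A s) (hσ : 0 ≤ σ) (hτ : 0 ≤ τ) (hD0 : ∀ s, 0 ≤ D s) (hK : 0 ≤ K)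
    (hD : ∀ s k : ℕ, (k ! : ℝ) / (6 * (n + 1) * (1 / 2) ^ s) ^ k ≤ D s * (τ ^ k * M k))
    (h₁ : ∀ s, A s * (minProd l (η s) * D s) ≤ K * (1 / 2) ^ s)
    (h₂ : ∀ s, A s * (A (s + 1) * (minProd l (η s) * D s)) ≤ K * (1 / 2) ^ s) :
    ∃ f : EuclideanSpace ℝ (Fin n) → ℝ, ContDiff ℝ (⊤ : ℕ∞) f ∧
      (∃ B ρ : ℝ, 0 ≤ B ∧ 0 ≤ ρ ∧ ∀ x, DerivBound M f x B ρ) ∧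
      ∀ (α : Fin n → ℕ) (a : E), mderiv α f a = F α a := by
  have hηpos : ∀ s, 0 < η s := fun s => by rw [hη]; positivity
  -- The constant `48 = 2 * 4 * 6` turns this into an equality: it allows the degrees of the finer
  -- scale `s + 1` at the comparison radius of scale `s`.
  have hη1 : ∀ s, 4 * (n + 1) * (6 * (n + 1) * (1 / 2 : ℝ) ^ s) ≤ η (s + 1) := fun s => by
    rw [hη]
    apply le_of_eq
    simp only [pow_succ]
    ring
  have hη2 : ∀ s, η (s + 1) ≤ η s := fun s => by
    have : 0 < (1 / 2 : ℝ) ^ s := by positivity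
    rw [hη]
    simp only [pow_succ (1 / 2 : ℝ)]
    nlinarith [sq_nonneg ((n : ℝ) + 1)]
  set q : ℕ → ℕ := fun s => minIndex l (η s) with hq
  set u : ℕ → EuclideanSpace ℝ (Fin n) → ℝ := fun s => Nat.casesOn s ((P 0).approx F (q 0))
    fun s => (P s).glue (P (s + 1)) F (q s) (q (s + 1)) with hu
  have hus : ∀ s, ContDiff ℝ (⊤ : ℕ∞) (u s) := by
    intro s
    rcases s with _ | s
    · exact (P 0).contDiff_approx _ _
    · exact (P s).contDiff_glue _ _ _ _
  -- The two summands serve the coarsest approximation and the glued differences. The latter have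
  -- index `s + 1`, so `3 C` is doubled to pass from `(1/2)^s` to `(1/2)^{s+1}`.
  set B := 3 ^ n * (A 0 * (2 * C * D 0)) + 9 ^ n * (6 * C * K) with hB
  have hA0 := hA 0
  have hD00 := hD0 0
  have hB0 : 0 ≤ B := by positivity
  have hub : ∀ s x, DerivBound M (u s) x (B * (1 / 2) ^ s) (σ + (σ + τ)) := by
    intro s x
    rcases s with _ | s
    · have h := (P 0).derivBound_approx hM hC hl hF (by positivity) hA0 hσ hτ hD00
        (hD 0) ((hη1 0).trans (hη2 0)) x
      refine h.mono hM (by positivity) ?_ (by positivity) (by linarith)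
      rw [pow_zero, mul_one, hB]
      have : 0 ≤ 9 ^ n * (6 * C * K) := by positivity
      linarith
    · have h := (P s).derivBound_glue hM hC hl hF (P (s + 1)) (by positivity)
        (pow_le_pow_of_le_one (by norm_num) (by norm_num) (Nat.le_succ s)) (hA s) (hA (s + 1))
        hσ hτ (hD0 s) (hD s) (hη1 s) (hη2 s) x
      refine h.mono hM (by positivity) ?_ (by positivity) le_rfl
      calc (9 : ℝ) ^ n * (A s * (A (s + 1) * (3 * C * minProd l (η s) * D s)))
          = 9 ^ n * (3 * C) * (A s * (A (s + 1) * (minProd l (η s) * D s))) := by ring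
        _ ≤ 9 ^ n * (3 * C) * (K * (1 / 2) ^ s) :=
            mul_le_mul_of_nonneg_left (h₂ s) (by positivity)
        _ = 9 ^ n * (6 * C * K) * (1 / 2) ^ (s + 1) := by
            rw [pow_succ]
            ring
        _ ≤ B * (1 / 2) ^ (s + 1) := by
            rw [hB]
            have : 0 ≤ 3 ^ n * (A 0 * (2 * C * D 0)) := by positivity
            gcongr
            linarith
  set v : ℕ → ℕ → ℝ := fun k s => B * (1 / 2) ^ s * ((σ + (σ + τ)) ^ k * M k) with hv
  have hvs : ∀ k, HasSum (v k) (2 * B * ((σ + (σ + τ)) ^ k * M k)) := by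
    intro k
    have := (hasSum_geometric_two.mul_left B).mul_right ((σ + (σ + τ)) ^ k * M k)
    rwa [mul_comm B 2] at this
  have hf : ContDiff ℝ (⊤ : ℕ∞) fun x => ∑' s, u s x :=
    contDiff_tsum hus (fun k _ => (hvs k).summable) fun k s x _ => hub s x k
  have hder : ∀ k x, HasSum (fun s => iteratedFDeriv ℝ k (u s) x)
      (iteratedFDeriv ℝ k (fun x => ∑' s, u s x) x) := by
    intro k x
    rw [iteratedFDeriv_tsum_apply hus (fun k _ => (hvs k).summable)
      (fun k s x _ => hub s x k) (by exact_mod_cast le_top)]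
    exact (Summable.of_norm_bounded (hvs k).summable fun s => hub s x k).hasSum
  refine ⟨fun x => ∑' s, u s x, hf, ⟨2 * B, σ + (σ + τ), by positivity, by positivity,
    fun x k => ?_⟩, fun α a => ?_⟩
  · rw [← (hder k x).tsum_eq]
    exact tsum_of_norm_bounded (hvs k) fun s => hub s x k
  · have hpart : ∀ m, (fun y => ∑ s ∈ Finset.range (m + 1), u s y) =ᶠ[𝓝 a.1]
        (P m).approx F (q m) := by
      intro m
      induction m with
      | zero => exact Eventually.of_forall fun y => by simp [hu]
      | succ m ih =>
        filter_upwards [ih, (P m).glue_eq (P (m + 1)) F (q m) (q (m + 1)) a.2] with y h1 h2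
        rw [Finset.sum_range_succ, h1]
        change _ + (P m).glue (P (m + 1)) F (q m) (q (m + 1)) y = _
        rw [h2]
        ring
    set k := len α with hk
    have hk' : ((k : ℕ∞) : WithTop ℕ∞) ≤ ((⊤ : ℕ∞) : WithTop ℕ∞) := by exact_mod_cast le_top
    have hsum : ∀ m, ∑ s ∈ Finset.range (m + 1), iteratedFDeriv ℝ k (u s) a =
        iteratedFDeriv ℝ k ((P m).approx F (q m)) a := by
      intro m
      rw [← ((hpart m).iteratedFDeriv ℝ k).eq_of_nhds,
        iteratedFDeriv_fun_sum_apply fun s _ => ((hus s).of_le hk').contDiffAt]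
    have hlim : Tendsto (fun m => iteratedFDeriv ℝ k ((P m).approx F (q m)) a.1) atTop
        (𝓝 (iteratedFDeriv ℝ k (fun x => ∑' s, u s x) a)) := by
      have := (tendsto_add_atTop_iff_nat 1).2 (hder k a).tendsto_sum_nat
      simpa only [hsum] using this
    obtain ⟨w, _, hw⟩ := isDerivEval_mderiv α
    have hlim' : Tendsto (fun m => mderiv α ((P m).approx F (q m)) a.1) atTop
        (𝓝 (mderiv α (fun x => ∑' s, u s x) a)) := by
      rw [hw _ hf]
      simp only [fun m => hw _ ((P m).contDiff_approx F (q m)) a.1]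
      exact ((ContinuousMultilinearMap.apply ℝ (fun _ : Fin k => EuclideanSpace ℝ (Fin n)) ℝ
        w).continuous.tendsto _).comp hlim
    have hgeom : Tendsto (fun m : ℕ => (1 / 2 : ℝ) ^ m) atTop (𝓝 0) :=
      tendsto_pow_atTop_nhds_zero_of_lt_one (by norm_num) (by norm_num)
    refine tendsto_nhds_unique hlim' ?_
    rw [tendsto_iff_norm_sub_tendsto_zero]
    have hη0 : Tendsto η atTop (𝓝 0) := by
      rw [hη]
      simpa using hgeom.const_mul (48 * ((n : ℝ) + 1) ^ 2)
    have hbd : Tendsto (fun m : ℕ => 3 ^ n * (3 * C) * ((σ + τ) ^ k * M k) * (K * (1 / 2 : ℝ) ^ m))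
        atTop (𝓝 0) := by
      simpa using (hgeom.const_mul K).const_mul (3 ^ n * (3 * C) * ((σ + τ) ^ k * M k))
    refine squeeze_zero' (Eventually.of_forall fun m => norm_nonneg _) ?_ hbd
    filter_upwards [tendsto_minIndex hl hηpos hη0 k] with m hm
    have h1 := mderiv_polyOn_self (fun β => F β a) a.1 (α := α) hm
    have h2 := mderiv_sub α ((P m).contDiff_approx F (q m)) (contDiff_taylorPoly F (q m) a) a.1
    have h3 : mderiv α (taylorPoly F (q m) a) a.1 = F α a := h1
    rw [h3] at h2
    rw [← h2, Real.norm_eq_abs]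
    have hMk := (hM.pos k).le
    refine (abs_mderiv_le α (((P m).contDiff_approx F (q m)).sub
      (contDiff_taylorPoly F (q m) a)) a.1).trans ?_
    refine ((P m).derivBound_approx_sub hM hC hl hF (by positivity) (hA m) hσ hτ (hD0 m) (hD m)
      ((hη1 m).trans (hη2 m)) a k).trans ?_
    calc (3 : ℝ) ^ n * (A m * (3 * C * minProd l (η m) * D m)) * ((σ + τ) ^ k * M k)
        = 3 ^ n * (3 * C) * ((σ + τ) ^ k * M k) * (A m * (minProd l (η m) * D m)) := by ring
      _ ≤ _ := mul_le_mul_of_nonneg_left (h₁ m) (by positivity)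

end Gluing

/-! ### Choice of constants and surjectivity -/

theorem IsWeightFunction.mem_ultraFun {ω : ℝ → ℝ} (hω : IsWeightFunction ω) {M : ℕ → ℝ}
    (hM : M ∈ weightMatrix ω) {n : ℕ} (f : SmoothFun n) {B ρ : ℝ} (hB : 0 ≤ B) (hρ : 0 ≤ ρ)
    (h : ∀ x, DerivBound M f.1 x B ρ) : f ∈ ultraFun ω n := by
  obtain ⟨y, hy, rfl⟩ := hM
  obtain ⟨z, hz, C, hC, hCz⟩ := hω.exists_weightSeq_pow_mul hy ρ hρ
  obtain ⟨r, hr⟩ := exists_nat_ge z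
  have hr0 : 0 < r := by exact_mod_cast hz.trans_le hr
  refine ⟨r, hr0, B * C, fun α x => ?_⟩
  rw [Real.exp_neg, ← div_eq_mul_inv, div_le_iff₀ (Real.exp_pos _)]
  refine (abs_mderiv_le α f.2 x).trans ((h x (len α)).trans ?_)
  rw [mul_assoc]
  refine mul_le_mul_of_nonneg_left ((hCz _).trans ?_) hB
  exact mul_le_mul_of_nonneg_left (hω.weightSeq_mono hz hr _) hC.le

/-- Polynomial derivatives are bounded in the form `k! / r^k`; this converts them to the class of
`M` at the price `1 / minProd l ε`. -/
theorem factorial_div_pow_le {l M : ℕ → ℝ} (hl : IsGrowing l) (hM : IsLogConvexSeq M) {C ε r : ℝ}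
    (hε : 0 < ε) (hr : ε ≤ r) (hlM : ∀ i : ℕ, (i + 1) * l i ≤ C * quot M (i + 1)) (k : ℕ) :
    (k ! : ℝ) / r ^ k ≤ 1 / minProd l ε * (C ^ k * M k) := by
  have h1 : (k ! : ℝ) * ∏ i ∈ Finset.range k, l i ≤ C ^ k * M k := by
    rw [← prod_succ_mul, hM.eq_prod k, ← Finset.card_range k, ← Finset.prod_const,
      Finset.card_range, ← Finset.prod_mul_distrib]
    exact Finset.prod_le_prod (fun i _ => mul_nonneg (by positivity) (hl.pos i).le)
      fun i _ => hlM i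
  have h2 := hl.minProd_le hε k
  rw [Finset.prod_mul_distrib, Finset.prod_const, Finset.card_range] at h2
  have hm := hl.minProd_pos hε
  have hr0 : 0 < r := hε.trans_le hr
  have hP : 0 < ∏ i ∈ Finset.range k, l i := Finset.prod_pos fun i _ => hl.pos i
  rw [div_mul_eq_mul_div, one_mul, div_le_div_iff₀ (by positivity) hm]
  calc (k ! : ℝ) * minProd l ε ≤ k ! * ((∏ i ∈ Finset.range k, l i) * ε ^ k) := by gcongr
    _ ≤ k ! * ((∏ i ∈ Finset.range k, l i) * r ^ k) := by gcongr
    _ = (k ! * ∏ i ∈ Finset.range k, l i) * r ^ k := by ring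
    _ ≤ _ := by gcongr

/-- Everything is compared at the smallest scale `ε = δ / (2 e)`, with `g = minProd l₂ ε`. Of the
power `g^{2n+2}`, the two cut-off factors consume `2n` and `1 / minProd l₂ δ` one; the last
satisfies `g ≤ l₂ 0 * ε` and supplies the factor `δ`. -/
theorem cutoff_bounds {l₁ l₂ : ℕ → ℝ} (h₁ : IsGrowing l₁) (h₂ : IsGrowing l₂) (n : ℕ) {b C : ℝ}
    (hC : 0 < C) (h : ∀ ε, 0 < ε →
      minProd l₁ (b * (2 * Real.exp 1) * ε) ≤ C * minProd l₂ ε ^ (2 * n + 2)) (hb : 0 < b) {δ : ℝ}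
    (hδ : 0 < δ) :
    (2 / minProd l₂ (δ / Real.exp 1)) ^ n * ((2 / minProd l₂ (δ / 2 / Real.exp 1)) ^ n *
      (minProd l₁ (b * δ) * (1 / minProd l₂ δ))) ≤ 4 ^ n * C * l₂ 0 * δ := by
  have he : 1 ≤ Real.exp 1 := Real.one_le_exp zero_le_one
  have he0 : 0 < Real.exp 1 := Real.exp_pos 1
  set ε := δ / 2 / Real.exp 1 with hε
  have hε0 : 0 < ε := by positivity
  have hεδ : ε ≤ δ := by
    rw [hε, div_div, div_le_iff₀ (by positivity)]
    nlinarith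
  have hεδ' : ε ≤ δ / Real.exp 1 := by
    rw [hε]
    gcongr
    linarith
  set g := minProd l₂ ε with hg
  have hg0 : 0 < g := h₂.minProd_pos hε0
  have e1 := h₂.minProd_mono hε0 hεδ
  have e2 := h₂.minProd_mono hε0 hεδ'
  have e3 := h ε hε0
  rw [show b * (2 * Real.exp 1) * ε = b * δ by rw [hε]; field_simp] at e3
  have hm := (h₁.minProd_pos (mul_pos hb hδ)).le
  have hl0 := (h₂.pos 0).le
  calc (2 / minProd l₂ (δ / Real.exp 1)) ^ n * ((2 / g) ^ n *
        (minProd l₁ (b * δ) * (1 / minProd l₂ δ)))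
      ≤ (2 / g) ^ n * ((2 / g) ^ n * (C * g ^ (2 * n + 2) * (1 / g))) := by
        have := h₂.minProd_pos (div_pos hδ he0)
        have := h₂.minProd_pos hδ
        gcongr
    _ = 4 ^ n * C * g := by
        rw [show (4 : ℝ) = 2 * 2 by norm_num, mul_pow, div_pow, pow_add, two_mul n, pow_add]
        field_simp
    _ ≤ 4 ^ n * C * (l₂ 0 * δ) := by
        gcongr
        exact (h₂.minProd_le_mul hε0).trans (by gcongr)
    _ = _ := by ring

theorem IsAdmissibleWeight.surjOn_jetMap {ω : ℝ → ℝ} (hω : IsAdmissibleWeight ω)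
    (hstrong : ∀ W ∈ weightMatrix ω, ∃ W' ∈ weightMatrix ω,
      Dominated (recipTail (quot W')) (fun k => (k : ℝ) / quot W k))
    {n : ℕ} {E : Set (EuclideanSpace ℝ (Fin n))} (hE : Bornology.IsBounded E) :
    SurjOn (jetMap E) (ultraFun ω n) (whitneyJet ω E) := by
  have hWF := hω.isWeightFunction
  rintro F ⟨_, ⟨x, hx, rfl⟩, ρ, hρ, C, hC, hF₁, hF₂⟩
  -- A partition of unity has to attach a point of `E` to every cube, so the empty set is treated
  -- apart.
  rcases E.eq_empty_or_nonempty with rfl | hne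
  · refine ⟨⟨fun _ => 0, contDiff_const⟩, hWF.mem_ultraFun ⟨x, hx, rfl⟩ _ le_rfl le_rfl
      fun y k => ?_, Subsingleton.elim _ _⟩
    simp
  obtain ⟨x', hx', C₀, hC₀, hx'C⟩ := hWF.exists_weightSeq_pow_mul hx ρ hρ.le
  have he0 : 0 < Real.exp 1 := Real.exp_pos 1
  set b : ℝ := 48 * ((n : ℝ) + 1) ^ 2 with hb
  have hb0 : 0 < b := by positivity
  -- The factor `2 e` compensates the passage from `2^{-s}` to `2^{-s} / (2 e)`, the smallest scale
  -- at which `l₂` is evaluated in the step from `s` to `s + 1`.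
  obtain ⟨l₁, l₂, hl₁, hl₂, hxl₁, ⟨C₁, hC₁, h₁₂⟩, M, hMω, hcut⟩ :=
    hω.exists_extension_weights hstrong hx' (B := b * (2 * Real.exp 1)) (by positivity)
      (R := 2 * n + 2) (by omega)
  have hM := hWF.isLogConvexSeq hMω
  have hpow : ∀ k, ρ ^ k * weightSeq ω x k ≤ C₀ * (k ! * ∏ i ∈ Finset.range k, l₁ i) :=
    fun k => (hx'C k).trans (mul_le_mul_of_nonneg_left (hxl₁ k) hC₀.le)
  have hF : JetBound F (C * C₀) l₁ := by
    refine ⟨fun α a => (hF₁ α a).trans ?_, fun p α hα a b => (hF₂ p α hα a b).trans ?_⟩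
    · rw [mul_assoc, mul_assoc]
      exact mul_le_mul_of_nonneg_left (hpow _) hC.le
    · refine mul_le_mul_of_nonneg_right ?_ (by positivity)
      rw [mul_assoc, mul_assoc]
      exact mul_le_mul_of_nonneg_left (hpow _) hC.le
  obtain ⟨σ, hσ, hpart⟩ := hcut.exists_partition hl₂ hM
  obtain ⟨μ, τ, hτ, -, -, -, -, hlM⟩ := hcut
  set A : ℕ → ℝ := fun s => (2 / minProd l₂ ((1 / 2) ^ s / Real.exp 1)) ^ n with hA
  have hpos : ∀ s : ℕ, (0 : ℝ) < (1 / 2) ^ s := fun s => by positivity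
  have hm : ∀ s : ℕ, 0 < minProd l₂ ((1 / 2) ^ s / Real.exp 1) :=
    fun s => hl₂.minProd_pos (div_pos (hpos s) he0)
  have hP : ∀ s : ℕ, Nonempty (WhitneyPartition E M ((1 / 2) ^ s) (A s) (n * σ)) := by
    intro s
    obtain ⟨g, hg, hsupp, hsum, hbound⟩ := hpart ((1 / 2) ^ s) (hpos s)
    exact exists_whitneyPartition hE hne hM (hpos s) (div_pos two_pos (hm s)).le hσ.le hg hsupp
      hsum hbound
  have hA0 : ∀ s, 0 ≤ A s := fun s => pow_nonneg (div_pos two_pos (hm s)).le n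
  have hA1 : ∀ s, 1 ≤ A s := fun s => by
    refine one_le_pow₀ ((one_le_div (hm s)).2 ?_)
    linarith [hl₂.minProd_le_one (div_pos (hpos s) he0)]
  have hmD : ∀ s : ℕ, 0 ≤ minProd l₁ (b * (1 / 2) ^ s) * (1 / minProd l₂ ((1 / 2) ^ s)) := fun s =>
    mul_nonneg (hl₁.minProd_pos (mul_pos hb0 (hpos s))).le
      (one_div_pos.2 (hl₂.minProd_pos (hpos s))).le
  have hK : ∀ s : ℕ, A s * (A (s + 1) * (minProd l₁ (b * (1 / 2) ^ s) *
      (1 / minProd l₂ ((1 / 2) ^ s)))) ≤ 4 ^ n * C₁ * l₂ 0 * (1 / 2) ^ s := by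
    intro s
    have := cutoff_bounds hl₁ hl₂ n hC₁ h₁₂ hb0 (hpos s)
    simp only [hA]
    rwa [show ((1 / 2 : ℝ) ^ (s + 1)) = (1 / 2) ^ s / 2 by rw [pow_succ]; ring]
  have hl0 := hl₂.pos 0
  obtain ⟨f, hf, ⟨B, ρ', hB, hρ', hfb⟩, hfF⟩ := exists_extension (E := E) (η := fun s => b * (1 / 2) ^ s)
    (D := fun s => 1 / minProd l₂ ((1 / 2) ^ s)) (τ := τ) (K := 4 ^ n * C₁ * l₂ 0) hM
    (by positivity) hl₁ hF (fun s => (hP s).some) rfl hA0 (by positivity) hτ.le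
    (fun s => (one_div_pos.2 (hl₂.minProd_pos (hpos s))).le) (by positivity)
    (fun s k => factorial_div_pow_le hl₂ hM (hpos s) (le_mul_of_one_le_left (hpos s).le (by
      linarith [Nat.cast_nonneg (α := ℝ) n])) hlM k)
    -- The bound with one partition follows from the bound with two because `A (s + 1) ≥ 1`.
    (fun s => le_trans (mul_le_mul_of_nonneg_left
      (le_mul_of_one_le_left (hmD s) (hA1 (s + 1))) (hA0 s)) (hK s)) hK
  refine ⟨⟨f, hf⟩, hWF.mem_ultraFun hMω _ hB hρ' hfb, ?_⟩
  ext α a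
  exact hfF α a

end Ultradiff
end

theorem corollary5p9 (ω : ℝ → ℝ) (hω : Ultradiff.IsAdmissibleWeight ω)
    (hstrong : ∀ W ∈ Ultradiff.weightMatrix ω, ∃ W' ∈ Ultradiff.weightMatrix ω,
      Ultradiff.Dominated (Ultradiff.recipTail (Ultradiff.quot W'))
        (fun k => (k : ℝ) / Ultradiff.quot W k))
    (n : ℕ) (E : Set (EuclideanSpace ℝ (Fin n))) (hE : IsCompact E) :
    Set.MapsTo (Ultradiff.jetMap E) (Ultradiff.ultraFun ω n) (Ultradiff.whitneyJet ω E) ∧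
      Set.SurjOn (Ultradiff.jetMap E) (Ultradiff.ultraFun ω n) (Ultradiff.whitneyJet ω E) :=
  ⟨Ultradiff.mapsTo_jetMap ω E, hω.surjOn_jetMap hstrong hE.isBounded⟩
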